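/- Let $\varphi$ be a slowly varying function at infinity and let $\tau=\{\tau_0=0<\tau_1<\tau_2<\cdots\}$ be a recurrent renewal process, with law $\mathbf P$, whose increments are i.i.d. positive (finite) integers with $$\mathrm K(n)=\mathbf P(\tau_1=n)=\frac{1}{2\pi}\,\varphi(n)\,n^{-3/2}\quad(n\ge 1),\qquad \sum_{n\ge1}\mathrm K(n)=1 .$$ Let $\omega=(\omega_n)_{n}$ be i.i.d. real random variables, with law $\mathbb P$, with zero mean, unit variance and $\lambda(\beta):=\log\mathbb E[e^{\beta\omega_1}]<\infty$ for all $\beta\in\mathbb R$. For $\beta>0$, $h\in\mathbb R$ and $N\in\mathbb N$ set $$Z_N^{\beta,h,\omega}=\mathbf E\Big[\exp\Big(\sum_{n=1}^N(\beta\omega_n+h-\lambda(\beta))\mathbf 1_{\{n\in\tau\}}\Big)\mathbf 1_{\{N\in\tau\}}\Big],\qquad \mathtt F(\beta,h)=\lim_{N\to\infty}\frac1N\,\mathbb E\big[\log Z_N^{\beta,h,\omega}\big],$$ $$h_c(\beta)=\inf\{h\in\mathbb R:\mathtt F(\beta,h)>0\}.$$ Let $u(n)=\mathbf P(n\in\tau)$,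 $D(N)=\sum_{n=1}^N u(n)^2$ and, for $x>0$, $D^{-1}(x)=\max\{N\in\mathbb N: D(N)\le x\}$, with $D^{-1}(x)=\infty$ if $D(N)\le x$ for all $N$; powers follow the conventions $\infty^{-a}=0$ and $0^{-a}=\infty$ for $a>0$. Then for every $\varepsilon\in(0,1)$ there is $\beta_\varepsilon>0$ such that for all $\beta\in(0,\beta_\varepsilon]$ $$h_c(\beta)\le D^{-1}\big((1-\varepsilon)/\beta^2\big)^{-\frac12(1-\varepsilon)} .$$ Moreover, if $\lim_{n\to\infty}\varphi(n)=c_\varphi$ for some real $c_\varphi$, then (with $\log 0=-\infty$) $$\limsup_{\beta\downarrow0}\ \beta^2\log h_c(\beta)\le-\tfrac12\,(c_\varphi)^2 .$$ -/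

import Mathlib

open MeasureTheory ProbabilityTheory Filter Topology
open scoped ENNReal

namespace Pinning

noncomputable section

/-- Slow variation at infinity: `φ` is measurable, positive near infinity, and
`φ (c x) / φ x → 1` as `x → ∞`, for every `c > 0`. -/
structure SlowlyVarying (φ : ℝ → ℝ) : Prop where
  measurable : Measurable φ
  eventually_pos : ∀ᶠ x in atTop, 0 < φ x
  tendsto_ratio : ∀ c : ℝ, 0 < c → Tendsto (fun x => φ (c * x) / φ x) atTop (𝓝 1)

/-- The inter-arrival probabilities `K(n) = (2π)⁻¹ φ(n) n^{-3/2}`. -/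
def interArrival (φ : ℝ → ℝ) (n : ℕ) : ℝ :=
  (2 * Real.pi)⁻¹ * φ n * (n : ℝ) ^ (-(3 / 2) : ℝ)

section Renewal

variable {S : Type*} [MeasurableSpace S]

/-- `ξ 0, ξ 1, …` are the increments of a recurrent renewal process with inter-arrival law
`interArrival φ`: i.i.d. positive integers with `P (ξ i = n) = K(n)`, `n ≥ 1`. Recurrence is
the finiteness of the increments. -/
structure IsRenewalIncrements (P : Measure S) (ξ : ℕ → S → ℕ) (φ : ℝ → ℝ) : Prop where
  measurable : ∀ i, Measurable (ξ i)
  indep : iIndepFun ξ P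
  pos : ∀ i, ∀ᵐ s ∂P, 1 ≤ ξ i s
  law : ∀ i n, 1 ≤ n → P.real {s | ξ i s = n} = interArrival φ n

/-- The renewal set `τ = {τ₀ = 0 < τ₁ < τ₂ < …}`, where `τ_k = ξ 0 + … + ξ (k - 1)`. -/
def renewalSet (ξ : ℕ → S → ℕ) (s : S) : Set ℕ :=
  Set.range fun k => ∑ i ∈ Finset.range k, ξ i s

/-- The renewal mass function `u(n) = P (n ∈ τ)`. -/
def renewalMass (P : Measure S) (ξ : ℕ → S → ℕ) (n : ℕ) : ℝ :=
  P.real {s | n ∈ renewalSet ξ s}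

/-- `D(N) = ∑_{n=1}^N u(n)²`. -/
def D (P : Measure S) (ξ : ℕ → S → ℕ) (N : ℕ) : ℝ :=
  ∑ n ∈ Finset.Icc 1 N, renewalMass P ξ n ^ 2

/-- `D⁻¹(x) = max {N ∈ ℕ | D(N) ≤ x}`, equal to `∞` when `D(N) ≤ x` for every `N`. -/
def DInv (P : Measure S) (ξ : ℕ → S → ℕ) (x : ℝ) : ℕ∞ :=
  ⨆ N ∈ {N : ℕ | D P ξ N ≤ x}, (N : ℕ∞)

end Renewal

/-- `ω` is a sequence of i.i.d., centered random variables of unit variance, with exponential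
moments of all orders. -/
structure IsDisorder {Ω : Type*} [MeasurableSpace Ω] (Q : Measure Ω) (ω : ℕ → Ω → ℝ) :
    Prop where
  indep : iIndepFun ω Q
  identDistrib : ∀ n, IdentDistrib (ω n) (ω 0) Q Q
  integrable_exp : ∀ t : ℝ, Integrable (fun w => Real.exp (t * ω 0 w)) Q
  mean_zero : ∫ w, ω 0 w ∂Q = 0
  unit_variance : variance (ω 0) Q = 1

section Model

variable {S : Type*} [MeasurableSpace S] {Ω : Type*} [MeasurableSpace Ω]

open Classical in
/-- The partition function with constrained end point, in the environment `η : ℕ → ℝ`, where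
`lam` stands for `λ(β)`:
`Z_N = E [exp (∑_{n=1}^N (β η_n + h - λ(β)) 1_{n ∈ τ}) 1_{N ∈ τ}]`. -/
def partitionFunction (P : Measure S) (ξ : ℕ → S → ℕ) (lam β h : ℝ) (η : ℕ → ℝ) (N : ℕ) : ℝ :=
  ∫ s, Real.exp (∑ n ∈ Finset.Icc 1 N,
      (β * η n + h - lam) * (if n ∈ renewalSet ξ s then 1 else 0))
    * (if N ∈ renewalSet ξ s then 1 else 0) ∂P

/-- The free energy `F(β, h) = lim_N N⁻¹ E [log Z_N]`, with `λ(β) = log E [exp (β ω)]`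
(Mathlib's `cgf`). The limit exists; it is written as a lower limit in `[-∞, ∞]` so that the
expression carries no default value. -/
def freeEnergy (P : Measure S) (ξ : ℕ → S → ℕ) (Q : Measure Ω) (ω : ℕ → Ω → ℝ)
    (β h : ℝ) : EReal :=
  liminf (fun N : ℕ =>
    (((1 / (N : ℝ)) *
      ∫ w, Real.log (partitionFunction P ξ (cgf (ω 0) Q β) β h (fun n => ω n w) N) ∂Q : ℝ) :
        EReal)) atTop

/-- The quenched critical point `h_c(β) = inf {h ∈ ℝ | F(β, h) > 0}`, the infimum being taken
in `[-∞, ∞]`. -/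
def criticalPoint (P : Measure S) (ξ : ℕ → S → ℕ) (Q : Measure Ω) (ω : ℕ → Ω → ℝ)
    (β : ℝ) : EReal :=
  ⨅ h ∈ {h : ℝ | 0 < freeEnergy P ξ Q ω β h}, (h : EReal)

end Model

end

end Pinning

/-! At `h = 0` the weights `exp (β ω_n - λ(β))` are independent with mean one, and a Taylor
expansion of the moment generating function bounds their variance `v` by `(1 + o(1)) β²`. Uncovering
the sites one at a time writes the free partition function on `[0, M]` as one plus orthogonal
martingale increments. Each increment contains a partition function that expands in the same way, so
the second moments solve a renewal equation with kernel `v u(n)²`, and the total is at most `1 / (1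
- v D(M))` as long as `v D(M) < 1` (`chaos_sum_le`, `IsRandomWeight.integral_freeWeight_sq_le`).
This is how `D⁻¹((1 - ε) / β²)` enters: up to that length the disorder is controlled in mean square.

Now keep only the paths with at least `L = M^(1/2 - ε/4)` points in `[0, M]`. Since `E [min (τ₁ / M)
1]` is at most `M^(-1/2)` up to small powers, these paths carry at least half of the mean
(`SlowlyVarying.truncMean_le`, `one_sub_truncMean_le_stepMass`). A Paley-Zygmund argument then makes
their weight at least `1/4` with probability bounded below uniformly in `β`. A field `h` multiplies
that weight by at least `exp (h L)`. For `h = N^(-(1 - ε)/2)` and `M = N / 2` the expected logarithm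
gains a power of `N`, whereas forcing the end point `N` costs only `O(log N)`. Hence the expected
log partition function is positive at one large `N`, and superadditivity turns this into positive
free energy (`le_logPartition`, `exists_eventually_le_logPartition`, `exists_freeEnergy_pos`).

For the second claim with `c > 0` it remains to show `D(N) ≤ (1 + δ) c⁻² log N` for large `N`
(`eventually_D_le`). Pointwise asymptotics of `u` are not needed. The kernel is compared with the
first return law of simple random walk at even times, whose generating function satisfies `|1 -
f(z)| = |1 - z|^(1/2)` exactly. This bounds the squared modulus of the generating function of `u` in
the unit disc by a constant plus nearly `π / c²` times that of the central binomial probabilities.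
Parseval's identity carries the comparison over to sums of squares, and Wallis' product supplies the
remaining logarithm. -/

namespace Pinning

noncomputable section

/-! ### Deterministic weighted renewal paths -/

/-- The total weight of the paths `0 = τ₀ < τ₁ < ⋯ < τ_k = N` with exactly `k` steps, a path
having weight `∏ i < k, K (τ_{i+1} - τ_i) * w τ_{i+1}`. -/
def stepWeight (K w : ℕ → ℝ) : ℕ → ℕ → ℝ
  | 0, N => if N = 0 then 1 else 0
  | k + 1, N => w N * ∑ m ∈ Finset.range N, stepWeight K w k m * K (N - m)

/-- The total weight of the paths from `0` to `N`. -/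
def totalWeight (K w : ℕ → ℝ) (N : ℕ) : ℝ :=
  ∑ k ∈ Finset.range (N + 1), stepWeight K w k N

/-- The total weight of the paths from `0` to `N`, the last point not being counted. -/
def preWeight (K w : ℕ → ℝ) (N : ℕ) : ℝ :=
  ∑ m ∈ Finset.range N, totalWeight K w m * K (N - m)

/-- The tail `1 - ∑_{n=1}^j K(n)`. -/
def tail (K : ℕ → ℝ) (j : ℕ) : ℝ := 1 - ∑ n ∈ Finset.range j, K (n + 1)

section Weights

variable {K w : ℕ → ℝ}

lemma stepWeight_nonneg (hK : ∀ n, 0 ≤ K n) (hw : ∀ n, 0 ≤ w n) (k N : ℕ) :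
    0 ≤ stepWeight K w k N := by
  induction k generalizing N with
  | zero => simp only [stepWeight]; split_ifs <;> norm_num
  | succ k ih =>
    exact mul_nonneg (hw N) (Finset.sum_nonneg fun m _ => mul_nonneg (ih m) (hK _))

lemma stepWeight_eq_zero {k N : ℕ} (h : N < k) : stepWeight K w k N = 0 := by
  induction k generalizing N with
  | zero => omega
  | succ k ih =>
    rw [stepWeight, Finset.sum_eq_zero, mul_zero]
    intro m hm
    rw [ih (by have := Finset.mem_range.1 hm; omega), zero_mul]

lemma totalWeight_eq_sum {N R : ℕ} (h : N < R) :
    totalWeight K w N = ∑ k ∈ Finset.range R, stepWeight K w k N := by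
  refine Finset.sum_subset (Finset.range_subset_range.2 h) fun k _ hk => stepWeight_eq_zero ?_
  simpa [Nat.lt_succ_iff] using hk

lemma totalWeight_nonneg (hK : ∀ n, 0 ≤ K n) (hw : ∀ n, 0 ≤ w n) (N : ℕ) :
    0 ≤ totalWeight K w N :=
  Finset.sum_nonneg fun k _ => stepWeight_nonneg hK hw k N

@[simp] lemma totalWeight_zero : totalWeight K w 0 = 1 := by
  simp [totalWeight, stepWeight]

lemma stepWeight_succ (k N : ℕ) : stepWeight K w (k + 1) N =
    w N * ∑ m ∈ Finset.range N, stepWeight K w k m * K (N - m) := rfl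

/-- Splitting off the last jump isolates the factor `w N`. The other factor involves only earlier
weights, which is the source of all independence used later. -/
lemma totalWeight_eq_mul_preWeight {N : ℕ} (hN : N ≠ 0) :
    totalWeight K w N = w N * preWeight K w N := by
  rw [totalWeight, Finset.sum_range_succ']
  simp only [stepWeight_succ]
  rw [stepWeight, if_neg hN, add_zero, ← Finset.mul_sum, Finset.sum_comm, preWeight]
  congr 1
  refine Finset.sum_congr rfl fun m hm => ?_
  rw [← Finset.sum_mul, ← totalWeight_eq_sum (Finset.mem_range.1 hm)]

lemma totalWeight_congr {w' : ℕ → ℝ} {N : ℕ} (h : ∀ n, 1 ≤ n → n ≤ N → w n = w' n) :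
    totalWeight K w N = totalWeight K w' N := by
  induction N using Nat.strong_induction_on with
  | _ N ih =>
    rcases eq_or_ne N 0 with rfl | hN
    · simp
    · rw [totalWeight_eq_mul_preWeight hN, totalWeight_eq_mul_preWeight hN,
        h N (by omega) le_rfl, preWeight, preWeight]
      congr 1
      refine Finset.sum_congr rfl fun m hm => ?_
      have := Finset.mem_range.1 hm
      rw [ih m this fun n h1 h2 => h n h1 (by omega)]

lemma preWeight_congr {w' : ℕ → ℝ} {N : ℕ} (h : ∀ n, 1 ≤ n → n < N → w n = w' n) :
    preWeight K w N = preWeight K w' N := by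
  refine Finset.sum_congr rfl fun m hm => ?_
  have := Finset.mem_range.1 hm
  rw [totalWeight_congr fun n h1 h2 => h n h1 (by omega)]

lemma stepWeight_congr {w' : ℕ → ℝ} {k N : ℕ} (h : ∀ n, 1 ≤ n → n ≤ N → w n = w' n) :
    stepWeight K w k N = stepWeight K w' k N := by
  induction k generalizing N with
  | zero => rfl
  | succ k ih =>
    rcases eq_or_ne N 0 with rfl | hN
    · simp [stepWeight]
    · rw [stepWeight, stepWeight, h N (by omega) le_rfl]
      congr 1
      refine Finset.sum_congr rfl fun m hm => ?_
      have := Finset.mem_range.1 hm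
      rw [ih fun n h1 h2 => h n h1 (by omega)]

lemma preWeight_nonneg (hK : ∀ n, 0 ≤ K n) (hw : ∀ n, 0 ≤ w n) (N : ℕ) :
    0 ≤ preWeight K w N :=
  Finset.sum_nonneg fun m _ => mul_nonneg (totalWeight_nonneg hK hw m) (hK _)

lemma le_preWeight (hK : ∀ n, 0 ≤ K n) (hw : ∀ n, 0 ≤ w n) {N : ℕ} (hN : N ≠ 0) :
    K N ≤ preWeight K w N := by
  have := Finset.single_le_sum (f := fun m => totalWeight K w m * K (N - m))
    (fun m _ => mul_nonneg (totalWeight_nonneg hK hw m) (hK _))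
    (Finset.mem_range.2 (Nat.pos_of_ne_zero hN))
  simpa [preWeight] using this

/-- With `c = exp h`, this is how the field rewards a path according to its number of points. -/
lemma stepWeight_const_mul (c : ℝ) (k N : ℕ) :
    stepWeight K (fun n => c * w n) k N = c ^ k * stepWeight K w k N := by
  induction k generalizing N with
  | zero => simp [stepWeight]
  | succ k ih =>
    simp only [stepWeight, ih, Finset.mul_sum]
    refine Finset.sum_congr rfl fun m _ => ?_
    ring

/-- The left side counts only the paths to `M + N` that visit `N`. This yields superadditivity of
the expected logarithm. -/
lemma totalWeight_mul_le (hK : ∀ n, 0 ≤ K n) (hw : ∀ n, 0 ≤ w n) (N M : ℕ) :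
    totalWeight K w N * totalWeight K (fun n => w (n + N)) M ≤ totalWeight K w (M + N) := by
  induction M using Nat.strong_induction_on with
  | _ M ih =>
    rcases eq_or_ne M 0 with rfl | hM
    · simp
    · rw [totalWeight_eq_mul_preWeight hM, totalWeight_eq_mul_preWeight (N := M + N) (by omega)]
      rw [mul_left_comm]
      refine mul_le_mul_of_nonneg_left ?_ (hw _)
      rw [preWeight, preWeight, Finset.mul_sum, add_comm M N, Finset.sum_range_add]
      refine le_add_of_nonneg_of_le
        (Finset.sum_nonneg fun m _ => mul_nonneg (totalWeight_nonneg hK hw m) (hK _)) ?_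
      refine Finset.sum_le_sum fun m hm => ?_
      rw [← mul_assoc, Nat.add_sub_add_left, add_comm N m]
      exact mul_le_mul_of_nonneg_right (ih m (Finset.mem_range.1 hm)) (hK _)

lemma sum_range_mul_sub (f : ℕ → ℝ) (g : ℕ → ℕ → ℝ) (M : ℕ) :
    ∑ n ∈ Finset.range (M + 1), ∑ m ∈ Finset.range n, f m * g m (n - m)
      = ∑ m ∈ Finset.range (M + 1), f m * ∑ j ∈ Finset.range (M - m), g m (j + 1) := by
  induction M with
  | zero => simp
  | succ M ih =>
    rw [Finset.sum_range_succ, ih, Finset.sum_range_succ (n := M + 1), Nat.sub_self,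
      Finset.sum_range_zero, mul_zero, add_zero, ← Finset.sum_add_distrib]
    refine Finset.sum_congr rfl fun m hm => ?_
    have := Finset.mem_range.1 hm
    rw [show M + 1 - m = (M - m) + 1 by omega, Finset.sum_range_succ, mul_add]

/-- The partition function on `[0, M]` with free end point. -/
def freeWeight (K w : ℕ → ℝ) (M : ℕ) : ℝ :=
  ∑ m ∈ Finset.range (M + 1), totalWeight K w m * tail K (M - m)

lemma tail_zero : tail K 0 = 1 := by simp [tail]

lemma tail_succ (j : ℕ) : tail K (j + 1) = tail K j - K (j + 1) := by
  simp only [tail, Finset.sum_range_succ]; ring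

/-- A new site `M + 1` removes `preWeight K w (M + 1)` from the tails and restores it multiplied by
`w (M + 1)`. For independent weights of mean one the summands are martingale increments. -/
lemma freeWeight_eq (M : ℕ) : freeWeight K w M =
    1 + ∑ n ∈ Finset.range M, (w (n + 1) - 1) * preWeight K w (n + 1) := by
  induction M with
  | zero => simp [freeWeight, tail_zero]
  | succ M ih =>
    rw [Finset.sum_range_succ, ← add_assoc, ← ih, freeWeight, Finset.sum_range_succ,
      Nat.sub_self, tail_zero, mul_one, totalWeight_eq_mul_preWeight (Nat.succ_ne_zero M),
      sub_mul, one_mul]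
    have : ∑ m ∈ Finset.range (M + 1), totalWeight K w m * tail K (M + 1 - m) =
        freeWeight K w M - preWeight K w (M + 1) := by
      rw [freeWeight, preWeight, ← Finset.sum_sub_distrib]
      refine Finset.sum_congr rfl fun m hm => ?_
      have := Finset.mem_range.1 hm
      rw [show M + 1 - m = (M - m) + 1 by omega, tail_succ]; ring
    rw [this, Nat.succ_eq_add_one]; ring

/-- The renewal mass function of the kernel `K`. -/
abbrev mass (K : ℕ → ℝ) : ℕ → ℝ := totalWeight K fun _ => 1

lemma mass_zero : mass K 0 = 1 := totalWeight_zero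

lemma mass_eq_preWeight {n : ℕ} (hn : n ≠ 0) : mass K n = preWeight K (fun _ => 1) n := by
  rw [mass, totalWeight_eq_mul_preWeight hn, one_mul]

/-- Expansion of the partition function along its last disordered point. -/
lemma totalWeight_eq_chaos (N : ℕ) : totalWeight K w N = mass K N +
    ∑ k ∈ Finset.range N, (w (k + 1) - 1) * preWeight K w (k + 1) * mass K (N - (k + 1)) := by
  induction N using Nat.strong_induction_on with
  | _ N ih =>
    rcases eq_or_ne N 0 with rfl | hN
    · simp
    obtain ⟨N, rfl⟩ := Nat.exists_eq_succ_of_ne_zero hN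
    simp only [Nat.succ_eq_add_one] at *
    set Y : ℕ → ℝ := fun k => (w (k + 1) - 1) * preWeight K w (k + 1) with hY
    have key : preWeight K w (N + 1) = mass K (N + 1) +
        ∑ k ∈ Finset.range N, Y k * mass K (N + 1 - (k + 1)) := by
      rw [preWeight, Finset.sum_congr rfl fun m hm => by rw [ih m (Finset.mem_range.1 hm)]]
      simp only [add_mul, Finset.sum_add_distrib]
      rw [mass_eq_preWeight (n := N + 1) (by omega)]
      congr 1
      simp only [Finset.sum_mul]
      -- For a fixed disordered site `k + 1`, the last renewal point `m` is replaced by its distance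
      -- `m - (k + 1)`. The inner sum then becomes the renewal equation for `mass K (N - k)`.
      rw [Finset.sum_sigma', Finset.sum_congr rfl (g := fun k => ∑ m ∈ Finset.range (N - k),
        Y k * (mass K m * K (N - k - m)))]
      · rw [Finset.sum_sigma']
        refine Finset.sum_nbij' (fun x => ⟨x.2, x.1 - (x.2 + 1)⟩)
          (fun x => ⟨x.2 + (x.1 + 1), x.1⟩) ?_ ?_ ?_ ?_ ?_
        · rintro ⟨m, k⟩ h; simp at h ⊢; omega
        · rintro ⟨m, k⟩ h; simp at h ⊢; omega
        · rintro ⟨m, k⟩ h; simp at h ⊢; omega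
        · rintro ⟨m, k⟩ h; simp at h ⊢
        · rintro ⟨m, k⟩ h
          simp at h ⊢
          rw [show N - k - (m - (k + 1)) = N + 1 - m by omega, hY]
          ring
      · intro k hk
        have := Finset.mem_range.1 hk
        rw [show N + 1 - (k + 1) = N - k by omega, mass_eq_preWeight (by omega), preWeight,
          Finset.mul_sum]
    rw [totalWeight_eq_mul_preWeight (by omega), Finset.sum_range_succ, Nat.sub_self,
      mass_zero, mul_one, ← add_assoc, ← key]
    ring

lemma preWeight_eq_chaos {N : ℕ} (hN : N ≠ 0) : preWeight K w N = mass K N +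
    ∑ k ∈ Finset.range (N - 1),
      (w (k + 1) - 1) * preWeight K w (k + 1) * mass K (N - (k + 1)) := by
  obtain ⟨N, rfl⟩ := Nat.exists_eq_succ_of_ne_zero hN
  have h := totalWeight_eq_chaos (K := K) (w := w) (N + 1)
  rw [totalWeight_eq_mul_preWeight (by omega), Finset.sum_range_succ, Nat.sub_self,
    mass_zero] at h
  simp only [Nat.succ_eq_add_one, Nat.add_sub_cancel] at *
  linarith

/-- The probability that the `L`-th renewal point is at most `M`. -/
def stepMass (K : ℕ → ℝ) (L M : ℕ) : ℝ :=
  ∑ m ∈ Finset.range (M + 1), stepWeight K (fun _ => 1) L m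

lemma tail_nonneg (hK : ∀ n, 0 ≤ K n) (hs : HasSum (fun n => K (n + 1)) 1) (j : ℕ) :
    0 ≤ tail K j :=
  sub_nonneg.2 (sum_le_hasSum _ (fun _ _ => hK _) hs)

lemma tail_le_one (hK : ∀ n, 0 ≤ K n) (j : ℕ) : tail K j ≤ 1 :=
  sub_le_self _ (Finset.sum_nonneg fun _ _ => hK _)

lemma stepMass_succ (k M : ℕ) : stepMass K (k + 1) M =
    ∑ m ∈ Finset.range (M + 1), stepWeight K (fun _ => 1) k m * (1 - tail K (M - m)) := by
  simp only [stepMass, stepWeight_succ, one_mul, tail, sub_sub_cancel]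
  exact sum_range_mul_sub _ (fun _ => K) M

/-- The `L`-th point lies in `[0, M]` exactly when the last point of `[0, M]` has index at least
`L`. Algebraically, `stepMass K k M - stepMass K (k + 1) M` telescopes, and ends at zero because `M`
sites cannot hold more than `M` steps. -/
lemma stepMass_eq_sum_tail (L M : ℕ) : stepMass K L M =
    ∑ m ∈ Finset.range (M + 1), (∑ k ∈ Finset.Ico L (M + 1 + L), stepWeight K (fun _ => 1) k m)
      * tail K (M - m) := by
  have h1 : ∀ k, ∑ m ∈ Finset.range (M + 1), stepWeight K (fun _ => 1) k m * tail K (M - m)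
      = stepMass K k M - stepMass K (k + 1) M := by
    intro k
    rw [stepMass_succ, stepMass, ← Finset.sum_sub_distrib]
    exact Finset.sum_congr rfl fun m _ => by ring
  simp only [Finset.sum_mul]
  rw [Finset.sum_comm, Finset.sum_congr rfl fun k _ => h1 k, Finset.sum_Ico_eq_sum_range,
    Nat.add_sub_cancel]
  have := Finset.sum_range_sub' (fun i => stepMass K (L + i) M) (M + 1)
  simp only [add_assoc, add_zero] at this ⊢
  rw [this]
  have h0 : stepMass K (L + (M + 1)) M = 0 :=
    Finset.sum_eq_zero fun m hm => stepWeight_eq_zero (by have := Finset.mem_range.1 hm; omega)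
  rw [h0, sub_zero]

lemma stepMass_le_one (hK : ∀ n, 0 ≤ K n) (hs : HasSum (fun n => K (n + 1)) 1) (L M : ℕ) :
    stepMass K L M ≤ 1 := by
  induction L with
  | zero => simp [stepMass, stepWeight]
  | succ L ih =>
    refine le_trans ?_ ih
    rw [stepMass_succ]
    refine Finset.sum_le_sum fun _ _ => mul_le_of_le_one_right
      (stepWeight_nonneg hK (fun _ => zero_le_one) _ _) (sub_le_self _ (tail_nonneg hK hs _))

/-- The truncated first moment `E [min (τ₁ / M) 1]`. -/
def truncMean (K : ℕ → ℝ) (M : ℕ) : ℝ :=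
  1 - ∑ n ∈ Finset.range M, K (n + 1) * (1 - ((n + 1 : ℕ) : ℝ) / M)

/-- Test the walk against `g m = 1 - m / M`, set to zero beyond `M`. One jump lowers the expectation
of `g` by at most `truncMean K M`, so after `L` jumps at least `1 - L * truncMean K M` is left;
finally `g ≤ 1`. -/
lemma one_sub_truncMean_le_stepMass (hK : ∀ n, 0 ≤ K n) (hs : HasSum (fun n => K (n + 1)) 1)
    {M : ℕ} (hM : M ≠ 0) (L : ℕ) : 1 - L * truncMean K M ≤ stepMass K L M := by
  have hM0 : (0 : ℝ) < M := by positivity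
  set g : ℕ → ℝ := fun m => 1 - (m : ℝ) / M with hg
  have hκ0 : 0 ≤ truncMean K M := by
    have : ∑ n ∈ Finset.range M, K (n + 1) * g (n + 1) ≤ ∑ n ∈ Finset.range M, K (n + 1) :=
      Finset.sum_le_sum fun n _ => mul_le_of_le_one_right (hK _) (sub_le_self _ (by positivity))
    have h2 := tail_nonneg hK hs M
    rw [tail] at h2
    rw [truncMean]; linarith
  have key : ∀ m ≤ M, g m - truncMean K M ≤
      ∑ j ∈ Finset.range (M - m), K (j + 1) * g (m + (j + 1)) := by
    intro m hm
    have hgm : g m ≤ 1 := sub_le_self _ (by positivity)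
    -- Jumps that leave `[0, M]` contribute nonpositive terms to the longer sum, so they may be
    -- added.
    have h1 : ∑ j ∈ Finset.range M, K (j + 1) * (g m - ((j + 1 : ℕ) : ℝ) / M) ≤
        ∑ j ∈ Finset.range (M - m), K (j + 1) * g (m + (j + 1)) := by
      rw [← Finset.sum_range_add_sum_Ico _ (Nat.sub_le M m)]
      refine le_trans (add_le_of_nonpos_right ?_) (le_of_eq ?_)
      · refine Finset.sum_nonpos fun j hj => mul_nonpos_of_nonneg_of_nonpos (hK _) ?_
        have h3 : M ≤ m + (j + 1) := by have := Finset.mem_Ico.1 hj; omega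
        have h4 : (1 : ℝ) ≤ (m : ℝ) / M + ((j + 1 : ℕ) : ℝ) / M := by
          rw [← add_div, one_le_div hM0]; exact_mod_cast h3
        simp only [hg]; linarith
      · refine Finset.sum_congr rfl fun j _ => ?_
        simp only [hg]; push_cast; ring
    have h5 : ∑ j ∈ Finset.range M, K (j + 1) * (g m - ((j + 1 : ℕ) : ℝ) / M) =
        (g m - 1) * ∑ j ∈ Finset.range M, K (j + 1) + (1 - truncMean K M) := by
      rw [truncMean, sub_sub_cancel, Finset.mul_sum, ← Finset.sum_add_distrib]
      exact Finset.sum_congr rfl fun j _ => by ring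
    have h6 := tail_nonneg hK hs M
    rw [tail] at h6
    have h7 : g m - 1 ≤ (g m - 1) * ∑ j ∈ Finset.range M, K (j + 1) := by nlinarith
    linarith
  have ind : ∀ L : ℕ, 1 - L * truncMean K M ≤
      ∑ m ∈ Finset.range (M + 1), stepWeight K (fun _ => 1) L m * g m := by
    intro L
    induction L with
    | zero => simp [stepWeight, hg]
    | succ L ih =>
      have h1 : ∑ m ∈ Finset.range (M + 1), stepWeight K (fun _ => 1) (L + 1) m * g m =
          ∑ m ∈ Finset.range (M + 1), stepWeight K (fun _ => 1) L m *
            ∑ j ∈ Finset.range (M - m), K (j + 1) * g (m + (j + 1)) := by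
        rw [← sum_range_mul_sub _ (fun m j => K j * g (m + j)) M]
        refine Finset.sum_congr rfl fun n _ => ?_
        rw [stepWeight_succ, one_mul, Finset.sum_mul]
        refine Finset.sum_congr rfl fun m hm => ?_
        rw [Nat.add_sub_cancel' (Finset.mem_range.1 hm).le, mul_assoc]
      have h2 : ∑ m ∈ Finset.range (M + 1), stepWeight K (fun _ => 1) L m *
            (g m - truncMean K M) ≤
          ∑ m ∈ Finset.range (M + 1), stepWeight K (fun _ => 1) (L + 1) m * g m := by
        rw [h1]
        exact Finset.sum_le_sum fun m hm => mul_le_mul_of_nonneg_left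
          (key m (Nat.lt_succ_iff.1 (Finset.mem_range.1 hm)))
          (stepWeight_nonneg hK (fun _ => zero_le_one) _ _)
      have h3 : ∑ m ∈ Finset.range (M + 1), stepWeight K (fun _ => 1) L m *
            (g m - truncMean K M) =
          ∑ m ∈ Finset.range (M + 1), stepWeight K (fun _ => 1) L m * g m
            - stepMass K L M * truncMean K M := by
        rw [stepMass, Finset.sum_mul, ← Finset.sum_sub_distrib]
        exact Finset.sum_congr rfl fun m _ => by ring
      have h4 : stepMass K L M * truncMean K M ≤ truncMean K M :=
        mul_le_of_le_one_left hκ0 (stepMass_le_one hK hs L M)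
      push_cast
      linarith
  refine (ind L).trans (Finset.sum_le_sum fun _ _ => mul_le_of_le_one_right
    (stepWeight_nonneg hK (fun _ => zero_le_one) _ _) (sub_le_self _ (by positivity)))

lemma mass_nonneg (hK : ∀ n, 0 ≤ K n) (n : ℕ) : 0 ≤ mass K n :=
  totalWeight_nonneg hK (fun _ => zero_le_one) n

/-- The total weight, with free end point in `[0, M]`, of the paths with at least `L` steps. -/
def longWeight (K w : ℕ → ℝ) (L M : ℕ) : ℝ :=
  ∑ m ∈ Finset.range (M + 1), (∑ k ∈ Finset.Ico L (M + 1 + L), stepWeight K w k m)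
    * tail K (M - m)

lemma longWeight_nonneg (hK : ∀ n, 0 ≤ K n) (hs : HasSum (fun n => K (n + 1)) 1)
    (hw : ∀ n, 0 ≤ w n) (L M : ℕ) : 0 ≤ longWeight K w L M :=
  Finset.sum_nonneg fun _ _ => mul_nonneg
    (Finset.sum_nonneg fun _ _ => stepWeight_nonneg hK hw _ _) (tail_nonneg hK hs _)

lemma sum_Ico_stepWeight_le (hK : ∀ n, 0 ≤ K n) (hw : ∀ n, 0 ≤ w n) {L M m : ℕ} (hm : m ≤ M) :
    ∑ k ∈ Finset.Ico L (M + 1 + L), stepWeight K w k m ≤ totalWeight K w m := by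
  rw [totalWeight_eq_sum (show m < M + 1 + L by omega)]
  refine Finset.sum_le_sum_of_subset_of_nonneg (fun k hk => ?_)
    fun k _ _ => stepWeight_nonneg hK hw k m
  exact Finset.mem_range.2 (Finset.mem_Ico.1 hk).2

lemma longWeight_le_freeWeight (hK : ∀ n, 0 ≤ K n) (hs : HasSum (fun n => K (n + 1)) 1)
    (hw : ∀ n, 0 ≤ w n) (L M : ℕ) : longWeight K w L M ≤ freeWeight K w M :=
  Finset.sum_le_sum fun _ hm => mul_le_mul_of_nonneg_right
    (sum_Ico_stepWeight_le hK hw (Nat.lt_succ_iff.1 (Finset.mem_range.1 hm))) (tail_nonneg hK hs _)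

/-- A path with at least `L` points in `[0, M]`, followed by one jump to `N`. -/
lemma mul_longWeight_le_preWeight (hK : ∀ n, 0 ≤ K n)
    (hw : ∀ n, 0 ≤ w n) {L M N : ℕ} (hMN : M < N) {a c : ℝ} (hc : 1 ≤ c) (ha : 0 ≤ a)
    (haK : ∀ m ≤ M, a ≤ K (N - m)) :
    a * (c ^ L * longWeight K w L M) ≤ preWeight K (fun n => c * w n) N := by
  have hc0 : 0 ≤ c := zero_le_one.trans hc
  have hcw : ∀ n, 0 ≤ c * w n := fun n => mul_nonneg hc0 (hw n)
  rw [longWeight, preWeight, ← mul_assoc, Finset.mul_sum]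
  refine le_trans (Finset.sum_le_sum fun m hm => ?_) (Finset.sum_le_sum_of_subset_of_nonneg
    (Finset.range_subset_range.2 (show M + 1 ≤ N by omega))
    fun m _ _ => mul_nonneg (totalWeight_nonneg hK hcw m) (hK _))
  have hm' : m ≤ M := Nat.lt_succ_iff.1 (Finset.mem_range.1 hm)
  have h1 : c ^ L * ∑ k ∈ Finset.Ico L (M + 1 + L), stepWeight K w k m
      ≤ totalWeight K (fun n => c * w n) m := by
    refine le_trans ?_ (sum_Ico_stepWeight_le (L := L) hK hcw hm')
    rw [Finset.mul_sum]
    refine Finset.sum_le_sum fun k hk => ?_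
    rw [stepWeight_const_mul]
    exact mul_le_mul_of_nonneg_right (pow_le_pow_right₀ hc (Finset.mem_Ico.1 hk).1)
      (stepWeight_nonneg hK hw _ _)
  have hS : 0 ≤ ∑ k ∈ Finset.Ico L (M + 1 + L), stepWeight K w k m :=
    Finset.sum_nonneg fun _ _ => stepWeight_nonneg hK hw _ _
  calc a * c ^ L * ((∑ k ∈ Finset.Ico L (M + 1 + L), stepWeight K w k m) * tail K (M - m))
      ≤ a * c ^ L * ((∑ k ∈ Finset.Ico L (M + 1 + L), stepWeight K w k m) * 1) := by
        gcongr; exact tail_le_one hK _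
    _ = (c ^ L * ∑ k ∈ Finset.Ico L (M + 1 + L), stepWeight K w k m) * a := by ring
    _ ≤ _ := mul_le_mul h1 (haK m hm') ha (totalWeight_nonneg hK hcw m)

/-- Total mass of the chaos expansion with second moments `s`. -/
lemma chaos_sum_le {u R : ℕ → ℝ} {s d : ℝ} {M : ℕ} (hR : ∀ n, 0 ≤ R n) (hs : 0 ≤ s)
    (hRu : ∀ n < M, R n = s * (u (n + 1) ^ 2 +
      ∑ k ∈ Finset.range n, R k * u (n + 1 - (k + 1)) ^ 2))
    (hd : s * ∑ n ∈ Finset.range M, u (n + 1) ^ 2 ≤ d) (hd1 : d < 1) :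
    1 + ∑ n ∈ Finset.range M, R n ≤ 1 / (1 - d) := by
  set T := ∑ n ∈ Finset.range M, R n with hT
  set V := ∑ n ∈ Finset.range M, u (n + 1) ^ 2 with hV
  have hT0 : 0 ≤ T := Finset.sum_nonneg fun n _ => hR n
  -- Exchanging the sums and extending every inner sum of squares to the whole range closes the
  -- recursion as `T ≤ d (1 + T)`.
  have h1 : T ≤ s * (V + T * V) := by
    have h0 : T = s * (V + ∑ n ∈ Finset.range M,
        ∑ k ∈ Finset.range n, R k * u (n + 1 - (k + 1)) ^ 2) := by
      rw [hT, Finset.sum_congr rfl fun n hn => hRu n (Finset.mem_range.1 hn), ← Finset.mul_sum,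
        Finset.sum_add_distrib]
    refine h0.trans_le ?_
    refine mul_le_mul_of_nonneg_left (add_le_add le_rfl ?_) hs
    rcases M with _ | M
    · simp [hT]
    have h2 := sum_range_mul_sub R (fun _ j => u j ^ 2) M
    have h3 : ∀ n k, n + 1 - (k + 1) = n - k := fun n k => by omega
    simp only [h3]
    rw [h2, hT, Finset.sum_mul]
    refine Finset.sum_le_sum fun m _ => mul_le_mul_of_nonneg_left ?_ (hR m)
    exact Finset.sum_le_sum_of_subset_of_nonneg
      (Finset.range_subset_range.2 (by omega)) fun _ _ _ => sq_nonneg _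
  rw [le_div_iff₀ (by linarith)]
  nlinarith

end Weights

/-! ### From the renewal process to path weights -/

lemma indepFun_of_dependsOn {α E β γ : Type*} [MeasurableSpace α] [MeasurableSpace E]
    [Inhabited E] [MeasurableSpace β] [MeasurableSpace γ] {μ : Measure α} {X : ℕ → α → E}
    (hX : iIndepFun X μ) (hm : ∀ i, AEMeasurable (X i) μ) {F : (ℕ → E) → β} {G : (ℕ → E) → γ}
    {s t : Finset ℕ} (hst : Disjoint s t) (hF : Measurable F) (hG : Measurable G)
    (hFs : DependsOn F s) (hGt : DependsOn G t) :
    IndepFun (fun a => F fun n => X n a) (fun a => G fun n => X n a) μ := by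
  classical
  -- Coordinates outside the block are filled with `default`, which the function does not see. This
  -- reduces the claim to independence of finite blocks.
  let e : ∀ r : Finset ℕ, (r → E) → ℕ → E := fun r y n => if h : n ∈ r then y ⟨n, h⟩ else default
  have he : ∀ r, Measurable (e r) := by
    intro r
    refine measurable_pi_lambda _ fun n => ?_
    by_cases h : n ∈ r
    · simpa [e, h] using measurable_pi_apply _
    · simp [e, h]
  have h := (hX.indepFun_finset₀ s t hst hm).comp (hF.comp (he s)) (hG.comp (he t))
  convert h using 1
  · funext a
    exact hFs fun i hi => by simp [e, Finset.mem_coe.1 hi]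
  · funext a
    exact hGt fun i hi => by simp [e, Finset.mem_coe.1 hi]

/-- The position after `k` steps. -/
def position (x : ℕ → ℕ) (k : ℕ) : ℕ := ∑ i ∈ Finset.range k, x i

/-- The weight of the first `k` steps on the event that they lead to `N`. -/
def pathWeight (w : ℕ → ℝ) (k N : ℕ) (x : ℕ → ℕ) : ℝ :=
  if position x k = N then ∏ i ∈ Finset.range k, w (position x (i + 1)) else 0

lemma position_succ (x : ℕ → ℕ) (k : ℕ) : position x (k + 1) = position x k + x k :=
  Finset.sum_range_succ _ _

lemma measurable_position (k : ℕ) : Measurable fun x : ℕ → ℕ => position x k := by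
  unfold position; fun_prop

lemma measurable_pathWeight (w : ℕ → ℝ) (k N : ℕ) : Measurable (pathWeight w k N) := by
  refine Measurable.ite (measurable_position k (measurableSet_singleton N)) ?_ measurable_const
  refine Finset.measurable_prod _ fun i _ => ?_
  exact (Measurable.of_discrete (f := w)).comp (measurable_position (i + 1))

lemma position_congr {x y : ℕ → ℕ} {k : ℕ} (h : ∀ i < k, x i = y i) :
    position x k = position y k :=
  Finset.sum_congr rfl fun i hi => h i (Finset.mem_range.1 hi)

lemma dependsOn_pathWeight (w : ℕ → ℝ) (k N : ℕ) :
    DependsOn (pathWeight w k N) (Finset.range k) := by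
  intro x y h
  have h' : ∀ i < k, x i = y i := fun i hi => h i (by simpa using hi)
  unfold pathWeight
  rw [position_congr h', Finset.prod_congr rfl fun i hi => by
    rw [position_congr fun j hj => h' j (by have := Finset.mem_range.1 hi; omega)]]

/-- Decomposition by the position before the last jump. Positivity of that jump places this position
strictly below `N`, so `Finset.range N` misses nothing. -/
lemma pathWeight_succ (w : ℕ → ℝ) (k N : ℕ) {x : ℕ → ℕ} (hx : 1 ≤ x k) :
    pathWeight w (k + 1) N x = w N * ∑ m ∈ Finset.range N,
      pathWeight w k m x * (if x k = N - m then 1 else 0) := by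
  unfold pathWeight
  by_cases h : position x (k + 1) = N
  · have h2 := h
    rw [position_succ] at h2
    rw [if_pos h, Finset.prod_range_succ, h, mul_comm,
      Finset.sum_eq_single_of_mem (position x k) (Finset.mem_range.2 (by omega))]
    · rw [if_pos rfl, if_pos (by omega), mul_one]
    · intro m _ hm
      rw [if_neg (Ne.symm hm), zero_mul]
  · rw [if_neg h, Finset.sum_eq_zero, mul_zero]
    intro m hm
    have := Finset.mem_range.1 hm
    rw [position_succ] at h
    by_cases h1 : position x k = m
    · rw [if_neg (show ¬ x k = N - m by omega), mul_zero]
    · rw [if_neg h1, zero_mul]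

section Renewal

variable {S : Type*} [MeasurableSpace S] {P : Measure S} [IsProbabilityMeasure P]
  {ξ : ℕ → S → ℕ} {φ : ℝ → ℝ}

/-- The weight of the first `k` jumps is independent of the jump `ξ k`, so taking expectations in
`pathWeight_succ` reproduces the recursion of `stepWeight`. -/
lemma integrable_pathWeight (hξ : IsRenewalIncrements P ξ φ) (w : ℕ → ℝ) (k N : ℕ) :
    Integrable (fun s => pathWeight w k N fun i => ξ i s) P ∧
      ∫ s, pathWeight w k N (fun i => ξ i s) ∂P = stepWeight (interArrival φ) w k N := by
  induction k generalizing N with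
  | zero =>
    by_cases h : N = 0
    · subst h; simp [pathWeight, position, stepWeight]
    · simp [pathWeight, position, stepWeight, h, Ne.symm h]
  | succ k ih =>
    have hae : (fun s => pathWeight w (k + 1) N fun i => ξ i s) =ᵐ[P] fun s =>
        w N * ∑ m ∈ Finset.range N, pathWeight w k m (fun i => ξ i s) *
          (if ξ k s = N - m then 1 else 0) := by
      filter_upwards [hξ.pos k] with s hs
      exact pathWeight_succ w k N hs
    have hind : ∀ m, IndepFun (fun s => pathWeight w k m fun i => ξ i s)
        (fun s => if ξ k s = N - m then (1 : ℝ) else 0) P := by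
      intro m
      refine indepFun_of_dependsOn (s := Finset.range k) (t := {k})
        (G := fun x => if x k = N - m then (1 : ℝ) else 0) hξ.indep
        (fun i => (hξ.measurable i).aemeasurable) (by simp) (measurable_pathWeight w k m)
        ?_ (dependsOn_pathWeight w k m) ?_
      · exact Measurable.ite (measurable_pi_apply k (measurableSet_singleton _))
          measurable_const measurable_const
      · intro x y h
        simp [h k (by simp)]
    have hset : ∀ m, MeasurableSet {s | ξ k s = N - m} := fun m =>
      hξ.measurable k (measurableSet_singleton (N - m))
    have hone : ∀ m, (fun s => if ξ k s = N - m then (1 : ℝ) else 0) =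
        Set.indicator {s | ξ k s = N - m} 1 := by
      intro m; funext s; simp [Set.indicator_apply]
    have hint1 : ∀ m, Integrable (fun s => if ξ k s = N - m then (1 : ℝ) else 0) P := by
      intro m
      rw [hone]
      exact (integrable_const (1 : ℝ)).indicator (hset m)
    have hint : ∀ m, Integrable (fun s => pathWeight w k m (fun i => ξ i s) *
        (if ξ k s = N - m then 1 else 0)) P := fun m =>
      (hind m).integrable_mul (ih m).1 (hint1 m)
    refine ⟨((integrable_finsetSum _ fun m _ => hint m).const_mul (w N)).congr hae.symm, ?_⟩
    rw [integral_congr_ae hae, integral_const_mul, integral_finsetSum _ fun m _ => hint m,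
      stepWeight_succ]
    congr 1
    refine Finset.sum_congr rfl fun m hm => ?_
    rw [(hind m).integral_fun_mul_eq_mul_integral (ih m).1.aestronglyMeasurable
      (hint1 m).aestronglyMeasurable, (ih m).2, hone, integral_indicator_one (hset m),
      hξ.law k _ (by have := Finset.mem_range.1 hm; omega)]

lemma strictMono_position {x : ℕ → ℕ} (hx : ∀ i, 1 ≤ x i) : StrictMono (position x) :=
  strictMono_nat_of_lt_succ fun k => by rw [position_succ]; have := hx k; omega

open Classical in
lemma exp_sum_mul_eq_sum_pathWeight {x : ℕ → ℕ} (hx : ∀ i, 1 ≤ x i) (a : ℕ → ℝ) (N : ℕ) :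
    Real.exp (∑ n ∈ Finset.Icc 1 N, a n * (if n ∈ Set.range (position x) then 1 else 0))
      * (if N ∈ Set.range (position x) then 1 else 0) =
    ∑ k ∈ Finset.range (N + 1), pathWeight (fun n => Real.exp (a n)) k N x := by
  have hmono := strictMono_position hx
  by_cases h : N ∈ Set.range (position x)
  · obtain ⟨k, hk⟩ := h
    have hkN : k ≤ N := hk ▸ hmono.id_le k
    rw [if_pos ⟨k, hk⟩, mul_one, Finset.sum_eq_single_of_mem k
      (Finset.mem_range.2 (by omega)), pathWeight, if_pos hk, ← Real.exp_sum]
    · congr 1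
      simp only [mul_ite, mul_one, mul_zero]
      rw [← Finset.sum_filter]
      symm
      refine Finset.sum_bij (fun i _ => position x (i + 1)) ?_ ?_ ?_ ?_
      · intro i hi
        have hi := Finset.mem_range.1 hi
        have h1 : i + 1 ≤ position x (i + 1) := hmono.id_le (i + 1)
        have h2 : position x (i + 1) ≤ N := hk ▸ hmono.monotone hi
        simp; omega
      · intro i _ j _ hij
        have := hmono.injective hij
        omega
      · intro n hn
        simp only [Finset.mem_filter, Finset.mem_Icc, Set.mem_range] at hn
        obtain ⟨⟨h1, h2⟩, j, rfl⟩ := hn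
        have hj0 : j ≠ 0 := by rintro rfl; simp [position] at h1
        rw [← hk] at h2
        have hjk := hmono.le_iff_le.1 h2
        exact ⟨j - 1, Finset.mem_range.2 (by omega), by rw [Nat.sub_add_cancel (by omega)]⟩
      · intro i _; rfl
    · intro j _ hj
      rw [pathWeight, if_neg]
      rw [← hk]
      exact fun h => hj (hmono.injective h)
  · rw [if_neg h, mul_zero, Finset.sum_eq_zero]
    intro k _
    rw [pathWeight, if_neg fun hk => h ⟨k, hk⟩]

/-- From here on the renewal process enters only through its kernel. -/
lemma partitionFunction_eq (hξ : IsRenewalIncrements P ξ φ) (lam β h : ℝ) (η : ℕ → ℝ) (N : ℕ) :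
    partitionFunction P ξ lam β h η N =
      totalWeight (interArrival φ) (fun n => Real.exp (β * η n + h - lam)) N := by
  have hpos : ∀ᵐ s ∂P, ∀ i, 1 ≤ ξ i s := ae_all_iff.2 hξ.pos
  rw [partitionFunction, integral_congr_ae (g := fun s => ∑ k ∈ Finset.range (N + 1),
    pathWeight (fun n => Real.exp (β * η n + h - lam)) k N fun i => ξ i s),
    integral_finsetSum _ fun k _ => (integrable_pathWeight hξ _ k N).1, totalWeight]
  · exact Finset.sum_congr rfl fun k _ => (integrable_pathWeight hξ _ k N).2
  · filter_upwards [hpos] with s hs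
    exact exp_sum_mul_eq_sum_pathWeight hs _ N

omit [IsProbabilityMeasure P] in
lemma measurableSet_mem_renewalSet (hξ : IsRenewalIncrements P ξ φ) (n : ℕ) :
    MeasurableSet {s | n ∈ renewalSet ξ s} := by
  have : {s | n ∈ renewalSet ξ s} = ⋃ k, {s | position (fun i => ξ i s) k = n} := by
    ext s; simp [renewalSet, position]
  rw [this]
  refine MeasurableSet.iUnion fun k => ?_
  have h1 : Measurable fun s => fun i => ξ i s := measurable_pi_lambda _ hξ.measurable
  exact ((measurable_position k).comp h1) (measurableSet_singleton n)

lemma renewalMass_eq (hξ : IsRenewalIncrements P ξ φ) (n : ℕ) :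
    renewalMass P ξ n = mass (interArrival φ) n := by
  have h := partitionFunction_eq hξ 0 0 0 (fun _ => 0) n
  simp only [partitionFunction, mul_zero, add_zero, sub_zero, zero_mul, Finset.sum_const_zero,
    Real.exp_zero, one_mul] at h
  rw [mass, ← h, renewalMass, ← integral_indicator_one (measurableSet_mem_renewalSet hξ n)]
  congr 1

/-- This relies on the convention that zero to the power `-3/2` is zero. It lets generating
functions start at index zero. -/
lemma interArrival_zero : interArrival φ 0 = 0 := by
  simp [interArrival, Real.zero_rpow]

omit [IsProbabilityMeasure P] in
lemma interArrival_nonneg (hξ : IsRenewalIncrements P ξ φ) (n : ℕ) : 0 ≤ interArrival φ n := by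
  rcases Nat.eq_zero_or_pos n with rfl | hn
  · rw [interArrival_zero]
  · rw [← hξ.law 0 n hn]; exact measureReal_nonneg

lemma hasSum_interArrival (hξ : IsRenewalIncrements P ξ φ) :
    HasSum (fun n => interArrival φ (n + 1)) 1 := by
  have hdisj : Pairwise (Function.onFun Disjoint fun n : ℕ => {s | ξ 0 s = n + 1}) := by
    intro i j hij
    refine Set.disjoint_left.2 fun s hi hj => hij ?_
    simp only [Set.mem_ofPred_eq] at hi hj
    omega
  have hU : P (⋃ n : ℕ, {s | ξ 0 s = n + 1}) = 1 := by
    rw [← measure_univ (μ := P)]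
    refine measure_congr ?_
    filter_upwards [hξ.pos 0] with s hs
    simp only [eq_iff_iff]
    exact iff_of_true (Set.mem_iUnion.2 ⟨ξ 0 s - 1, (Nat.sub_add_cancel hs).symm⟩) (Set.mem_univ s)
  rw [measure_iUnion hdisj fun n => hξ.measurable 0 (measurableSet_singleton (n + 1))] at hU
  have h1 := ENNReal.hasSum_toReal (hU.trans_ne ENNReal.one_ne_top)
  rw [← ENNReal.tsum_toReal_eq fun n => measure_ne_top P _, hU, ENNReal.toReal_one] at h1
  have h2 : (fun n => interArrival φ (n + 1)) = fun n : ℕ => (P {s | ξ 0 s = n + 1}).toReal :=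
    funext fun n => (hξ.law 0 (n + 1) (by omega)).symm
  rwa [h2]

end Renewal

/-! ### Slow variation: uniform convergence and power bounds -/

section SlowVariation

/-- The sets increase to `[0, 2]`, so their measures tend to `2`. The threshold `3/2` is what makes
two such sets meet inside an interval of length `3`. -/
lemma exists_volume_gt {h : ℝ → ℝ}
    (hh : ∀ u, Tendsto (fun x => h (x + u) - h x) atTop (𝓝 0)) {ε : ℝ} (hε : 0 < ε)
    {y : ℕ → ℝ} (hy : Tendsto y atTop atTop) :
    ∀ᶠ n in atTop, ENNReal.ofReal (3 / 2) <
      volume {v ∈ Set.Icc (0 : ℝ) 2 | ∀ m ≥ n, |h (y m + v) - h (y m)| < ε} := by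
  set V : ℕ → Set ℝ := fun n => {v ∈ Set.Icc (0 : ℝ) 2 | ∀ m ≥ n, |h (y m + v) - h (y m)| < ε}
  have hmono : Monotone V := fun i j hij v hv => ⟨hv.1, fun m hm => hv.2 m (hij.trans hm)⟩
  have hU : ⋃ n, V n = Set.Icc (0 : ℝ) 2 := by
    ext v
    refine ⟨fun hv => ?_, fun hv => ?_⟩
    · obtain ⟨n, hn⟩ := Set.mem_iUnion.1 hv
      exact hn.1
    · have h1 := ((hh v).comp hy).eventually (Metric.ball_mem_nhds 0 hε)
      obtain ⟨n, hn⟩ := eventually_atTop.1 h1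
      exact Set.mem_iUnion.2 ⟨n, hv, fun m hm => by simpa using hn m hm⟩
  have ht := tendsto_measure_iUnion_atTop (μ := volume) hmono
  rw [hU, Real.volume_Icc, sub_zero] at ht
  refine ht.eventually (lt_mem_nhds ?_)
  exact (ENNReal.ofReal_lt_ofReal_iff (by norm_num)).2 (by norm_num)

/-- The uniform convergence theorem for slowly varying functions, in additive form. -/
lemma exists_forall_abs_sub_le {h : ℝ → ℝ} (hm : Measurable h)
    (hh : ∀ u, Tendsto (fun x => h (x + u) - h x) atTop (𝓝 0)) {ε : ℝ} (hε : 0 < ε) :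
    ∃ X, ∀ x ≥ X, ∀ u ∈ Set.Icc (0 : ℝ) 1, |h (x + u) - h x| ≤ ε := by
  by_contra! hcon
  choose x hx u hu hxu using fun n : ℕ => hcon n
  have hxt : Tendsto x atTop atTop := tendsto_atTop_mono hx tendsto_natCast_atTop_atTop
  have hxut : Tendsto (fun n => x n + u n) atTop atTop :=
    tendsto_atTop_mono (fun n => le_add_of_nonneg_right (hu n).1) hxt
  obtain ⟨n, h1, h2⟩ := ((exists_volume_gt hh (half_pos hε) hxt).and
    (exists_volume_gt hh (half_pos hε) hxut)).exists
  set V := {v ∈ Set.Icc (0 : ℝ) 2 | ∀ m ≥ n, |h (x m + v) - h (x m)| < ε / 2} with hV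
  set W := {v ∈ Set.Icc (0 : ℝ) 2 | ∀ m ≥ n, |h (x m + u m + v) - h (x m + u m)| < ε / 2} with hW
  have hWm : MeasurableSet W := by
    refine measurableSet_Icc.inter ?_
    change MeasurableSet {v | ∀ m ≥ n, |h (x m + u m + v) - h (x m + u m)| < ε / 2}
    simp only [Set.ofPred_forall]
    refine MeasurableSet.iInter fun m => MeasurableSet.iInter fun _ => ?_
    exact measurableSet_lt (by fun_prop) measurable_const
  -- At a common point, both `h (x n)` and `h (x n + u n)` would be within `ε / 2` of the same
  -- value, against the choice of `u n`.
  have hdisj : Disjoint V ((fun w => w + -u n) ⁻¹' W) := by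
    refine Set.disjoint_left.2 fun v hv hw => ?_
    have h3 := hv.2 n le_rfl
    have h4 := hw.2 n le_rfl
    rw [show x n + u n + (v + -u n) = x n + v by ring] at h4
    have h5 := hxu n
    rw [abs_lt] at h3 h4
    rcases lt_abs.1 h5 with h6 | h6 <;> linarith
  have hsub : V ∪ ((fun w => w + -u n) ⁻¹' W) ⊆ Set.Icc 0 3 := by
    have := hu n
    rintro v (hv | hv)
    · have := hv.1; simp only [Set.mem_Icc] at *; constructor <;> linarith
    · have := hv.1; simp only [Set.mem_Icc] at *; constructor <;> linarith
  have h3 := measure_mono (μ := volume) hsub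
  rw [measure_union hdisj (hWm.preimage (by fun_prop)), measure_preimage_add_right,
    Real.volume_Icc, sub_zero] at h3
  have h4 := ENNReal.add_lt_add h1 h2
  rw [← ENNReal.ofReal_add (by norm_num) (by norm_num)] at h4
  norm_num at h4 h3
  exact absurd h3 (not_le.2 h4)

variable {φ : ℝ → ℝ}

/-- A slowly varying function is eventually between `x ^ (-δ)` and `x ^ δ`, up to constants. -/
lemma SlowlyVarying.exists_bounds (hφ : SlowlyVarying φ) {δ : ℝ} (hδ : 0 < δ) :
    ∃ C > 0, ∀ᶠ x in atTop, φ x ≤ C * x ^ δ ∧ C⁻¹ * x ^ (-δ) ≤ φ x := by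
  set h : ℝ → ℝ := fun x => Real.log (φ (Real.exp x)) with hh
  have hm : Measurable h := Real.measurable_log.comp (hφ.measurable.comp Real.measurable_exp)
  have hpos : ∀ᶠ x in atTop, 0 < φ (Real.exp x) := Real.tendsto_exp_atTop.eventually
    hφ.eventually_pos
  have hlim : ∀ u, Tendsto (fun x => h (x + u) - h x) atTop (𝓝 0) := by
    intro u
    have h1 := (hφ.tendsto_ratio (Real.exp u) (Real.exp_pos u)).comp Real.tendsto_exp_atTop
    have h2 := (Real.continuousAt_log one_ne_zero).tendsto.comp h1
    rw [Real.log_one] at h2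
    refine h2.congr' ?_
    have h3 := (tendsto_atTop_add_const_right atTop u tendsto_id).eventually hpos
    filter_upwards [hpos, h3] with x hx hxu
    simp only [id, Function.comp] at *
    rw [hh]
    simp only
    rw [← Real.log_div hxu.ne' hx.ne', Real.exp_add, mul_comm]
  obtain ⟨X₀, hX₀⟩ := exists_forall_abs_sub_le hm hlim hδ
  obtain ⟨X₁, hX₁⟩ := eventually_atTop.1 hpos
  set X := max X₀ (max X₁ 0) with hX
  -- Each unit interval costs at most `δ`, so `log φ(exp x)` grows at most linearly with slope `δ`.
  have step : ∀ (k : ℕ) (u : ℝ), u ∈ Set.Icc (0 : ℝ) 1 →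
      |h (X + k + u) - h X| ≤ δ * (k + 1) := by
    intro k
    induction k with
    | zero =>
      intro u hu
      simpa using hX₀ X (le_max_left _ _) u hu
    | succ k ih =>
      intro u hu
      have h1 := ih 1 ⟨zero_le_one, le_rfl⟩
      have h2 := hX₀ (X + k + 1) (by
        have := le_max_left X₀ (max X₁ 0)
        have : (0 : ℝ) ≤ k := k.cast_nonneg
        linarith) u hu
      have h3 := abs_sub_le (h (X + k + 1 + u)) (h (X + k + 1)) (h X)
      push_cast
      rw [show X + (k + 1 : ℝ) + u = X + k + 1 + u by ring]
      linarith
  have bound : ∀ x ≥ X, |h x - h X| ≤ δ * (x + 1) := by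
    intro x hx
    have hf := Nat.floor_le (sub_nonneg.2 hx)
    have h1 := step ⌊x - X⌋₊ (x - X - ⌊x - X⌋₊) ⟨sub_nonneg.2 hf,
      by have := Nat.lt_floor_add_one (x - X); linarith⟩
    rw [show X + (⌊x - X⌋₊ : ℝ) + (x - X - ⌊x - X⌋₊) = x by ring] at h1
    refine h1.trans (mul_le_mul_of_nonneg_left ?_ hδ.le)
    have : 0 ≤ X := le_max_of_le_right (le_max_right _ _)
    linarith
  refine ⟨Real.exp (|h X| + δ), Real.exp_pos _, ?_⟩
  filter_upwards [eventually_ge_atTop (Real.exp X)] with x hx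
  have hx0 : 0 < x := (Real.exp_pos X).trans_le hx
  have hlx : X ≤ Real.log x := (Real.le_log_iff_exp_le hx0).2 hx
  have h1 := abs_le.1 (bound _ hlx)
  have h2 : 0 < φ x := by
    have := hX₁ (Real.log x) ((le_max_left X₁ 0).trans ((le_max_right X₀ _).trans hlx))
    rwa [Real.exp_log hx0] at this
  have h3 : h (Real.log x) = Real.log (φ x) := by rw [hh]; simp only; rw [Real.exp_log hx0]
  rw [h3] at h1
  have h4 := neg_abs_le (h X)
  have h5 := le_abs_self (h X)
  rw [← Real.exp_neg, Real.rpow_def_of_pos hx0, Real.rpow_def_of_pos hx0, ← Real.exp_add,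
    ← Real.exp_add]
  constructor
  · rw [← Real.log_le_iff_le_exp h2]; linarith
  · rw [← Real.le_log_iff_exp_le h2]; linarith

lemma interArrival_eq_mul (φ : ℝ → ℝ) (n : ℕ) : interArrival φ n =
    (2 * Real.pi)⁻¹ * φ n * (n : ℝ) ^ (-(3 / 2) : ℝ) := rfl

/-- The asymptotic bound becomes one for all indices by adding the finitely many initial ratios to
the constant. -/
lemma SlowlyVarying.interArrival_le (hφ : SlowlyVarying φ) {δ : ℝ} (hδ : 0 < δ) :
    ∃ C > 0, ∀ n : ℕ, interArrival φ (n + 1) ≤ C * ((n + 1 : ℕ) : ℝ) ^ (δ - 3 / 2) := by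
  obtain ⟨C, hC, h⟩ := hφ.exists_bounds hδ
  obtain ⟨N, hN⟩ := eventually_atTop.1 (tendsto_natCast_atTop_atTop.eventually h)
  have hbig : ∀ n ≥ N, 0 < n → interArrival φ n ≤ C * (n : ℝ) ^ (δ - 3 / 2) := by
    intro n hn hn0
    have hn0' : (0 : ℝ) < n := by exact_mod_cast hn0
    have h1 := (hN n hn).1
    rw [interArrival_eq_mul, show δ - 3 / 2 = δ + -(3 / 2) by ring, Real.rpow_add hn0', ← mul_assoc]
    refine mul_le_mul_of_nonneg_right ?_ (Real.rpow_nonneg hn0'.le _)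
    have h2 : (2 * Real.pi)⁻¹ ≤ 1 := inv_le_one_of_one_le₀ (by linarith [Real.pi_gt_three])
    calc (2 * Real.pi)⁻¹ * φ n ≤ (2 * Real.pi)⁻¹ * (C * (n : ℝ) ^ δ) := by gcongr
      _ ≤ 1 * (C * (n : ℝ) ^ δ) := by gcongr
      _ = _ := one_mul _
  set f : ℕ → ℝ := fun n => |interArrival φ n| / (n : ℝ) ^ (δ - 3 / 2) with hf
  refine ⟨C + ∑ n ∈ Finset.range N, f n, ?_, fun n => ?_⟩
  · exact add_pos_of_pos_of_nonneg hC (Finset.sum_nonneg fun n _ => by positivity)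
  have hp : (0 : ℝ) < ((n + 1 : ℕ) : ℝ) ^ (δ - 3 / 2) := Real.rpow_pos_of_pos (by positivity) _
  have hS : 0 ≤ ∑ n ∈ Finset.range N, f n := Finset.sum_nonneg fun n _ => by positivity
  rcases le_or_gt N (n + 1) with h1 | h1
  · refine (hbig _ h1 (by omega)).trans (mul_le_mul_of_nonneg_right ?_ hp.le)
    linarith
  · have h2 : f (n + 1) ≤ ∑ n ∈ Finset.range N, f n :=
      Finset.single_le_sum (fun n _ => by positivity) (Finset.mem_range.2 h1)
    calc interArrival φ (n + 1) ≤ |interArrival φ (n + 1)| := le_abs_self _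
      _ = f (n + 1) * ((n + 1 : ℕ) : ℝ) ^ (δ - 3 / 2) := by
        simp only [hf]; rw [div_mul_cancel₀ _ hp.ne']
      _ ≤ _ := mul_le_mul_of_nonneg_right (by linarith) hp.le

/-- The crude exponent `2` suffices, because this bound enters only through its logarithm. The gap
between `3/2 + 1/4` and `2` absorbs the constants. -/
lemma SlowlyVarying.le_interArrival (hφ : SlowlyVarying φ) :
    ∀ᶠ n : ℕ in atTop, ((n : ℝ) ^ 2)⁻¹ ≤ interArrival φ n := by
  obtain ⟨C, hC, h⟩ := hφ.exists_bounds (show (0 : ℝ) < 1 / 4 by norm_num)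
  have h1 : ∀ᶠ x : ℝ in atTop, 2 * Real.pi * C ≤ x ^ (1 / 4 : ℝ) :=
    (tendsto_rpow_atTop (by norm_num)).eventually (eventually_ge_atTop _)
  filter_upwards [tendsto_natCast_atTop_atTop.eventually (h.and h1), eventually_gt_atTop 0]
    with n hn hn0
  have hn0' : (0 : ℝ) < n := by exact_mod_cast hn0
  obtain ⟨⟨-, h2⟩, h3⟩ := hn
  have hpi := Real.pi_pos
  rw [interArrival_eq_mul]
  calc ((n : ℝ) ^ 2)⁻¹ = 1 * (n : ℝ) ^ (-2 : ℝ) := by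
        rw [Real.rpow_neg hn0'.le, one_mul]; norm_num
    _ ≤ ((2 * Real.pi)⁻¹ * C⁻¹ * (n : ℝ) ^ (1 / 4 : ℝ)) * (n : ℝ) ^ (-2 : ℝ) := by
        refine mul_le_mul_of_nonneg_right ?_ (Real.rpow_nonneg hn0'.le _)
        rw [← mul_inv, ← div_eq_inv_mul, one_le_div (by positivity)]
        exact h3
    _ = (2 * Real.pi)⁻¹ * (C⁻¹ * (n : ℝ) ^ (-(1 / 4) : ℝ)) * (n : ℝ) ^ (-(3 / 2) : ℝ) := by
        rw [mul_assoc, ← Real.rpow_add hn0', mul_assoc, mul_assoc, mul_assoc,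
          ← Real.rpow_add hn0']
        norm_num
    _ ≤ _ := by gcongr

/-- The truncated mean decays like `M ^ (-1/2)`, up to arbitrarily small powers. -/
lemma SlowlyVarying.truncMean_le (hφ : SlowlyVarying φ) (hK : ∀ n, 0 ≤ interArrival φ n)
    (hs : HasSum (fun n => interArrival φ (n + 1)) 1) {δ : ℝ} (hδ : 0 < δ) (hδ' : δ < 1 / 4) :
    ∃ C > 0, ∀ M : ℕ, M ≠ 0 →
      truncMean (interArrival φ) M ≤ C * (M : ℝ) ^ (-(1 / 2 - 2 * δ)) := by
  obtain ⟨C, hC, hCK⟩ := hφ.interArrival_le hδ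
  have hsum : Summable fun n : ℕ => ((n + 1 : ℕ) : ℝ) ^ (-(1 + δ)) :=
    (summable_nat_add_iff 1).2 (Real.summable_nat_rpow.2 (by linarith))
  refine ⟨C * ∑' n : ℕ, ((n + 1 : ℕ) : ℝ) ^ (-(1 + δ)), ?_, fun M hM => ?_⟩
  · refine mul_pos hC (hsum.tsum_pos (fun n => by positivity) 0 (by positivity))
  have hM0 : (0 : ℝ) < M := by positivity
  set g : ℕ → ℝ := fun n => if n ∈ Finset.range M then
    interArrival φ (n + 1) * (1 - ((n + 1 : ℕ) : ℝ) / M) else 0 with hg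
  have h1 : HasSum g (∑ n ∈ Finset.range M,
      interArrival φ (n + 1) * (1 - ((n + 1 : ℕ) : ℝ) / M)) := by
    have : HasSum g (∑ n ∈ Finset.range M, g n) := hasSum_sum_of_ne_finset_zero
      fun n hn => by simp only [hg]; rw [if_neg hn]
    rwa [Finset.sum_congr rfl fun n hn => by simp only [hg]; rw [if_pos hn]] at this
  have h2 : HasSum (fun n => interArrival φ (n + 1) - g n) (truncMean (interArrival φ) M) :=
    hs.sub h1
  have h3 : HasSum (fun n : ℕ => C * (M : ℝ) ^ (-(1 / 2 - 2 * δ)) * ((n + 1 : ℕ) : ℝ) ^ (-(1 + δ)))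
      (C * (M : ℝ) ^ (-(1 / 2 - 2 * δ)) * ∑' n : ℕ, ((n + 1 : ℕ) : ℝ) ^ (-(1 + δ))) :=
    hsum.hasSum.mul_left _
  refine (hasSum_le (fun n => ?_) h2 h3).trans (le_of_eq (by ring))
  have hn0 : (0 : ℝ) < ((n + 1 : ℕ) : ℝ) := by positivity
  -- This is `min x 1 ≤ x ^ p` with `p = 1/2 - 2δ`. That `p` leaves the summable exponent `(δ - 3/2)
  -- + p = -(1 + δ)`.
  have h4 : interArrival φ (n + 1) - g n ≤
      interArrival φ (n + 1) * (((n + 1 : ℕ) : ℝ) / M) ^ (1 / 2 - 2 * δ) := by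
    by_cases hn : n ∈ Finset.range M
    · simp only [hg]
      rw [if_pos hn, show ∀ a b : ℝ, a - a * (1 - b) = a * b by intros; ring]
      refine mul_le_mul_of_nonneg_left ?_ (hK _)
      refine Real.self_le_rpow_of_le_one (by positivity) ?_ (by linarith)
      rw [div_le_one hM0]
      exact_mod_cast Finset.mem_range.1 hn
    · simp only [hg]
      rw [if_neg hn, sub_zero]
      refine le_mul_of_one_le_right (hK _) (Real.one_le_rpow ?_ (by linarith))
      rw [one_le_div hM0]
      have : M ≤ n + 1 := by have := Finset.mem_range.not.1 hn; omega
      exact_mod_cast this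
  refine h4.trans ?_
  calc interArrival φ (n + 1) * (((n + 1 : ℕ) : ℝ) / M) ^ (1 / 2 - 2 * δ)
      ≤ (C * ((n + 1 : ℕ) : ℝ) ^ (δ - 3 / 2)) *
        (((n + 1 : ℕ) : ℝ) / M) ^ (1 / 2 - 2 * δ) := by gcongr; exact hCK n
    _ = C * (M : ℝ) ^ (-(1 / 2 - 2 * δ)) *
        (((n + 1 : ℕ) : ℝ) ^ (δ - 3 / 2) * ((n + 1 : ℕ) : ℝ) ^ (1 / 2 - 2 * δ)) := by
        rw [Real.div_rpow hn0.le hM0.le, Real.rpow_neg hM0.le]; ring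
    _ = _ := by
        rw [← Real.rpow_add hn0]; congr 2; ring

end SlowVariation

/-! ### Measurability and dependence on finitely many weights -/

section Measurability

lemma measurable_stepWeight (K : ℕ → ℝ) (k N : ℕ) :
    Measurable fun w : ℕ → ℝ => stepWeight K w k N := by
  induction k generalizing N with
  | zero => exact measurable_const
  | succ k ih =>
    simp only [stepWeight_succ]
    exact (measurable_pi_apply N).mul
      (Finset.measurable_sum _ fun m _ => (ih m).mul measurable_const)

lemma measurable_totalWeight (K : ℕ → ℝ) (N : ℕ) :
    Measurable fun w : ℕ → ℝ => totalWeight K w N :=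
  Finset.measurable_sum _ fun k _ => measurable_stepWeight K k N

lemma measurable_preWeight (K : ℕ → ℝ) (N : ℕ) :
    Measurable fun w : ℕ → ℝ => preWeight K w N :=
  Finset.measurable_sum _ fun m _ => (measurable_totalWeight K m).mul measurable_const

lemma measurable_longWeight (K : ℕ → ℝ) (L M : ℕ) :
    Measurable fun w : ℕ → ℝ => longWeight K w L M :=
  Finset.measurable_sum _ fun _ _ => (Finset.measurable_sum _ fun _ _ =>
    measurable_stepWeight K _ _).mul measurable_const

lemma dependsOn_stepWeight (K : ℕ → ℝ) (k : ℕ) {m N : ℕ} (h : m < N) :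
    DependsOn (fun w : ℕ → ℝ => stepWeight K w k m) (Finset.range N) := fun _ _ hxy =>
  stepWeight_congr fun n _ hn => hxy n (by simpa using hn.trans_lt h)

lemma dependsOn_preWeight (K : ℕ → ℝ) {m N : ℕ} (h : m ≤ N) :
    DependsOn (fun w : ℕ → ℝ => preWeight K w m) (Finset.range N) := fun _ _ hxy =>
  preWeight_congr fun n _ hn => hxy n (by simpa using hn.trans_le h)

end Measurability

/-! ### Second moment method for independent weights of mean one -/

section Disorder

variable {Ω : Type*} [MeasurableSpace Ω] {Q : Measure Ω} [IsProbabilityMeasure Q]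

/-- Independent, square integrable random weights with mean one and variance `v`. -/
structure IsRandomWeight (Q : Measure Ω) (w : ℕ → Ω → ℝ) (v : ℝ) : Prop where
  indep : iIndepFun w Q
  memLp : ∀ n, MemLp (w n) 2 Q
  nonneg : ∀ n a, 0 ≤ w n a
  mean : ∀ n, ∫ a, w n a ∂Q = 1
  var : ∀ n, ∫ a, (w n a - 1) ^ 2 ∂Q = v

variable {w : ℕ → Ω → ℝ} {v : ℝ} {K : ℕ → ℝ}

omit [IsProbabilityMeasure Q] in
lemma IsRandomWeight.aemeasurable (hw : IsRandomWeight Q w v) (n : ℕ) : AEMeasurable (w n) Q :=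
  (hw.memLp n).aestronglyMeasurable.aemeasurable

omit [IsProbabilityMeasure Q] in
lemma IsRandomWeight.aemeasurable_comp (hw : IsRandomWeight Q w v) {F : (ℕ → ℝ) → ℝ}
    (hF : Measurable F) : AEMeasurable (fun a => F fun n => w n a) Q :=
  hF.comp_aemeasurable (aemeasurable_pi_lambda _ hw.aemeasurable)

omit [IsProbabilityMeasure Q] in
lemma IsRandomWeight.indepFun (hw : IsRandomWeight Q w v) {F : (ℕ → ℝ) → ℝ} {N : ℕ}
    (hF : Measurable F) (hFd : DependsOn F (Finset.range N)) :
    IndepFun (w N) (fun a => F fun n => w n a) Q :=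
  indepFun_of_dependsOn (s := {N}) (t := Finset.range N) (F := fun x => x N) hw.indep
    hw.aemeasurable (by simp) (measurable_pi_apply N) hF (fun x y h => h N (by simp)) hFd

-- Independence is essential: a product of two square integrable functions is in general only
-- integrable.
omit [IsProbabilityMeasure Q] in
lemma memLp_two_mul {X Y : Ω → ℝ} (hXY : IndepFun X Y Q) (hX : MemLp X 2 Q) (hY : MemLp Y 2 Q) :
    MemLp (fun a => X a * Y a) 2 Q := by
  have hm : AEStronglyMeasurable (fun a => X a * Y a) Q :=
    hX.aestronglyMeasurable.mul hY.aestronglyMeasurable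
  rw [memLp_two_iff_integrable_sq hm]
  have h := (hXY.comp (φ := fun x : ℝ => x ^ 2) (ψ := fun x : ℝ => x ^ 2) (by fun_prop)
    (by fun_prop)).integrable_mul hX.integrable_sq hY.integrable_sq
  refine h.congr (Eventually.of_forall fun a => ?_)
  simp [mul_pow]

lemma IsRandomWeight.memLp_totalWeight (hw : IsRandomWeight Q w v) (N : ℕ) :
    MemLp (fun a => totalWeight K (fun n => w n a) N) 2 Q := by
  induction N using Nat.strong_induction_on with
  | _ N ih =>
    rcases eq_or_ne N 0 with rfl | hN
    · simpa using memLp_const 1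
    · simp only [totalWeight_eq_mul_preWeight hN]
      refine memLp_two_mul (hw.indepFun (measurable_preWeight K N)
        (dependsOn_preWeight K le_rfl)) (hw.memLp N) ?_
      exact memLp_finsetSum _ fun m hm => (ih m (Finset.mem_range.1 hm)).mul_const _

lemma IsRandomWeight.memLp_preWeight (hw : IsRandomWeight Q w v) (N : ℕ) :
    MemLp (fun a => preWeight K (fun n => w n a) N) 2 Q :=
  memLp_finsetSum _ fun m _ => (hw.memLp_totalWeight m).mul_const _

/-- The terms of the expansion of the partition function. -/
def chaos (K w : ℕ → ℝ) (k : ℕ) : ℝ := (w (k + 1) - 1) * preWeight K w (k + 1)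

lemma measurable_chaos (K : ℕ → ℝ) (k : ℕ) : Measurable fun w => chaos K w k :=
  ((measurable_pi_apply (k + 1)).sub measurable_const).mul (measurable_preWeight K (k + 1))

lemma dependsOn_chaos (K : ℕ → ℝ) {k N : ℕ} (h : k + 1 < N) :
    DependsOn (fun w : ℕ → ℝ => chaos K w k) (Finset.range N) := by
  intro x y hxy
  simp only [chaos]
  have h1 : preWeight K x (k + 1) = preWeight K y (k + 1) := dependsOn_preWeight K h.le hxy
  rw [hxy (k + 1) (by simpa using h), h1]

lemma IsRandomWeight.memLp_chaos (hw : IsRandomWeight Q w v) (k : ℕ) :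
    MemLp (fun a => chaos K (fun n => w n a) k) 2 Q := by
  have h := (hw.indepFun (measurable_preWeight K (k + 1)) (dependsOn_preWeight K le_rfl)).comp
    (φ := fun x : ℝ => x - 1) (by fun_prop) measurable_id
  exact memLp_two_mul h ((hw.memLp _).sub (memLp_const 1)) (hw.memLp_preWeight (k + 1))

/-- The centred factor `w (k + 1) - 1` is independent of everything built from the weights of index
at most `k`. -/
lemma IsRandomWeight.integral_chaos_mul (hw : IsRandomWeight Q w v) {F : (ℕ → ℝ) → ℝ} {k : ℕ}
    (hF : Measurable F) (hFd : DependsOn F (Finset.range (k + 1))) :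
    ∫ a, F (fun n => w n a) * chaos K (fun n => w n a) k ∂Q = 0 := by
  have h := (hw.indepFun (F := fun x => F x * preWeight K x (k + 1)) (N := k + 1)
    (hF.mul (measurable_preWeight K (k + 1)))
    (fun x y h => by simp only [hFd h, dependsOn_preWeight K le_rfl h])).comp
    (φ := fun x : ℝ => x - 1) (by fun_prop) measurable_id
  have h2 := h.integral_fun_mul_eq_mul_integral
    ((hw.memLp _).sub (memLp_const 1)).aestronglyMeasurable
    (hw.aemeasurable_comp (hF.mul (measurable_preWeight K (k + 1)))).aestronglyMeasurable
  have h3 : ∫ a, (w (k + 1) a - 1) ∂Q = 0 := by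
    rw [integral_sub ((hw.memLp _).integrable (by norm_num)) (integrable_const 1), hw.mean]
    simp
  simp only [Function.comp_def, id] at h2
  rw [h3, zero_mul] at h2
  rw [← h2]
  congr 1
  funext a
  simp only [chaos]; ring

/-- The second moments of the terms of the expansion. -/
lemma IsRandomWeight.integral_chaos_sq (hw : IsRandomWeight Q w v) (k : ℕ) :
    ∫ a, chaos K (fun n => w n a) k ^ 2 ∂Q =
      v * ∫ a, preWeight K (fun n => w n a) (k + 1) ^ 2 ∂Q := by
  have h := (hw.indepFun (measurable_preWeight K (k + 1)) (dependsOn_preWeight K le_rfl)).comp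
    (φ := fun x : ℝ => (x - 1) ^ 2) (ψ := fun x : ℝ => x ^ 2) (by fun_prop) (by fun_prop)
  have h2 := h.integral_fun_mul_eq_mul_integral
    ((hw.memLp _).sub (memLp_const 1)).integrable_sq.aestronglyMeasurable
    (hw.memLp_preWeight (K := K) (k + 1)).integrable_sq.aestronglyMeasurable
  simp only [Function.comp_def] at h2
  rw [hw.var] at h2
  rw [← h2]
  congr 1
  funext a
  simp only [chaos]; ring

/-- Pythagoras for martingale increments. The coefficients `c` allow one statement to serve the free
partition function (`c = 1`) and the pinned one (`c` a renewal mass). -/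
lemma IsRandomWeight.integral_sum_chaos_sq (hw : IsRandomWeight Q w v) (b : ℝ) (c : ℕ → ℝ)
    (M : ℕ) :
    ∫ a, (b + ∑ k ∈ Finset.range M, chaos K (fun n => w n a) k * c k) ^ 2 ∂Q =
      b ^ 2 + ∑ k ∈ Finset.range M, (∫ a, chaos K (fun n => w n a) k ^ 2 ∂Q) * c k ^ 2 := by
  induction M with
  | zero => simp
  | succ M ih =>
    set F : (ℕ → ℝ) → ℝ := fun x => b + ∑ k ∈ Finset.range M, chaos K x k * c k with hF
    have hFm : Measurable F := measurable_const.add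
      (Finset.measurable_sum _ fun k _ => (measurable_chaos K k).mul measurable_const)
    have hFd : DependsOn F (Finset.range (M + 1)) := by
      intro x y hxy
      simp only [hF]
      congr 1
      refine Finset.sum_congr rfl fun k hk => ?_
      have h1 : chaos K x k = chaos K y k :=
        dependsOn_chaos K (by have := Finset.mem_range.1 hk; omega) hxy
      rw [h1]
    have hFL : MemLp (fun a => F fun n => w n a) 2 Q := (memLp_const b).add
      (memLp_finsetSum _ fun k _ => (hw.memLp_chaos k).mul_const _)
    have hcM := hw.memLp_chaos (K := K) M
    have horth := hw.integral_chaos_mul (K := K) hFm hFd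
    have hexp : ∀ a, (b + ∑ k ∈ Finset.range (M + 1), chaos K (fun n => w n a) k * c k) ^ 2 =
        F (fun n => w n a) ^ 2 + (2 * c M * (F (fun n => w n a) * chaos K (fun n => w n a) M)
          + c M ^ 2 * chaos K (fun n => w n a) M ^ 2) := by
      intro a
      rw [Finset.sum_range_succ]; simp only [hF]; ring
    have hi1 : Integrable (fun a => 2 * c M *
        (F (fun n => w n a) * chaos K (fun n => w n a) M)) Q :=
      (hFL.integrable_mul hcM).const_mul _
    have hi2 : Integrable (fun a => c M ^ 2 * chaos K (fun n => w n a) M ^ 2) Q :=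
      hcM.integrable_sq.const_mul _
    have hi3 : Integrable (fun a => 2 * c M * (F (fun n => w n a) * chaos K (fun n => w n a) M) +
        c M ^ 2 * chaos K (fun n => w n a) M ^ 2) Q := hi1.add hi2
    simp only [hexp]
    rw [integral_add hFL.integrable_sq hi3, integral_add hi1 hi2, integral_const_mul,
      integral_const_mul, horth, Finset.sum_range_succ, mul_zero, zero_add, ih]
    ring

/-- The second moment of the free partition function is bounded as long as the variance times
the expected overlap stays below one. -/
lemma IsRandomWeight.integral_freeWeight_sq_le (hw : IsRandomWeight Q w v) {d : ℝ} {M : ℕ}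
    (hd : v * ∑ n ∈ Finset.range M, mass K (n + 1) ^ 2 ≤ d) (hd1 : d < 1) :
    ∫ a, freeWeight K (fun n => w n a) M ^ 2 ∂Q ≤ 1 / (1 - d) := by
  have hv : 0 ≤ v := hw.var 0 ▸ integral_nonneg fun a => sq_nonneg _
  have h1 := hw.integral_sum_chaos_sq (K := K) 1 (fun _ => 1) M
  simp only [mul_one, one_pow] at h1
  have h2 : ∀ a, freeWeight K (fun n => w n a) M =
      1 + ∑ k ∈ Finset.range M, chaos K (fun n => w n a) k := fun a => freeWeight_eq M
  simp only [h2]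
  rw [h1]
  -- The second moment of an increment is `v` times that of `preWeight`, whose own expansion
  -- supplies the recursion required here.
  refine chaos_sum_le (u := mass K) (fun n => integral_nonneg fun a => sq_nonneg _) hv
    (fun n _ => ?_) hd hd1
  rw [hw.integral_chaos_sq]
  congr 1
  rw [← hw.integral_sum_chaos_sq]
  congr 1
  funext a
  rw [preWeight_eq_chaos (by omega), Nat.add_sub_cancel]
  rfl

lemma IsRandomWeight.integral_stepWeight (hw : IsRandomWeight Q w v) (k N : ℕ) :
    Integrable (fun a => stepWeight K (fun n => w n a) k N) Q ∧
      ∫ a, stepWeight K (fun n => w n a) k N ∂Q = stepWeight K (fun _ => 1) k N := by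
  induction k generalizing N with
  | zero => simp [stepWeight]
  | succ k ih =>
    simp only [stepWeight_succ]
    have hi : Integrable (fun a => ∑ m ∈ Finset.range N,
        stepWeight K (fun n => w n a) k m * K (N - m)) Q :=
      integrable_finsetSum _ fun m _ => (ih m).1.mul_const _
    have hind := hw.indepFun (N := N) (F := fun x => ∑ m ∈ Finset.range N,
        stepWeight K x k m * K (N - m))
      (Finset.measurable_sum _ fun m _ => (measurable_stepWeight K k m).mul measurable_const)
      (fun x y h => Finset.sum_congr rfl fun m hm => congrArg (· * K (N - m))
        (dependsOn_stepWeight K k (Finset.mem_range.1 hm) h))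
    refine ⟨hind.integrable_mul ((hw.memLp N).integrable (by norm_num)) hi, ?_⟩
    rw [hind.integral_fun_mul_eq_mul_integral (hw.memLp N).aestronglyMeasurable
      hi.aestronglyMeasurable, hw.mean, integral_finsetSum _ fun m _ => (ih m).1.mul_const _]
    congr 1
    refine Finset.sum_congr rfl fun m _ => ?_
    rw [integral_mul_const, (ih m).2]

lemma IsRandomWeight.integral_longWeight (hw : IsRandomWeight Q w v) (L M : ℕ) :
    Integrable (fun a => longWeight K (fun n => w n a) L M) Q ∧
      ∫ a, longWeight K (fun n => w n a) L M ∂Q = stepMass K L M := by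
  have hi : ∀ m, Integrable (fun a => (∑ k ∈ Finset.Ico L (M + 1 + L),
      stepWeight K (fun n => w n a) k m) * tail K (M - m)) Q := fun m =>
    (integrable_finsetSum _ fun k _ => (hw.integral_stepWeight k m).1).mul_const _
  refine ⟨integrable_finsetSum _ fun m _ => hi m, ?_⟩
  simp only [longWeight]
  rw [integral_finsetSum _ fun m _ => hi m, stepMass_eq_sum_tail]
  refine Finset.sum_congr rfl fun m _ => ?_
  rw [integral_mul_const, integral_finsetSum _ fun k _ => (hw.integral_stepWeight k m).1]
  congr 1
  exact Finset.sum_congr rfl fun k _ => (hw.integral_stepWeight k m).2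

/-- A second moment estimate in the style of Paley and Zygmund. -/
lemma paley_zygmund {X : Ω → ℝ} (hX : MemLp X 2 Q) {C : ℝ} (hC : 0 < C)
    (h1 : 1 / 2 ≤ ∫ a, X a ∂Q) (h2 : ∫ a, X a ^ 2 ∂Q ≤ C) :
    Integrable (fun a => if 1 / 4 ≤ X a then (1 : ℝ) else 0) Q ∧
      1 / (16 * C) ≤ ∫ a, (if 1 / 4 ≤ X a then (1 : ℝ) else 0) ∂Q := by
  have hm : AEMeasurable (fun a => if 1 / 4 ≤ X a then (1 : ℝ) else 0) Q := by
    have : Measurable fun x : ℝ => if 1 / 4 ≤ x then (1 : ℝ) else 0 :=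
      Measurable.ite measurableSet_Ici measurable_const measurable_const
    exact this.comp_aemeasurable hX.aestronglyMeasurable.aemeasurable
  have hI : Integrable (fun a => if 1 / 4 ≤ X a then (1 : ℝ) else 0) Q := by
    refine Integrable.of_bound hm.aestronglyMeasurable 1 (Eventually.of_forall fun a => ?_)
    split_ifs <;> simp
  refine ⟨hI, ?_⟩
  -- On the event this is `(X - 4C)² ≥ 0`. The first two terms cost `1/4 + 1/8` in mean, so `2C`
  -- times the probability must be at least `1/8`.
  have hpt : ∀ a, X a ≤ 1 / 4 + (X a ^ 2 * (1 / (8 * C)) +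
      2 * C * (if 1 / 4 ≤ X a then (1 : ℝ) else 0)) := by
    intro a
    split_ifs with h
    · have : X a ^ 2 * (1 / (8 * C)) + 2 * C - X a = (X a - 4 * C) ^ 2 / (8 * C) := by
        field_simp; ring
      have h3 : 0 ≤ (X a - 4 * C) ^ 2 / (8 * C) := by positivity
      linarith
    · have : 0 ≤ X a ^ 2 * (1 / (8 * C)) := by positivity
      linarith
  have hi2 := hX.integrable_sq.mul_const (1 / (8 * C))
  have hi3 : Integrable (fun a => X a ^ 2 * (1 / (8 * C)) +
      2 * C * (if 1 / 4 ≤ X a then (1 : ℝ) else 0)) Q := hi2.add (hI.const_mul (2 * C))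
  have h3 : _ ≤ ∫ a, (1 / 4 + (X a ^ 2 * (1 / (8 * C)) +
      2 * C * (if 1 / 4 ≤ X a then (1 : ℝ) else 0))) ∂Q :=
    integral_mono (hX.integrable (by norm_num)) ((integrable_const (1 / 4 : ℝ)).add hi3) hpt
  rw [integral_add (integrable_const _) hi3, integral_add hi2 (hI.const_mul _),
    integral_mul_const, integral_const_mul] at h3
  simp only [integral_const, probReal_univ, smul_eq_mul, one_mul] at h3
  have h4 : (∫ a, X a ^ 2 ∂Q) * (1 / (8 * C)) ≤ 1 / 8 := by
    calc _ ≤ C * (1 / (8 * C)) := by gcongr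
      _ = 1 / 8 := by field_simp
  rw [div_le_iff₀ (by positivity)]
  linarith

/-- With probability bounded below, the partition function over long paths is of order one. -/
lemma IsRandomWeight.le_integral_longWeight (hw : IsRandomWeight Q w v) (hK : ∀ n, 0 ≤ K n)
    (hs : HasSum (fun n => K (n + 1)) 1) {d : ℝ} {L M : ℕ}
    (hd : v * ∑ n ∈ Finset.range M, mass K (n + 1) ^ 2 ≤ d) (hd1 : d < 1)
    (hL : 1 / 2 ≤ stepMass K L M) :
    Integrable (fun a => if 1 / 4 ≤ longWeight K (fun n => w n a) L M then (1 : ℝ) else 0) Q ∧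
      (1 - d) / 16 ≤
        ∫ a, (if 1 / 4 ≤ longWeight K (fun n => w n a) L M then (1 : ℝ) else 0) ∂Q := by
  have hfree : MemLp (fun a => freeWeight K (fun n => w n a) M) 2 Q :=
    memLp_finsetSum _ fun m _ => (hw.memLp_totalWeight m).mul_const _
  have hle : ∀ a, longWeight K (fun n => w n a) L M ≤ freeWeight K (fun n => w n a) M := fun a =>
    longWeight_le_freeWeight hK hs (fun n => hw.nonneg n a) L M
  have h0 : ∀ a, 0 ≤ longWeight K (fun n => w n a) L M := fun a =>
    longWeight_nonneg hK hs (fun n => hw.nonneg n a) L M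
  have hlong : MemLp (fun a => longWeight K (fun n => w n a) L M) 2 Q := by
    refine hfree.mono (hw.aemeasurable_comp (measurable_longWeight K L M)).aestronglyMeasurable
      (Eventually.of_forall fun a => ?_)
    rw [Real.norm_of_nonneg (h0 a), Real.norm_of_nonneg ((h0 a).trans (hle a))]
    exact hle a
  -- Restricting to long paths can only decrease the second moment, while the first moment stays
  -- above `1/2` by `hL`.
  have h2 : ∫ a, longWeight K (fun n => w n a) L M ^ 2 ∂Q ≤ 1 / (1 - d) :=
    (integral_mono hlong.integrable_sq hfree.integrable_sq fun a =>
      pow_le_pow_left₀ (h0 a) (hle a) 2).trans (hw.integral_freeWeight_sq_le hd hd1)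
  have h3 := paley_zygmund hlong (C := 1 / (1 - d)) (one_div_pos.2 (by linarith))
    ((hw.integral_longWeight L M).2.symm ▸ hL) h2
  refine ⟨h3.1, le_trans (le_of_eq ?_) h3.2⟩
  have : 1 - d ≠ 0 := by linarith
  field_simp

end Disorder

/-! ### The exponential weights and their variance -/

section Disorder

variable {Ω : Type*} [MeasurableSpace Ω] {Q : Measure Ω} [IsProbabilityMeasure Q]
  {ω : ℕ → Ω → ℝ}

omit [IsProbabilityMeasure Q] in
lemma IsDisorder.aemeasurable (hω : IsDisorder Q ω) (n : ℕ) : AEMeasurable (ω n) Q :=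
  (hω.identDistrib n).aemeasurable_fst

omit [IsProbabilityMeasure Q] in
lemma IsDisorder.interior_integrableExpSet (hω : IsDisorder Q ω) :
    interior (integrableExpSet (ω 0) Q) = Set.univ := by
  have : integrableExpSet (ω 0) Q = Set.univ := Set.eq_univ_of_forall hω.integrable_exp
  rw [this, interior_univ]

omit [IsProbabilityMeasure Q] in
lemma IsDisorder.integrable (hω : IsDisorder Q ω) (n : ℕ) :
    Integrable (ω n) Q ∧ ∫ w, ω n w ∂Q = 0 := by
  have h0 : Integrable (ω 0) Q :=
    integrable_of_mem_interior_integrableExpSet (hω.interior_integrableExpSet ▸ Set.mem_univ 0)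
  exact ⟨(hω.identDistrib n).integrable_iff.2 h0,
    (hω.identDistrib n).integral_eq.trans hω.mean_zero⟩

omit [IsProbabilityMeasure Q] in
lemma IsDisorder.integrable_exp_mul (hω : IsDisorder Q ω) (n : ℕ) (t : ℝ) :
    Integrable (fun w => Real.exp (t * ω n w)) Q ∧
      ∫ w, Real.exp (t * ω n w) ∂Q = mgf (ω 0) Q t := by
  have h := (hω.identDistrib n).comp (u := fun x => Real.exp (t * x)) (by fun_prop)
  exact ⟨h.integrable_iff.2 (hω.integrable_exp t), h.integral_eq⟩

lemma IsDisorder.isRandomWeight (hω : IsDisorder Q ω) (β : ℝ) :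
    IsRandomWeight Q (fun n w => Real.exp (β * ω n w - cgf (ω 0) Q β))
      (mgf (ω 0) Q (2 * β) / mgf (ω 0) Q β ^ 2 - 1) := by
  have hpos : 0 < mgf (ω 0) Q β := mgf_pos (hω.integrable_exp β)
  have hexp : ∀ x, Real.exp (β * x - cgf (ω 0) Q β) = (mgf (ω 0) Q β)⁻¹ * Real.exp (β * x) := by
    intro x
    rw [Real.exp_sub, cgf, Real.exp_log hpos, div_eq_inv_mul]
  have hsq : ∀ n w, Real.exp (β * ω n w) ^ 2 = Real.exp (2 * β * ω n w) := by
    intro n w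
    rw [← Real.exp_nat_mul]; congr 1; push_cast; ring
  have hL2 : ∀ n, MemLp (fun w => Real.exp (β * ω n w)) 2 Q := by
    intro n
    rw [memLp_two_iff_integrable_sq (hω.integrable_exp_mul n β).1.aestronglyMeasurable]
    simp only [hsq]
    exact (hω.integrable_exp_mul n _).1
  have hmean : ∀ n, ∫ w, Real.exp (β * ω n w - cgf (ω 0) Q β) ∂Q = 1 := by
    intro n
    simp only [hexp]
    rw [integral_const_mul, (hω.integrable_exp_mul n β).2, inv_mul_cancel₀ hpos.ne']
  refine ⟨?_, fun n => ?_, fun n a => (Real.exp_pos _).le, hmean, fun n => ?_⟩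
  · exact hω.indep.comp (fun _ x => Real.exp (β * x - cgf (ω 0) Q β)) fun _ => by fun_prop
  · simp only [hexp]
    exact (hL2 n).const_mul _
  · have h1 : ∀ w, (Real.exp (β * ω n w - cgf (ω 0) Q β) - 1) ^ 2 =
        (mgf (ω 0) Q β ^ 2)⁻¹ * Real.exp (2 * β * ω n w) -
          (2 * Real.exp (β * ω n w - cgf (ω 0) Q β) - 1) := by
      intro w
      rw [hexp, ← hsq]; ring
    simp only [h1]
    have hi : Integrable (fun w => Real.exp (β * ω n w - cgf (ω 0) Q β)) Q := by
      simp only [hexp]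
      exact (hω.integrable_exp_mul n β).1.const_mul _
    have hi2 : Integrable (fun w => 2 * Real.exp (β * ω n w - cgf (ω 0) Q β) - 1) Q :=
      (hi.const_mul 2).sub (integrable_const 1)
    rw [integral_sub ((hω.integrable_exp_mul n _).1.const_mul _) hi2,
      integral_sub (hi.const_mul 2) (integrable_const 1), integral_const_mul, integral_const_mul,
      (hω.integrable_exp_mul n _).2, hmean]
    simp only [integral_const, probReal_univ, smul_eq_mul, mul_one]
    ring

omit [IsProbabilityMeasure Q] in
lemma IsDisorder.contDiff_mgf (hω : IsDisorder Q ω) : ContDiff ℝ 2 (mgf (ω 0) Q) := by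
  refine contDiff_iff_contDiffAt.2 fun t => ?_
  exact (analyticAt_mgf (hω.interior_integrableExpSet ▸ Set.mem_univ t)).contDiffAt

/-- The variance of the weights is asymptotically at most `β ^ 2`. -/
lemma IsDisorder.eventually_var_le (hω : IsDisorder Q ω) {ε : ℝ} (hε : 0 < ε) :
    ∀ᶠ β in 𝓝 (0 : ℝ), mgf (ω 0) Q (2 * β) / mgf (ω 0) Q β ^ 2 - 1 ≤ (1 + ε) * β ^ 2 := by
  set m := mgf (ω 0) Q with hm
  have h0 : (0 : ℝ) ∈ interior (integrableExpSet (ω 0) Q) :=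
    hω.interior_integrableExpSet ▸ Set.mem_univ 0
  have hm0 : m 0 = 1 := by simp [hm]
  have hm1 : deriv m 0 = 0 := by rw [hm, deriv_mgf_zero h0]; exact hω.mean_zero
  have hL2 : MemLp (ω 0) 2 Q := memLp_of_mem_interior_integrableExpSet h0 2
  have hm2 : iteratedDeriv 2 m 0 = 1 := by
    have h1 := variance_eq_sub hL2
    rw [hω.unit_variance, hω.mean_zero] at h1
    rw [hm, iteratedDeriv_mgf_zero h0]
    simp at h1 ⊢
    exact h1.symm
  have ht := taylor_tendsto (x₀ := (0 : ℝ)) (n := 2) convex_univ (Set.mem_univ 0)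
    hω.contDiff_mgf.contDiffOn
  rw [nhdsWithin_univ] at ht
  set e : ℝ → ℝ := fun t => ((t - 0) ^ 2)⁻¹ • (m t - taylorWithinEval m 2 Set.univ 0 t) with he
  have hexp : ∀ t, m t = 1 + t ^ 2 / 2 + t ^ 2 * e t := by
    intro t
    have h1 : taylorWithinEval m 2 Set.univ 0 t = 1 + t ^ 2 / 2 := by
      rw [taylor_within_apply]
      simp only [Finset.sum_range_succ, Finset.sum_range_zero, iteratedDerivWithin_univ, hm2,
        iteratedDeriv_one, iteratedDeriv_zero, hm0, hm1, smul_eq_mul]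
      norm_num [Nat.factorial]
      ring
    rcases eq_or_ne t 0 with rfl | ht0
    · simp [hm0]
    · simp only [he, h1, sub_zero, smul_eq_mul]
      field_simp
      ring
  have h2 : Tendsto (fun β : ℝ => 2 * β) (𝓝 0) (𝓝 0) := by
    simpa using (continuous_const_mul (2 : ℝ)).tendsto 0
  -- The bound `1/2` gives `m β ≥ 1`. Since `m β ^ 2 ≥ 2 * m β - 1`, the remainders at `β` and `2β`
  -- contribute at most `(2 + 4) β² ε / 6 = ε β²`.
  have hsmall : ∀ᶠ t in 𝓝 (0 : ℝ), |e t| < min (ε / 6) (1 / 2) := by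
    have := ht.eventually
      (Metric.ball_mem_nhds (0 : ℝ) (show 0 < min (ε / 6) (1 / 2) by positivity))
    simpa using this
  filter_upwards [hsmall, h2.eventually hsmall] with β hβ1 hβ2
  have hb1 := abs_lt.1 (hβ1.trans_le (min_le_left _ _))
  have hb2 := abs_lt.1 (hβ2.trans_le (min_le_left _ _))
  have hb3 := abs_lt.1 (hβ1.trans_le (min_le_right _ _))
  have hβ : 0 ≤ β ^ 2 := sq_nonneg β
  have hf1 : 1 ≤ m β := by rw [hexp]; nlinarith
  have hf2 : 1 ≤ m β ^ 2 := one_le_pow₀ hf1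
  have h3 : 2 * m β - 1 ≤ m β ^ 2 := by nlinarith [sq_nonneg (m β - 1)]
  have h4 : m (2 * β) ≤ m β ^ 2 + (1 + ε) * β ^ 2 := by
    have := hexp β
    have := hexp (2 * β)
    nlinarith
  rw [sub_le_iff_le_add, div_le_iff₀ (by positivity)]
  have h5 : 0 ≤ (1 + ε) * β ^ 2 := by positivity
  nlinarith

end Disorder

/-! ### Expected logarithm: superadditivity and lower bounds -/

section LogPartition

variable {Ω : Type*} [MeasurableSpace Ω] {Q : Measure Ω} [IsProbabilityMeasure Q]
  {ω : ℕ → Ω → ℝ} {K : ℕ → ℝ}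

/-- The expected logarithm of the partition function with weights `exp (β ω + h - lam)`. -/
def logPartition (Q : Measure Ω) (ω : ℕ → Ω → ℝ) (K : ℕ → ℝ) (lam β h : ℝ) (N : ℕ) : ℝ :=
  ∫ w, Real.log (totalWeight K (fun n => Real.exp (β * ω n w + h - lam)) N) ∂Q

lemma sum_Ico_kernel_le (hK : ∀ n, 0 ≤ K n) (hs : HasSum (fun n => K (n + 1)) 1) (N : ℕ) :
    ∑ m ∈ Finset.range N, K (N - m) ≤ 1 := by
  rw [← Finset.sum_range_reflect]
  refine le_trans (le_of_eq (Finset.sum_congr rfl fun m hm => ?_))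
    (sum_le_hasSum (Finset.range N) (fun _ _ => hK _) hs)
  have := Finset.mem_range.1 hm
  congr 1
  omega

/-- A crude bound, needed only for integrability of the logarithm. -/
lemma totalWeight_le_exp_sum (hK : ∀ n, 0 ≤ K n) (hs : HasSum (fun n => K (n + 1)) 1)
    (x : ℕ → ℝ) (N : ℕ) : totalWeight K (fun n => Real.exp (x n)) N ≤
      Real.exp (∑ i ∈ Finset.range N, |x (i + 1)|) := by
  induction N using Nat.strong_induction_on with
  | _ N ih =>
    rcases eq_or_ne N 0 with rfl | hN
    · simp
    obtain ⟨N, rfl⟩ := Nat.exists_eq_succ_of_ne_zero hN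
    rw [totalWeight_eq_mul_preWeight hN, Finset.sum_range_succ, add_comm, Real.exp_add]
    refine mul_le_mul (Real.exp_le_exp.2 (le_abs_self _)) ?_
      (preWeight_nonneg hK (fun _ => (Real.exp_pos _).le) _) (Real.exp_pos _).le
    calc preWeight K (fun n => Real.exp (x n)) (N + 1)
        ≤ ∑ m ∈ Finset.range (N + 1),
          Real.exp (∑ i ∈ Finset.range N, |x (i + 1)|) * K (N + 1 - m) := by
          refine Finset.sum_le_sum fun m hm => mul_le_mul_of_nonneg_right ?_ (hK _)
          have hm := Finset.mem_range.1 hm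
          refine (ih m hm).trans (Real.exp_le_exp.2 ?_)
          exact Finset.sum_le_sum_of_subset_of_nonneg (Finset.range_subset_range.2 (by omega))
            fun _ _ _ => abs_nonneg _
      _ ≤ _ := by
          rw [← Finset.mul_sum]
          exact mul_le_of_le_one_right (Real.exp_pos _).le (sum_Ico_kernel_le hK hs _)

lemma totalWeight_pos (hK : ∀ n, 0 ≤ K n) {w : ℕ → ℝ} (hw : ∀ n, 0 < w n) {N : ℕ} (hN : N ≠ 0)
    (hKN : 0 < K N) : 0 < totalWeight K w N := by
  rw [totalWeight_eq_mul_preWeight hN]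
  exact mul_pos (hw N) (hKN.trans_le (le_preWeight hK (fun n => (hw n).le) hN))

/-- The logarithm is squeezed between the contribution of the single jump from `0` to `N`, which
requires `K N > 0`, and a finite sum of absolute values of the disorder. -/
lemma integrable_log_totalWeight (hω : IsDisorder Q ω) (hK : ∀ n, 0 ≤ K n)
    (hs : HasSum (fun n => K (n + 1)) 1) (lam β h : ℝ) {N : ℕ} (hN : N ≠ 0) (hKN : 0 < K N) :
    Integrable (fun w =>
      Real.log (totalWeight K (fun n => Real.exp (β * ω n w + h - lam)) N)) Q := by
  have hi : ∀ n, Integrable (fun w => β * ω n w + h - lam) Q := fun n =>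
    (((hω.integrable n).1.const_mul β).add (integrable_const h)).sub (integrable_const lam)
  have hm : AEMeasurable (fun w =>
      Real.log (totalWeight K (fun n => Real.exp (β * ω n w + h - lam)) N)) Q := by
    have h1 : Measurable fun y : ℕ → ℝ =>
        Real.log (totalWeight K (fun n => Real.exp (β * y n + h - lam)) N) :=
      Real.measurable_log.comp ((measurable_totalWeight K N).comp (by fun_prop))
    exact h1.comp_aemeasurable (aemeasurable_pi_lambda _ hω.aemeasurable)
  have hdom : Integrable (fun w => (∑ i ∈ Finset.range N, |β * ω (i + 1) w + h - lam|) +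
      (|Real.log (K N)| + |β * ω N w + h - lam|)) Q :=
    (integrable_finsetSum _ fun i _ => (hi (i + 1)).abs).add
      ((integrable_const _).add (hi N).abs)
  refine hdom.mono' hm.aestronglyMeasurable (Eventually.of_forall fun w => ?_)
  have hpos := totalWeight_pos hK (w := fun n => Real.exp (β * ω n w + h - lam))
    (fun n => Real.exp_pos _) hN hKN
  have hup := (Real.log_le_iff_le_exp hpos).2
    (totalWeight_le_exp_sum hK hs (fun n => β * ω n w + h - lam) N)
  have hlow : Real.log (K N) + (β * ω N w + h - lam) ≤
      Real.log (totalWeight K (fun n => Real.exp (β * ω n w + h - lam)) N) := by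
    rw [totalWeight_eq_mul_preWeight hN]
    have hpre := le_preWeight hK (w := fun n => Real.exp (β * ω n w + h - lam))
      (fun n => (Real.exp_pos _).le) hN
    rw [Real.log_mul (Real.exp_pos _).ne' (hKN.trans_le hpre).ne', Real.log_exp, add_comm]
    gcongr
  have h1 := neg_abs_le (Real.log (K N))
  have h2 := neg_abs_le (β * ω N w + h - lam)
  have h3 : 0 ≤ ∑ i ∈ Finset.range N, |β * ω (i + 1) w + h - lam| :=
    Finset.sum_nonneg fun _ _ => abs_nonneg _
  have h4 := abs_nonneg (Real.log (K N))
  have h5 := abs_nonneg (β * ω N w + h - lam)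
  rw [Real.norm_eq_abs, abs_le]
  constructor <;> linarith

omit [IsProbabilityMeasure Q] in
lemma IsDisorder.identDistrib_shift (hω : IsDisorder Q ω) (N : ℕ) :
    IdentDistrib (fun w => fun n => ω (n + N) w) (fun w => fun n => ω n w) Q Q :=
  IdentDistrib.pi (fun n => (hω.identDistrib (n + N)).trans (hω.identDistrib n).symm)
    (hω.indep.precomp (add_left_injective N)) hω.indep

/-- Forcing a visit at `N` factorizes the path. The second factor sees a shifted environment, which
has the same law. -/
lemma logPartition_add_le (hω : IsDisorder Q ω) (hK : ∀ n, 0 ≤ K n)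
    (hs : HasSum (fun n => K (n + 1)) 1) (lam β h : ℝ) {N M : ℕ} (hN : N ≠ 0) (hM : M ≠ 0)
    (hKN : 0 < K N) (hKM : 0 < K M) (hKNM : 0 < K (M + N)) :
    logPartition Q ω K lam β h N + logPartition Q ω K lam β h M ≤
      logPartition Q ω K lam β h (M + N) := by
  set F : (ℕ → ℝ) → ℝ := fun y =>
    Real.log (totalWeight K (fun n => Real.exp (β * y n + h - lam)) M) with hF
  have hFm : Measurable F :=
    Real.measurable_log.comp ((measurable_totalWeight K M).comp (by fun_prop))
  have hid := (hω.identDistrib_shift N).comp hFm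
  have hiM := integrable_log_totalWeight hω hK hs lam β h hM hKM
  have hiM' : Integrable (fun w => F fun n => ω (n + N) w) Q := hid.integrable_iff.2 hiM
  have hEM : logPartition Q ω K lam β h M = ∫ w, F (fun n => ω (n + N) w) ∂Q :=
    hid.integral_eq.symm
  have hiN := integrable_log_totalWeight hω hK hs lam β h hN hKN
  rw [hEM, logPartition, logPartition, ← integral_add hiN hiM']
  refine integral_mono (hiN.add hiM')
    (integrable_log_totalWeight hω hK hs lam β h (by omega) hKNM) fun w => ?_
  simp only [hF]
  rw [← Real.log_mul (totalWeight_pos hK (fun n => Real.exp_pos _) hN hKN).ne'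
    (totalWeight_pos hK (fun n => Real.exp_pos _) hM hKM).ne']
  refine Real.log_le_log (mul_pos (totalWeight_pos hK (fun n => Real.exp_pos _) hN hKN)
    (totalWeight_pos hK (fun n => Real.exp_pos _) hM hKM)) ?_
  exact totalWeight_mul_le hK (fun n => (Real.exp_pos _).le) N M

/-- A finite volume criterion for a linear lower bound on the expected logarithm. -/
lemma exists_eventually_le_logPartition (hω : IsDisorder Q ω) (hK : ∀ n, 0 ≤ K n)
    (hs : HasSum (fun n => K (n + 1)) 1) (lam β h : ℝ) {n₀ N : ℕ} (hn₀ : ∀ n ≥ n₀, 0 < K n)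
    (hN : n₀ ≤ N) (hN0 : N ≠ 0) (hpos : 0 < logPartition Q ω K lam β h N) :
    ∃ c > 0, ∀ᶠ n : ℕ in atTop, c ≤ 1 / (n : ℝ) * logPartition Q ω K lam β h n := by
  set G := logPartition Q ω K lam β h with hG
  have hNr : (0 : ℝ) < N := by positivity
  have hstep : ∀ k r, N ≤ r → k * G N + G r ≤ G (r + k * N) := by
    intro k r hr
    induction k with
    | zero => simp
    | succ k ih =>
      have h1 := logPartition_add_le hω hK hs lam β h (N := N) (M := r + k * N) hN0 (by omega)
        (hn₀ _ hN) (hn₀ _ (by omega)) (hn₀ _ (by omega))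
      rw [show r + (k + 1) * N = r + k * N + N by ring]
      push_cast
      linarith
  set B := ∑ r ∈ Finset.range (2 * N), |G r| with hB
  refine ⟨G N / (2 * N), by positivity, ?_⟩
  have hlarge : ∀ᶠ n : ℕ in atTop, (2 * G N + B) / (G N / (2 * N)) ≤ n :=
    tendsto_natCast_atTop_atTop.eventually (eventually_ge_atTop _)
  filter_upwards [hlarge, eventually_ge_atTop (2 * N), eventually_gt_atTop 0] with n hn hn2 hn0
  have hmod : n % N < N := Nat.mod_lt _ (Nat.pos_of_ne_zero hN0)
  have hdiv : 2 ≤ n / N := (Nat.le_div_iff_mul_le (Nat.pos_of_ne_zero hN0)).2 hn2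
  -- The remainder is taken in `[N, 2N)` instead of `[0, N)`, so that the kernel is positive there
  -- and superadditivity applies.
  have hdec : N + n % N + (n / N - 1) * N = n := by
    have h1 := Nat.mod_add_div n N
    obtain ⟨q, hq⟩ := Nat.exists_eq_add_of_le hdiv
    rw [hq] at h1 ⊢
    rw [show 2 + q - 1 = q + 1 by omega]
    nlinarith
  have h1 := hstep (n / N - 1) (N + n % N) (by omega)
  rw [hdec] at h1
  have h2 : |G (N + n % N)| ≤ B :=
    Finset.single_le_sum (f := fun r => |G r|) (fun _ _ => abs_nonneg _)
      (Finset.mem_range.2 (by omega))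
  have h3 := neg_abs_le (G (N + n % N))
  have h4 : (n : ℝ) / N - 2 ≤ ((n / N - 1 : ℕ) : ℝ) := by
    rw [Nat.cast_sub (by omega)]
    have h5 : (n : ℝ) = N * ((n / N : ℕ) : ℝ) + ((n % N : ℕ) : ℝ) := by
      exact_mod_cast (Nat.div_add_mod n N).symm
    have h6 : ((n % N : ℕ) : ℝ) ≤ N := by exact_mod_cast hmod.le
    have h7 : (n : ℝ) / N ≤ ((n / N : ℕ) : ℝ) + 1 := by
      rw [div_le_iff₀ hNr]; linarith
    push_cast
    linarith
  have hnr : (0 : ℝ) < n := by exact_mod_cast hn0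
  rw [div_le_iff₀ (by positivity)] at hn
  rw [one_div, ← div_eq_inv_mul, le_div_iff₀ hnr]
  have h8 : ((n : ℝ) / N - 2) * G N ≤ ((n / N - 1 : ℕ) : ℝ) * G N :=
    mul_le_mul_of_nonneg_right h4 hpos.le
  have h9 : (n : ℝ) / N * G N = 2 * (G N / (2 * N) * n) := by field_simp
  linarith

/-- Lower bound on the expected logarithm from the paths with many points in `[0, M]`. -/
lemma le_logPartition (hω : IsDisorder Q ω) (hK : ∀ n, 0 ≤ K n)
    (hs : HasSum (fun n => K (n + 1)) 1) {β h a d : ℝ} {L M N : ℕ} (hMN : M < N) (hh : 0 ≤ h)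
    (ha : 0 < a) (haK : ∀ m ≤ M, a ≤ K (N - m))
    (hd : (mgf (ω 0) Q (2 * β) / mgf (ω 0) Q β ^ 2 - 1) *
      ∑ n ∈ Finset.range M, mass K (n + 1) ^ 2 ≤ d) (hd1 : d < 1)
    (hL : 1 / 2 ≤ stepMass K L M) (hhL : Real.log 4 ≤ h * L) :
    Real.log a + h - cgf (ω 0) Q β + (1 - d) / 16 * (h * L - Real.log 4) ≤
      logPartition Q ω K (cgf (ω 0) Q β) β h N := by
  set lam := cgf (ω 0) Q β with hlam
  have hN : N ≠ 0 := by omega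
  have hKN : a ≤ K N := by simpa using haK 0 (Nat.zero_le _)
  obtain ⟨hi, hprob⟩ := (hω.isRandomWeight β).le_integral_longWeight hK hs hd hd1 hL
  set W : Ω → ℝ := fun w => longWeight K (fun n => Real.exp (β * ω n w - lam)) L M with hW
  set I : Ω → ℝ := fun w => if 1 / 4 ≤ W w then (1 : ℝ) else 0 with hI
  have hi : Integrable I Q := hi
  have hpt : ∀ w, (Real.log a + h - lam) + (β * ω N w + (h * L - Real.log 4) * I w) ≤
      Real.log (totalWeight K (fun n => Real.exp (β * ω n w + h - lam)) N) := by
    intro w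
    have hwt : (fun n => Real.exp (β * ω n w + h - lam)) =
        fun n => Real.exp h * Real.exp (β * ω n w - lam) := by
      funext n; rw [← Real.exp_add]; congr 1; ring
    have h0 := hKN.trans (le_preWeight hK (w := fun n => Real.exp (β * ω n w + h - lam))
      (fun n => (Real.exp_pos _).le) hN)
    have hpre : Real.log a + (h * L - Real.log 4) * I w ≤
        Real.log (preWeight K (fun n => Real.exp (β * ω n w + h - lam)) N) := by
      simp only [hI]
      split_ifs with hA
      · have h1 := mul_longWeight_le_preWeight (L := L) hK
          (w := fun n => Real.exp (β * ω n w - lam)) (fun n => (Real.exp_pos _).le) hMN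
          (Real.one_le_exp hh) ha.le haK
        rw [← hwt] at h1
        have h2 : a * (Real.exp h ^ L * (1 / 4)) ≤
            preWeight K (fun n => Real.exp (β * ω n w + h - lam)) N :=
          le_trans (by gcongr) h1
        refine le_trans (le_of_eq ?_) (Real.log_le_log (by positivity) h2)
        rw [Real.log_mul ha.ne' (by positivity), Real.log_mul (by positivity) (by norm_num),
          Real.log_pow, Real.log_exp, one_div, Real.log_inv]
        ring
      -- Off the good event the direct jump from `0` to `N` is enough: only the cost `log a` is
      -- paid.
      · rw [mul_zero, add_zero]
        exact Real.log_le_log ha h0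
    rw [totalWeight_eq_mul_preWeight hN, Real.log_mul (Real.exp_pos _).ne' (ha.trans_le h0).ne',
      Real.log_exp]
    linarith
  have hi1 : Integrable (fun w => β * ω N w + (h * L - Real.log 4) * I w) Q :=
    ((hω.integrable N).1.const_mul β).add (hi.const_mul _)
  have h1 : _ ≤ logPartition Q ω K lam β h N := integral_mono ((integrable_const _).add hi1)
    (integrable_log_totalWeight hω hK hs lam β h hN (ha.trans_le hKN)) hpt
  simp only [Pi.add_apply] at h1
  rw [integral_add (integrable_const _) hi1, integral_add ((hω.integrable N).1.const_mul β)
    (hi.const_mul _), integral_const_mul, integral_const_mul, (hω.integrable N).2] at h1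
  simp only [integral_const, probReal_univ, smul_eq_mul, one_mul, mul_zero, zero_add] at h1
  refine le_trans ?_ h1
  have h2 : (1 - d) / 16 * (h * L - Real.log 4) ≤ (∫ w, I w ∂Q) * (h * L - Real.log 4) :=
    mul_le_mul_of_nonneg_right hprob (sub_nonneg.2 hhL)
  linarith

end LogPartition

/-! ### Choice of the number of points and of the field -/

section Asymptotics

lemma tendsto_natCast_rpow_atTop {p : ℝ} (hp : 0 < p) :
    Tendsto (fun n : ℕ => (n : ℝ) ^ p) atTop atTop :=
  (tendsto_rpow_atTop hp).comp tendsto_natCast_atTop_atTop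

lemma third_le_half {N : ℕ} (hN : 2 ≤ N) : (N : ℝ) / 3 ≤ ((N / 2 : ℕ) : ℝ) := by
  rw [div_le_iff₀ (by norm_num)]
  have : N ≤ (N / 2) * 3 := by omega
  exact_mod_cast this

/-- The lower bound on the expected logarithm is eventually positive. -/
lemma eventually_lower_bound_pos {ε : ℝ} (hε : 0 < ε) (hε1 : ε < 1) :
    ∀ᶠ N : ℕ in atTop,
      Real.log 4 ≤ (N : ℝ) ^ (-(1 / 2) * (1 - ε)) *
        (⌊((N / 2 : ℕ) : ℝ) ^ (1 / 2 - ε / 4)⌋₊ : ℝ) ∧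
      0 < Real.log (((N : ℝ) ^ 2)⁻¹) - 1 + (1 - (1 - ε / 2)) / 16 *
        ((N : ℝ) ^ (-(1 / 2) * (1 - ε)) * (⌊((N / 2 : ℕ) : ℝ) ^ (1 / 2 - ε / 4)⌋₊ : ℝ)
          - Real.log 4) := by
  have hlog := ((isLittleO_log_rpow_atTop (show 0 < ε / 4 by positivity)).bound
    (show 0 < ε / 400 by positivity))
  have h1 := tendsto_natCast_atTop_atTop.eventually hlog
  have hlog4 : Real.log 4 ≤ 3 := by
    have := Real.log_le_sub_one_of_pos (show (0 : ℝ) < 4 by norm_num)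
    linarith
  have h2 := (tendsto_natCast_rpow_atTop (show 0 < ε / 4 by positivity)).eventually
    (eventually_ge_atTop (1000 / ε))
  filter_upwards [h1, h2, eventually_ge_atTop 2] with N hN1 hN2 hN
  have hN0 : (0 : ℝ) < N := by positivity
  have hN1' : (1 : ℝ) ≤ N := by exact_mod_cast (by omega : 1 ≤ N)
  -- The exponents add up to `-(1 - ε)/2 + (1/2 - ε/4) = ε/4`, so `h L` is at least `A / 3 - 1`, the
  -- `3` coming from `N / 2`. The thresholds make `(ε/32)(A/3 - 4)` beat `2 log N + 1`.
  set A := (N : ℝ) ^ (ε / 4) with hA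
  have hA0 : 0 < A := Real.rpow_pos_of_pos hN0 _
  have hlogN : Real.log N ≤ ε / 400 * A := by
    have := (le_abs_self _).trans hN1
    rwa [Real.norm_of_nonneg hA0.le] at this
  set h := (N : ℝ) ^ (-(1 / 2) * (1 - ε)) with hh
  have hh0 : 0 < h := Real.rpow_pos_of_pos hN0 _
  have hh1 : h ≤ 1 := Real.rpow_le_one_of_one_le_of_nonpos hN1' (by linarith)
  have hfl : A / 3 - 1 ≤ h * (⌊((N / 2 : ℕ) : ℝ) ^ (1 / 2 - ε / 4)⌋₊ : ℝ) := by
    have h3 := (Nat.lt_floor_add_one (((N / 2 : ℕ) : ℝ) ^ (1 / 2 - ε / 4))).le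
    have h4 : (N : ℝ) ^ (1 / 2 - ε / 4) / 3 ≤ ((N / 2 : ℕ) : ℝ) ^ (1 / 2 - ε / 4) := by
      calc (N : ℝ) ^ (1 / 2 - ε / 4) / 3
          ≤ (N : ℝ) ^ (1 / 2 - ε / 4) / (3 : ℝ) ^ (1 / 2 - ε / 4) := by
            refine div_le_div_of_nonneg_left (Real.rpow_nonneg hN0.le _) (by positivity) ?_
            exact Real.rpow_le_self_of_one_le (by norm_num) (by linarith)
        _ = ((N : ℝ) / 3) ^ (1 / 2 - ε / 4) := (Real.div_rpow hN0.le (by norm_num) _).symm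
        _ ≤ _ := Real.rpow_le_rpow (by positivity) (third_le_half hN) (by linarith)
    have h5 : h * (N : ℝ) ^ (1 / 2 - ε / 4) = A := by
      rw [hh, hA, ← Real.rpow_add hN0]; congr 1; ring
    have h6 : h * ((N : ℝ) ^ (1 / 2 - ε / 4) / 3) ≤
        h * ((⌊((N / 2 : ℕ) : ℝ) ^ (1 / 2 - ε / 4)⌋₊ : ℝ) + 1) :=
      mul_le_mul_of_nonneg_left (h4.trans h3) hh0.le
    rw [← mul_div_assoc, h5] at h6
    linarith
  rw [div_le_iff₀ hε] at hN2
  have hA2 : 1000 ≤ A := by nlinarith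
  refine ⟨by linarith, ?_⟩
  rw [Real.log_inv, Real.log_pow]
  have h7 : ε / 32 * (A / 3 - 1 - 3) ≤ (1 - (1 - ε / 2)) / 16 *
      (h * (⌊((N / 2 : ℕ) : ℝ) ^ (1 / 2 - ε / 4)⌋₊ : ℝ) - Real.log 4) := by
    rw [show (1 - (1 - ε / 2)) / 16 = ε / 32 by ring]
    exact mul_le_mul_of_nonneg_left (by linarith) (by positivity)
  push_cast
  nlinarith

/-- With `L ≤ M ^ p` and `p < q`, the loss `L * truncMean K M` is at most `C * M ^ (p - q)`, which
tends to zero. -/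
lemma eventually_half_le_stepMass {K : ℕ → ℝ} (hK : ∀ n, 0 ≤ K n)
    (hs : HasSum (fun n => K (n + 1)) 1) {C p q : ℝ} (hC : 0 < C) (hpq : p < q)
    (h : ∀ M : ℕ, M ≠ 0 → truncMean K M ≤ C * (M : ℝ) ^ (-q)) :
    ∀ᶠ M : ℕ in atTop, 1 / 2 ≤ stepMass K ⌊(M : ℝ) ^ p⌋₊ M := by
  have h1 := (tendsto_natCast_rpow_atTop (show 0 < q - p by linarith)).eventually
    (eventually_ge_atTop (2 * C))
  filter_upwards [h1, eventually_gt_atTop 0] with M hM hM0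
  have hM0' : (0 : ℝ) < M := by exact_mod_cast hM0
  refine le_trans ?_ (one_sub_truncMean_le_stepMass hK hs hM0.ne' _)
  have h2 : (⌊(M : ℝ) ^ p⌋₊ : ℝ) * truncMean K M ≤ (M : ℝ) ^ p * (C * (M : ℝ) ^ (-q)) := by
    have h3 := Nat.floor_le (Real.rpow_nonneg hM0'.le p)
    calc _ ≤ (⌊(M : ℝ) ^ p⌋₊ : ℝ) * (C * (M : ℝ) ^ (-q)) :=
          mul_le_mul_of_nonneg_left (h M hM0.ne') (Nat.cast_nonneg _)
      _ ≤ _ := mul_le_mul_of_nonneg_right h3 (by positivity)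
  have h4 : (M : ℝ) ^ p * (C * (M : ℝ) ^ (-q)) = C / (M : ℝ) ^ (q - p) := by
    rw [mul_left_comm, ← Real.rpow_add hM0', div_eq_mul_inv, ← Real.rpow_neg hM0'.le]
    congr 2; ring
  have h5 : C / (M : ℝ) ^ (q - p) ≤ 1 / 2 := by
    rw [div_le_iff₀ (by positivity)]; linarith
  linarith

end Asymptotics

/-! ### Positive free energy and the bound by `DInv` -/

section Main

variable {S : Type*} [MeasurableSpace S] {Ω : Type*} [MeasurableSpace Ω]
  {P : Measure S} [IsProbabilityMeasure P] {ξ : ℕ → S → ℕ} {φ : ℝ → ℝ}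
  {Q : Measure Ω} [IsProbabilityMeasure Q] {ω : ℕ → Ω → ℝ}

lemma D_eq (hξ : IsRenewalIncrements P ξ φ) (N : ℕ) :
    D P ξ N = ∑ n ∈ Finset.range N, mass (interArrival φ) (n + 1) ^ 2 := by
  simp only [D, renewalMass_eq hξ]
  rw [Finset.range_eq_Ico, Finset.sum_Ico_add' (fun n => mass (interArrival φ) n ^ 2)]
  rfl

omit [IsProbabilityMeasure Q] in
lemma freeEnergy_eq (hξ : IsRenewalIncrements P ξ φ) (β h : ℝ) : freeEnergy P ξ Q ω β h =
    liminf (fun N : ℕ => ((1 / (N : ℝ) *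
      logPartition Q ω (interArrival φ) (cgf (ω 0) Q β) β h N : ℝ) : EReal)) atTop := by
  simp only [freeEnergy, logPartition, partitionFunction_eq hξ]

/-- As long as the expected overlap up to `N` is below `(1 - ε) / β ^ 2`, a field slightly larger
than `N ^ (-1/2)` localizes the path. -/
theorem exists_freeEnergy_pos (hφ : SlowlyVarying φ) (hξ : IsRenewalIncrements P ξ φ)
    (hω : IsDisorder Q ω) {ε : ℝ} (hε : 0 < ε) (hε1 : ε < 1) :
    ∃ β₀ > 0, ∃ N₀ : ℕ, ∀ β, 0 < β → β ≤ β₀ → ∀ N ≥ N₀, D P ξ N ≤ (1 - ε) / β ^ 2 →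
      0 < freeEnergy P ξ Q ω β ((N : ℝ) ^ (-(1 / 2) * (1 - ε))) := by
  have hK := interArrival_nonneg hξ
  have hs := hasSum_interArrival hξ
  -- The decay exponent becomes `1/2 - ε/8`, which beats the number of points `M ^ (1/2 - ε/4)`.
  obtain ⟨C, hC, htm⟩ := hφ.truncMean_le hK hs (δ := ε / 16) (by positivity) (by linarith)
  have hstep := eventually_half_le_stepMass hK hs (p := 1 / 2 - ε / 4) hC
    (by linarith) htm
  obtain ⟨n₁, hn₁⟩ := eventually_atTop.1 hstep
  obtain ⟨n₂, hn₂⟩ := eventually_atTop.1 hφ.le_interArrival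
  obtain ⟨n₃, hn₃⟩ := eventually_atTop.1 (eventually_lower_bound_pos hε hε1)
  have hcgf : ∀ᶠ β in 𝓝 (0 : ℝ), cgf (ω 0) Q β ≤ 1 := by
    have h1 : ContinuousAt (cgf (ω 0) Q) 0 :=
      (analyticAt_cgf (hω.interior_integrableExpSet ▸ Set.mem_univ 0)).continuousAt
    refine h1.tendsto.eventually (ge_mem_nhds ?_)
    simp
  obtain ⟨r, hr, hball⟩ := Metric.eventually_nhds_iff.1
    ((hω.eventually_var_le (show 0 < ε / 2 by positivity)).and hcgf)
  refine ⟨r / 2, by positivity, 2 * n₁ + 2 * n₂ + n₃ + 2, fun β hβ hβr N hN hDN => ?_⟩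
  obtain ⟨hvar, hlam⟩ := hball (y := β) (by
    rw [Real.dist_eq, sub_zero, abs_of_pos hβ]; linarith)
  have hN0 : N ≠ 0 := by omega
  have hN0' : (0 : ℝ) < N := by positivity
  have hKpos : ∀ n ≥ n₂ + 1, 0 < interArrival φ n := fun n hn =>
    lt_of_lt_of_le (by have : n ≠ 0 := by omega
                       positivity) (hn₂ n (by omega))
  obtain ⟨hl1, hl2⟩ := hn₃ N (by omega)
  set h := (N : ℝ) ^ (-(1 / 2) * (1 - ε)) with hh
  have hh0 : 0 < h := Real.rpow_pos_of_pos hN0' _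
  have hd : (mgf (ω 0) Q (2 * β) / mgf (ω 0) Q β ^ 2 - 1) *
      ∑ n ∈ Finset.range (N / 2), mass (interArrival φ) (n + 1) ^ 2 ≤ 1 - ε / 2 := by
    have h1 : ∑ n ∈ Finset.range (N / 2), mass (interArrival φ) (n + 1) ^ 2 ≤
        (1 - ε) / β ^ 2 := by
      refine le_trans ?_ ((D_eq hξ N).symm.trans_le hDN)
      exact Finset.sum_le_sum_of_subset_of_nonneg
        (Finset.range_subset_range.2 (Nat.div_le_self _ _)) fun _ _ _ => sq_nonneg _
    calc _ ≤ ((1 + ε / 2) * β ^ 2) * ((1 - ε) / β ^ 2) :=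
          mul_le_mul hvar h1 (Finset.sum_nonneg fun _ _ => sq_nonneg _) (by positivity)
      _ = (1 + ε / 2) * (1 - ε) := by field_simp
      _ ≤ 1 - ε / 2 := by nlinarith
  -- With `M = N / 2` the final jump to `N` has length at least `N / 2`, so its probability is at
  -- least `N⁻²`.
  have hbound := le_logPartition hω hK hs (β := β) (h := h) (a := ((N : ℝ) ^ 2)⁻¹)
    (d := 1 - ε / 2) (L := ⌊((N / 2 : ℕ) : ℝ) ^ (1 / 2 - ε / 4)⌋₊) (M := N / 2) (N := N)
    (by omega) hh0.le (by positivity) (fun m hm => ?_) hd (by linarith) (hn₁ _ (by omega)) hl1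
  · have hpos : 0 < logPartition Q ω (interArrival φ) (cgf (ω 0) Q β) β h N := by linarith
    obtain ⟨c, hc, hev⟩ := exists_eventually_le_logPartition hω hK hs (cgf (ω 0) Q β) β h
      (n₀ := n₂ + 1) hKpos (by omega) hN0 hpos
    rw [freeEnergy_eq hξ]
    refine lt_of_lt_of_le (EReal.coe_pos.2 hc) (le_liminf_of_le ?_ ?_)
    · isBoundedDefault
    · filter_upwards [hev] with n hn
      exact EReal.coe_le_coe_iff.2 hn
  · refine le_trans ?_ (hn₂ (N - m) (by omega))
    have h1 : ((N - m : ℕ) : ℝ) ≤ N := by exact_mod_cast Nat.sub_le N m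
    have h2 : (0 : ℝ) < ((N - m : ℕ) : ℝ) := by
      have : 0 < N - m := by omega
      exact_mod_cast this
    gcongr

omit [IsProbabilityMeasure P] [IsProbabilityMeasure Q] in
lemma criticalPoint_le {β h : ℝ} (hpos : 0 < freeEnergy P ξ Q ω β h) :
    criticalPoint P ξ Q ω β ≤ h := iInf₂_le h hpos

lemma coe_rpow_ennreal {N : ℕ} (hN : N ≠ 0) (p : ℝ) :
    ((((N : ℝ≥0∞) ^ p : ℝ≥0∞)) : EReal) = (((N : ℝ) ^ p : ℝ) : EReal) := by
  have h0 : (0 : ℝ) < N := by positivity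
  rw [← ENNReal.ofReal_natCast, ENNReal.ofReal_rpow_of_pos h0,
    EReal.coe_ennreal_ofReal, max_eq_left (Real.rpow_nonneg h0.le _)]

omit [IsProbabilityMeasure P] in
lemma D_mono : Monotone (D P ξ) := fun _ _ h =>
  Finset.sum_le_sum_of_subset_of_nonneg (Finset.Icc_subset_Icc_right h) fun _ _ _ => sq_nonneg _

omit [IsProbabilityMeasure P] in
lemma le_DInv {x : ℝ} {N : ℕ} (h : D P ξ N ≤ x) : (N : ℕ∞) ≤ DInv P ξ x :=
  le_iSup₂ (f := fun (N : ℕ) (_ : N ∈ {N : ℕ | D P ξ N ≤ x}) => (N : ℕ∞)) N h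

omit [IsProbabilityMeasure P] in
lemma D_le_of_DInv_eq {x : ℝ} {N : ℕ} (hx : 0 ≤ x) (h : DInv P ξ x = N) : D P ξ N ≤ x := by
  by_contra! hcon
  have h0 : N ≠ 0 := by
    rintro rfl
    simp [D] at hcon
    linarith
  have : DInv P ξ x ≤ ((N - 1 : ℕ) : ℕ∞) := by
    refine iSup₂_le fun M hM => ?_
    have hMN : M < N := by
      by_contra! hle
      exact absurd (D_mono hle) (not_le.2 (lt_of_le_of_lt hM hcon))
    exact_mod_cast (by omega : M ≤ N - 1)
  rw [h] at this
  have : N ≤ N - 1 := by exact_mod_cast this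
  omega

lemma tendsto_div_sq_atTop {a : ℝ} (ha : 0 < a) :
    Tendsto (fun β : ℝ => a / β ^ 2) (𝓝[>] 0) atTop := by
  have h1 : Tendsto (fun β : ℝ => β ^ 2) (𝓝[>] 0) (𝓝[>] 0) := by
    refine tendsto_nhdsWithin_iff.2 ⟨?_, ?_⟩
    · have := (continuous_pow (M := ℝ) 2).tendsto 0
      simp only [ne_eq, OfNat.ofNat_ne_zero, not_false_eq_true, zero_pow] at this
      exact this.mono_left nhdsWithin_le_nhds
    · filter_upwards [self_mem_nhdsWithin] with β hβ
      exact pow_pos (Set.mem_Ioi.1 hβ) 2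
  simpa [div_eq_mul_inv] using (tendsto_inv_nhdsGT_zero.comp h1).const_mul_atTop ha

/-- Small `β` forces `D(N₀ + 1) ≤ (1 - ε) / β²`, so a finite `DInv` is itself an admissible length
beyond `N₀`. If `DInv` is infinite, every large length is admissible and the bounds decrease to
zero. -/
theorem criticalPoint_le_DInv (hφ : SlowlyVarying φ) (hξ : IsRenewalIncrements P ξ φ)
    (hω : IsDisorder Q ω) {ε : ℝ} (hε : 0 < ε) (hε1 : ε < 1) :
    ∃ β₀ : ℝ, 0 < β₀ ∧ ∀ β : ℝ, 0 < β → β ≤ β₀ →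
      criticalPoint P ξ Q ω β ≤
        (((DInv P ξ ((1 - ε) / β ^ 2) : ℝ≥0∞) ^ (-(1 / 2) * (1 - ε) : ℝ) : ℝ≥0∞) : EReal) := by
  obtain ⟨β₀, hβ₀, N₀, hmain⟩ := exists_freeEnergy_pos hφ hξ hω hε hε1
  have hev := (tendsto_div_sq_atTop (show 0 < 1 - ε by linarith)).eventually
    (eventually_ge_atTop (D P ξ (N₀ + 1)))
  obtain ⟨r, hr, hball⟩ := Metric.eventually_nhds_iff.1 (eventually_nhdsWithin_iff.1 hev)
  refine ⟨min β₀ (r / 2), by positivity, fun β hβ hβle => ?_⟩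
  have hD : D P ξ (N₀ + 1) ≤ (1 - ε) / β ^ 2 := by
    refine hball (y := β) ?_ hβ
    rw [Real.dist_eq, sub_zero, abs_of_pos hβ]
    have := hβle.trans (min_le_right _ _)
    linarith
  set x := (1 - ε) / β ^ 2 with hx
  have hx0 : 0 ≤ x := div_nonneg (by linarith) (sq_nonneg _)
  have hcrit : ∀ N : ℕ, N₀ + 1 ≤ N → D P ξ N ≤ x →
      criticalPoint P ξ Q ω β ≤ (((N : ℝ) ^ (-(1 / 2) * (1 - ε)) : ℝ) : EReal) := fun N hN hDN =>
    criticalPoint_le (hmain β hβ (hβle.trans (min_le_left _ _)) N (by omega) hDN)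
  induction hinv : DInv P ξ x with
  | top =>
    have hall : ∀ N : ℕ, D P ξ N ≤ x := by
      intro N
      by_contra! hcon
      have : DInv P ξ x ≤ (N : ℕ∞) := by
        refine iSup₂_le fun M hM => ?_
        have hMN : M ≤ N := by
          by_contra! hle
          exact absurd (D_mono hle.le) (not_le.2 (lt_of_le_of_lt hM hcon))
        exact_mod_cast hMN
      rw [hinv] at this
      exact absurd this (by simp)
    have h1 : (((⊤ : ℕ∞) : ℝ≥0∞)) ^ (-(1 / 2) * (1 - ε) : ℝ) = 0 := by
      rw [ENat.toENNReal_top]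
      exact ENNReal.top_rpow_of_neg (by nlinarith)
    rw [h1, EReal.coe_ennreal_zero]
    have h2 : Tendsto (fun N : ℕ => (N : ℝ) ^ (-(1 / 2) * (1 - ε))) atTop (𝓝 0) := by
      have := (tendsto_rpow_neg_atTop (show 0 < 1 / 2 * (1 - ε) by nlinarith)).comp
        tendsto_natCast_atTop_atTop
      simpa [Function.comp_def] using this
    have h3 : Tendsto (fun N : ℕ => (((N : ℝ) ^ (-(1 / 2) * (1 - ε)) : ℝ) : EReal)) atTop
        (𝓝 (0 : EReal)) := by
      have := (continuous_coe_real_ereal.tendsto 0).comp h2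
      simpa [Function.comp_def] using this
    refine ge_of_tendsto h3 ?_
    filter_upwards [eventually_ge_atTop (N₀ + 1)] with N hN
    exact hcrit N hN (hall N)
  | coe N =>
    have hN : N₀ + 1 ≤ N := by
      have := le_DInv (P := P) (ξ := ξ) hD
      rw [hinv] at this
      exact_mod_cast this
    have hcast : (((N : ℕ∞) : ℝ≥0∞)) = (N : ℝ≥0∞) := ENat.toENNReal_coe N
    rw [hcast, coe_rpow_ennreal (by omega)]
    exact hcrit N hN (D_le_of_DInv_eq hx0 hinv)

end Main

/-! ### Generating functions in the unit disc -/

section GeneratingFunction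

/-- The generating function of a real sequence. -/
def genFun (f : ℕ → ℝ) (z : ℂ) : ℂ := ∑' n, (f n : ℂ) * z ^ n

lemma summable_norm_mul_pow {f : ℕ → ℝ} (hf : ∀ n, |f n| ≤ 1) {z : ℂ} (hz : ‖z‖ < 1) :
    Summable fun n => ‖(f n : ℂ) * z ^ n‖ := by
  refine Summable.of_nonneg_of_le (fun n => norm_nonneg _) (fun n => ?_)
    (summable_geometric_of_lt_one (norm_nonneg z) hz)
  rw [norm_mul, norm_pow, Complex.norm_real, Real.norm_eq_abs]
  exact mul_le_of_le_one_left (by positivity) (hf n)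

lemma genFun_mul {f g : ℕ → ℝ} (hf : ∀ n, |f n| ≤ 1) (hg : ∀ n, |g n| ≤ 1) {z : ℂ}
    (hz : ‖z‖ < 1) : genFun f z * genFun g z =
      genFun (fun n => ∑ p ∈ Finset.HasAntidiagonal.antidiagonal n, f p.1 * g p.2) z := by
  rw [genFun, genFun, tsum_mul_tsum_eq_tsum_sum_antidiagonal_of_summable_norm
    (summable_norm_mul_pow hf hz) (summable_norm_mul_pow hg hz), genFun]
  congr 1
  funext n
  push_cast
  rw [Finset.sum_mul]
  refine Finset.sum_congr rfl fun p hp => ?_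
  rw [← Finset.HasAntidiagonal.mem_antidiagonal.1 hp, pow_add]
  ring

lemma genFun_eq_add {f : ℕ → ℝ} (hf : ∀ n, |f n| ≤ 1) {z : ℂ} (hz : ‖z‖ < 1) :
    genFun f z = f 0 + z * genFun (fun n => f (n + 1)) z := by
  rw [genFun, (summable_norm_mul_pow hf hz).of_norm.tsum_eq_zero_add, genFun, ← tsum_mul_left,
    pow_zero, mul_one]
  congr 2
  funext n
  rw [pow_succ]; ring

lemma norm_one_sub_pow_le {z : ℂ} (hz : ‖z‖ ≤ 1) (n : ℕ) : ‖1 - z ^ n‖ ≤ n * ‖1 - z‖ := by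
  induction n with
  | zero => simp
  | succ n ih =>
    have h1 : 1 - z ^ (n + 1) = (1 - z) + z * (1 - z ^ n) := by rw [pow_succ]; ring
    rw [h1]
    refine (norm_add_le _ _).trans ?_
    rw [norm_mul]
    have h2 : ‖z‖ * ‖1 - z ^ n‖ ≤ ‖1 - z ^ n‖ := mul_le_of_le_one_left (norm_nonneg _) hz
    push_cast
    linarith

lemma norm_one_sub_pow_le_two {z : ℂ} (hz : ‖z‖ ≤ 1) (n : ℕ) : ‖1 - z ^ n‖ ≤ 2 := by
  refine (norm_sub_le _ _).trans ?_
  rw [norm_one, norm_pow]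
  have := pow_le_one₀ (norm_nonneg z) hz (n := n)
  linarith

/-- Comparison of complex and real increments. -/
lemma norm_one_sub_pow_le_mul {z : ℂ} (hz : ‖z‖ ≤ 1) (n : ℕ) :
    ‖1 - z ^ n‖ ≤ 4 * (1 - (1 - ‖1 - z‖ / 2) ^ n) := by
  set t := ‖1 - z‖ / 2 with ht
  have ht0 : 0 ≤ t := by positivity
  have ht1 : t ≤ 1 := by
    have := norm_one_sub_pow_le_two hz 1
    rw [pow_one] at this
    linarith
  -- Bernoulli's inequality combined with `(1 - t²)^n ≤ 1`. It remains to compare `min (2nt) 2`,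
  -- which bounds the left side of the goal, with `4nt / (1 + nt)`.
  have h1 : (1 - t) ^ n ≤ (1 + n * t)⁻¹ := by
    have h2 : 1 + n * t ≤ (1 + t) ^ n := one_add_mul_le_pow (by linarith) n
    have h3 : (1 - t) ^ n * (1 + t) ^ n ≤ 1 := by
      rw [← mul_pow]
      exact pow_le_one₀ (by nlinarith) (by nlinarith)
    have h4 : (0 : ℝ) < 1 + n * t := by positivity
    rw [← one_div, le_div_iff₀ h4]
    exact (mul_le_mul_of_nonneg_left h2 (pow_nonneg (by linarith) n)).trans h3
  have hnt : 0 ≤ n * t := by positivity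
  have h5 : n * t / (1 + n * t) ≤ 1 - (1 - t) ^ n := by
    have : n * t / (1 + n * t) = 1 - (1 + n * t)⁻¹ := by field_simp; ring
    linarith
  refine le_trans ?_ (mul_le_mul_of_nonneg_left h5 (by norm_num))
  rw [← mul_div_assoc, le_div_iff₀ (by positivity)]
  have h6 := norm_one_sub_pow_le_two hz n
  have h7 := norm_one_sub_pow_le hz n
  rw [show ‖1 - z‖ = 2 * t by rw [ht]; ring] at h7
  rcases le_total (n * t) 1 with h | h
  · nlinarith [norm_nonneg (1 - z ^ n)]
  · nlinarith [norm_nonneg (1 - z ^ n)]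

end GeneratingFunction

/-! ### Central binomial probabilities and first returns -/

section CentralBinom

/-- The normalized central binomial coefficients. -/
def centralProb (n : ℕ) : ℝ := (n.centralBinom : ℝ) / 4 ^ n

lemma centralProb_zero : centralProb 0 = 1 := by simp [centralProb]

lemma centralProb_pos (n : ℕ) : 0 < centralProb n :=
  div_pos (by exact_mod_cast n.centralBinom_pos) (by positivity)

lemma centralProb_succ (n : ℕ) :
    (2 * n + 2) * centralProb (n + 1) = (2 * n + 1) * centralProb n := by
  have h : ((n : ℝ) + 1) * ((n + 1).centralBinom : ℝ) = 2 * (2 * n + 1) * (n.centralBinom : ℝ) := by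
    exact_mod_cast Nat.succ_mul_centralBinom_succ n
  unfold centralProb
  rw [pow_succ]
  field_simp
  linarith

lemma centralProb_le_one (n : ℕ) : centralProb n ≤ 1 :=
  div_le_one_of_le₀ (by exact_mod_cast n.centralBinom_le_four_pow) (by positivity)

lemma abs_centralProb_le (n : ℕ) : |centralProb n| ≤ 1 := by
  rw [abs_of_pos (centralProb_pos n)]; exact centralProb_le_one n

/-- These are the coefficients of the square of `(1 - z)^(-1/2)`. By symmetry, weighting a term by
its first index amounts to a factor `n / 2`; with `centralProb_succ` this gives `(n + 1) a (n + 1) =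
(n + 1) a n` for the convolution `a`. -/
lemma sum_antidiagonal_centralProb (n : ℕ) :
    ∑ p ∈ Finset.HasAntidiagonal.antidiagonal n, centralProb p.1 * centralProb p.2 = 1 := by
  have hsym : ∀ m : ℕ, 2 * ∑ p ∈ Finset.HasAntidiagonal.antidiagonal m,
      (p.1 : ℝ) * (centralProb p.1 * centralProb p.2) =
      m * ∑ p ∈ Finset.HasAntidiagonal.antidiagonal m, centralProb p.1 * centralProb p.2 := by
    intro m
    rw [two_mul]
    nth_rewrite 2 [← Finset.Nat.sum_antidiagonal_swap]
    rw [← Finset.sum_add_distrib, Finset.mul_sum]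
    refine Finset.sum_congr rfl fun p hp => ?_
    have h : (m : ℝ) = p.1 + p.2 := by
      exact_mod_cast (Finset.HasAntidiagonal.mem_antidiagonal.1 hp).symm
    rw [h, Prod.fst_swap, Prod.snd_swap]; ring
  induction n with
  | zero => simp [centralProb_zero]
  | succ n ih =>
    have h1 := hsym (n + 1)
    rw [Finset.Nat.sum_antidiagonal_succ] at h1
    have h2 : ∑ p ∈ Finset.HasAntidiagonal.antidiagonal n, (((p.1 + 1 : ℕ) : ℝ)) *
        (centralProb (p.1 + 1) * centralProb p.2) =
        ∑ p ∈ Finset.HasAntidiagonal.antidiagonal n,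
          ((p.1 : ℝ) * (centralProb p.1 * centralProb p.2) +
          1 / 2 * (centralProb p.1 * centralProb p.2)) := by
      refine Finset.sum_congr rfl fun p _ => ?_
      have := centralProb_succ p.1
      push_cast
      linear_combination (centralProb p.2 / 2) * this
    simp only [Nat.cast_zero, zero_mul, zero_add] at h1
    rw [h2, Finset.sum_add_distrib, ← Finset.mul_sum, mul_add, hsym n, ih] at h1
    have h3 : ((n : ℝ) + 1) ≠ 0 := by positivity
    push_cast at h1
    have h4 : ((n : ℝ) + 1) * ∑ p ∈ Finset.HasAntidiagonal.antidiagonal (n + 1),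
        centralProb p.1 * centralProb p.2 = (n + 1) * 1 := by linarith
    exact mul_left_cancel₀ h3 h4

lemma centralProb_sq (n : ℕ) : centralProb n ^ 2 * ((2 * n + 1) * Real.Wallis.W n) = 1 := by
  have h1 : ((2 * n).factorial : ℝ) = n.centralBinom * (n.factorial : ℝ) ^ 2 := by
    have := Nat.choose_mul_factorial_mul_factorial (show n ≤ 2 * n by omega)
    rw [show 2 * n - n = n by omega, ← Nat.centralBinom_eq_two_mul_choose] at this
    have h2 : (n.centralBinom : ℝ) * n.factorial * n.factorial = (2 * n).factorial := by
      exact_mod_cast this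
    rw [← h2]; ring
  have h3 : (n.centralBinom : ℝ) ≠ 0 := by exact_mod_cast n.centralBinom_ne_zero
  have h4 : (n.factorial : ℝ) ≠ 0 := by exact_mod_cast n.factorial_ne_zero
  rw [Real.Wallis.W_eq_factorial_ratio, h1, centralProb, pow_mul]
  have h5 : (2 : ℝ) ^ 4 = 4 ^ 2 := by norm_num
  rw [h5, ← pow_mul, mul_comm 2 n, pow_mul]
  field_simp

/-- A lower bound on Wallis' product gives the sharp constant `1 / π` for every index, ready to be
summed into a logarithm. -/
lemma centralProb_sq_le (n : ℕ) :
    centralProb (n + 1) ^ 2 ≤ 1 / Real.pi * (1 / ((n : ℝ) + 1)) := by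
  have h1 := centralProb_sq (n + 1)
  have h2 := Real.Wallis.le_W (n + 1)
  have hpi := Real.pi_pos
  push_cast at h1 h2
  have h3 : Real.pi * ((n : ℝ) + 1) ≤ (2 * (n + 1) + 1) * Real.Wallis.W (n + 1) := by
    have h4 : Real.pi * ((n : ℝ) + 1) ≤ (2 * (n + 1) + 1) *
        ((2 * ((n : ℝ) + 1) + 1) / (2 * (n + 1) + 2) * (Real.pi / 2)) := by
      rw [div_mul_div_comm, mul_div_assoc', le_div_iff₀ (by positivity)]
      nlinarith [mul_pos hpi (show (0 : ℝ) < n + 1 by positivity)]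
    exact h4.trans (mul_le_mul_of_nonneg_left h2 (by positivity))
  rw [← mul_div_mul_comm, one_mul, le_div_iff₀ (by positivity)]
  exact (mul_le_mul_of_nonneg_left h3 (sq_nonneg _)).trans h1.le

lemma tendsto_centralProb : Tendsto centralProb atTop (𝓝 0) := by
  have h1 : Tendsto (fun n => centralProb (n + 1) ^ 2) atTop (𝓝 0) := by
    refine squeeze_zero (fun n => sq_nonneg _) centralProb_sq_le ?_
    simpa using tendsto_one_div_add_atTop_nhds_zero_nat.const_mul (1 / Real.pi)
  have h2 := (Real.continuous_sqrt.tendsto 0).comp h1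
  rw [Real.sqrt_zero] at h2
  refine (tendsto_add_atTop_iff_nat 1).1 (h2.congr fun n => ?_)
  simp only [Function.comp]
  exact Real.sqrt_sq (centralProb_pos _).le

lemma tendsto_centralProb_mul_sqrt :
    Tendsto (fun n : ℕ => centralProb n * Real.sqrt (n + 1)) atTop (𝓝 (1 / Real.sqrt Real.pi)) := by
  have h1 : Tendsto (fun n : ℕ => (Real.Wallis.W n)⁻¹ * (((n : ℝ) + 1) / (2 * n + 1))) atTop
      (𝓝 ((Real.pi / 2)⁻¹ * (1 / 2))) := by
    refine (Real.Wallis.tendsto_W_nhds_pi_div_two.inv₀ (by positivity)).mul ?_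
    have h2 : Tendsto (fun n : ℕ => 1 / 2 + 1 / 4 * (1 / ((n : ℝ) + 1 / 2))) atTop
        (𝓝 (1 / 2 + 1 / 4 * 0)) := by
      refine tendsto_const_nhds.add (Tendsto.const_mul _ ?_)
      exact (tendsto_const_nhds (x := (1 : ℝ))).div_atTop
        (tendsto_atTop_add_const_right _ _ tendsto_natCast_atTop_atTop)
    rw [mul_zero, add_zero] at h2
    refine h2.congr fun n => ?_
    have : (n : ℝ) + 1 / 2 ≠ 0 := by positivity
    field_simp
    ring
  have h3 := (Real.continuous_sqrt.tendsto _).comp h1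
  have h4 : Real.sqrt ((Real.pi / 2)⁻¹ * (1 / 2)) = 1 / Real.sqrt Real.pi := by
    rw [show (Real.pi / 2)⁻¹ * (1 / 2) = Real.pi⁻¹ by field_simp, Real.sqrt_inv, one_div]
  rw [h4] at h3
  refine h3.congr fun n => ?_
  have hW := Real.Wallis.W_pos n
  have h5 : (Real.Wallis.W n)⁻¹ * (((n : ℝ) + 1) / (2 * n + 1)) =
      centralProb n ^ 2 * (n + 1) := by
    have := centralProb_sq n
    field_simp
    linear_combination -this
  simp only [Function.comp]
  rw [h5, Real.sqrt_mul (sq_nonneg _), Real.sqrt_sq (centralProb_pos n).le]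

/-- The first return probabilities of the simple random walk at even times. -/
def firstReturn : ℕ → ℝ
  | 0 => 0
  | n + 1 => centralProb n - centralProb (n + 1)

lemma firstReturn_succ (n : ℕ) : firstReturn (n + 1) = centralProb n / (2 * n + 2) := by
  have := centralProb_succ n
  rw [firstReturn, eq_div_iff (by positivity)]
  linarith

lemma firstReturn_succ_pos (n : ℕ) : 0 < firstReturn (n + 1) := by
  rw [firstReturn_succ]
  exact div_pos (centralProb_pos n) (by positivity)

lemma firstReturn_nonneg (n : ℕ) : 0 ≤ firstReturn n := by
  rcases n with _ | n
  · exact le_rfl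
  · exact (firstReturn_succ_pos n).le

lemma hasSum_firstReturn : HasSum firstReturn 1 := by
  have h1 : HasSum (fun n => firstReturn (n + 1)) 1 := by
    rw [hasSum_iff_tendsto_nat_of_nonneg fun n => firstReturn_nonneg _]
    have h2 : ∀ n, ∑ i ∈ Finset.range n, firstReturn (i + 1) = 1 - centralProb n := by
      intro n
      rw [← centralProb_zero]
      exact Finset.sum_range_sub' centralProb n
    simp only [h2]
    simpa using tendsto_centralProb.const_sub 1
  have h3 := (hasSum_nat_add_iff (f := firstReturn) 1).1 h1
  simpa [firstReturn] using h3

lemma abs_firstReturn_le (n : ℕ) : |firstReturn n| ≤ 1 := by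
  rw [abs_of_nonneg (firstReturn_nonneg n)]
  exact le_hasSum hasSum_firstReturn n fun m _ => firstReturn_nonneg m

lemma one_sub_genFun_firstReturn {z : ℂ} (hz : ‖z‖ < 1) :
    1 - genFun firstReturn z = (1 - z) * genFun centralProb z := by
  rw [genFun_eq_add abs_firstReturn_le hz]
  have h1 : genFun (fun n => firstReturn (n + 1)) z =
      genFun centralProb z - genFun (fun n => centralProb (n + 1)) z := by
    rw [genFun, genFun, genFun, ← Summable.tsum_sub
      (summable_norm_mul_pow abs_centralProb_le hz).of_norm
      (summable_norm_mul_pow (fun n => abs_centralProb_le (n + 1)) hz).of_norm]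
    congr 1
    funext n
    rw [firstReturn]; push_cast; ring
  have h2 := genFun_eq_add abs_centralProb_le hz
  rw [centralProb_zero] at h2
  rw [h1, firstReturn]
  push_cast at h2 ⊢
  linear_combination -h2

/-- The squared form of the binomial series avoids choosing a branch of the root; only moduli are
needed later. -/
lemma genFun_centralProb_sq {z : ℂ} (hz : ‖z‖ < 1) :
    (1 - z) * genFun centralProb z ^ 2 = 1 := by
  have h0 : 1 - z ≠ 0 := by
    intro h
    rw [← sub_eq_zero.1 h, norm_one] at hz
    exact lt_irrefl _ hz
  rw [sq, genFun_mul abs_centralProb_le abs_centralProb_le hz]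
  simp only [sum_antidiagonal_centralProb, genFun, Complex.ofReal_one, one_mul]
  rw [tsum_geometric_of_norm_lt_one hz, mul_inv_cancel₀ h0]

lemma norm_genFun_centralProb_sq {z : ℂ} (hz : ‖z‖ < 1) :
    ‖1 - z‖ * ‖genFun centralProb z‖ ^ 2 = 1 := by
  rw [← norm_pow, ← norm_mul, genFun_centralProb_sq hz, norm_one]

lemma norm_one_sub_genFun_firstReturn {z : ℂ} (hz : ‖z‖ < 1) :
    ‖1 - genFun firstReturn z‖ = Real.sqrt ‖1 - z‖ := by
  symm
  rw [Real.sqrt_eq_iff_eq_sq (norm_nonneg _) (norm_nonneg _), one_sub_genFun_firstReturn hz,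
    norm_mul, mul_pow]
  have := norm_genFun_centralProb_sq hz
  linear_combination (-‖1 - z‖) * this

/-- For real arguments, the sum of the increments is a square root. -/
lemma tsum_firstReturn_mul_le {x : ℝ} (hx0 : 0 ≤ x) (hx1 : x < 1) :
    Summable (fun n => firstReturn n * (1 - x ^ n)) ∧
      ∑' n, firstReturn n * (1 - x ^ n) ≤ Real.sqrt (1 - x) := by
  have hz : ‖(x : ℂ)‖ < 1 := by rwa [Complex.norm_real, Real.norm_of_nonneg hx0]
  have hs : Summable fun n => firstReturn n * x ^ n := by
    have := (summable_norm_mul_pow abs_firstReturn_le hz).of_norm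
    refine Complex.summable_ofReal.1 (this.congr fun n => ?_)
    push_cast; rfl
  have h1 : HasSum (fun n => firstReturn n * (1 - x ^ n)) (1 - ∑' n, firstReturn n * x ^ n) := by
    refine (hasSum_firstReturn.sub hs.hasSum).congr_fun fun n => ?_
    ring
  refine ⟨h1.summable, ?_⟩
  have h2 := norm_one_sub_genFun_firstReturn hz
  have h3 : genFun firstReturn x = ((∑' n, firstReturn n * x ^ n : ℝ) : ℂ) := by
    rw [genFun, Complex.ofReal_tsum]; push_cast; rfl
  rw [h3, ← Complex.ofReal_one, ← Complex.ofReal_sub, ← Complex.ofReal_sub, Complex.norm_real,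
    Complex.norm_real, Real.norm_eq_abs, Real.norm_of_nonneg (by linarith : (0 : ℝ) ≤ 1 - x)] at h2
  rw [h1.tsum_eq, ← h2]
  exact le_abs_self _

end CentralBinom

/-! ### Comparison of the kernel with the first return law -/

section Comparison

variable {K : ℕ → ℝ} {C : ℝ}

/-- Near `1`, the generating function of a kernel comparable to `firstReturn` is governed by
the square root singularity. -/
lemma exists_le_norm_one_sub_genFun (hK1 : HasSum K 1)
    (hK : ∀ n, 0 ≤ K n) (hratio : Tendsto (fun n => K n / firstReturn n) atTop (𝓝 C))
    {η : ℝ} (hη : 0 < η) :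
    ∃ s₀ > 0, ∀ z : ℂ, ‖z‖ < 1 → ‖1 - z‖ ≤ s₀ →
      (|C| - η) * Real.sqrt ‖1 - z‖ ≤ ‖1 - genFun K z‖ := by
  have hKb : ∀ n, |K n| ≤ 1 := fun n => by
    rw [abs_of_nonneg (hK n)]; exact le_hasSum hK1 n fun m _ => hK m
  set e : ℕ → ℝ := fun n => K n - C * firstReturn n with he
  have hesum : HasSum e (1 - C * 1) := hK1.sub (hasSum_firstReturn.mul_left C)
  have hsmall : ∀ᶠ n in atTop, |e n| ≤ η / 5 * firstReturn n := by
    have h1 := hratio.eventually (Metric.ball_mem_nhds C (show 0 < η / 5 by positivity))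
    filter_upwards [h1, eventually_gt_atTop 0] with n hn hn0
    obtain ⟨n, rfl⟩ := Nat.exists_eq_succ_of_ne_zero hn0.ne'
    have hpos := firstReturn_succ_pos n
    have h2 : e (n + 1) = (K (n + 1) / firstReturn (n + 1) - C) * firstReturn (n + 1) := by
      simp only [he]; field_simp
    rw [Nat.succ_eq_add_one] at hn ⊢
    rw [h2, abs_mul, abs_of_pos hpos]
    exact mul_le_mul_of_nonneg_right (Metric.mem_ball.1 hn).le hpos.le
  obtain ⟨m₀, hm₀⟩ := eventually_atTop.1 hsmall
  set E := ∑ n ∈ Finset.range m₀, |e n| * n with hE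
  have hE0 : 0 ≤ E := Finset.sum_nonneg fun n _ => by positivity
  refine ⟨(η / 5 / (E + 1)) ^ 2, by positivity, fun z hz hzs => ?_⟩
  set s := ‖1 - z‖ with hs
  -- At this real point `|1 - z^n| ≤ 4 (1 - x^n)`, so the terms `n ≥ m₀` of the error sum to at most
  -- `(4η/5) √s`. The finitely many others contribute `E s ≤ (η/5) √s` by the choice of `s₀`.
  set x := 1 - s / 2 with hx
  have hs0 : 0 < s := by
    refine norm_pos_iff.2 fun h => ?_
    rw [← sub_eq_zero.1 h, norm_one] at hz
    exact lt_irrefl _ hz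
  have hs2 : s ≤ 2 := by
    have := norm_one_sub_pow_le_two hz.le 1
    rwa [pow_one] at this
  obtain ⟨hsumx, hlex⟩ := tsum_firstReturn_mul_le (x := x) (by linarith) (by linarith)
  have hdiff : HasSum (fun n => (e n : ℂ) * (1 - z ^ n))
      ((1 - genFun K z) - C * (1 - genFun firstReturn z)) := by
    have h1 : HasSum (fun n => (e n : ℂ)) ((1 - C * 1 : ℝ) : ℂ) := Complex.hasSum_ofReal.2 hesum
    have h2 := (summable_norm_mul_pow hKb hz).of_norm.hasSum
    have h3 := (summable_norm_mul_pow abs_firstReturn_le hz).of_norm.hasSum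
    have h4 := h1.sub (h2.sub (h3.mul_left (C : ℂ)))
    convert! h4 using 1
    · funext n
      simp only [he]; push_cast; ring
    · simp only [genFun]; push_cast; ring
  have hbound : HasSum (fun n => (if n ∈ Finset.range m₀ then |e n| * n * s else 0) +
      4 * (η / 5) * (firstReturn n * (1 - x ^ n)))
      (∑ n ∈ Finset.range m₀, |e n| * n * s +
        4 * (η / 5) * ∑' n, firstReturn n * (1 - x ^ n)) := by
    refine HasSum.add ?_ (hsumx.hasSum.mul_left _)
    have h1 : HasSum (fun n => if n ∈ Finset.range m₀ then |e n| * n * s else 0)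
        (∑ n ∈ Finset.range m₀, if n ∈ Finset.range m₀ then |e n| * n * s else 0) :=
      hasSum_sum_of_ne_finset_zero fun n hn => if_neg hn
    rwa [Finset.sum_congr rfl fun n hn => if_pos hn] at h1
  have hx01 : 0 ≤ x ∧ x ≤ 1 := ⟨by linarith, by linarith⟩
  have hterm : ∀ n, ‖(e n : ℂ) * (1 - z ^ n)‖ ≤
      (if n ∈ Finset.range m₀ then |e n| * n * s else 0) +
        4 * (η / 5) * (firstReturn n * (1 - x ^ n)) := by
    intro n
    rw [norm_mul, Complex.norm_real, Real.norm_eq_abs]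
    have hx1 : 0 ≤ 1 - x ^ n := sub_nonneg.2 (pow_le_one₀ hx01.1 hx01.2)
    have hnn : 0 ≤ 4 * (η / 5) * (firstReturn n * (1 - x ^ n)) := by
      have := firstReturn_nonneg n
      positivity
    split_ifs with hn
    · have := mul_le_mul_of_nonneg_left (norm_one_sub_pow_le hz.le n) (abs_nonneg (e n))
      rw [mul_assoc]
      linarith
    · rw [zero_add]
      have h1 := hm₀ n (by simpa using hn)
      calc |e n| * ‖1 - z ^ n‖ ≤ (η / 5 * firstReturn n) * (4 * (1 - x ^ n)) :=
            mul_le_mul h1 (norm_one_sub_pow_le_mul hz.le n) (norm_nonneg _)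
              (mul_nonneg (by positivity) (firstReturn_nonneg n))
        _ = _ := by ring
  have herr : ‖(1 - genFun K z) - C * (1 - genFun firstReturn z)‖ ≤
      E * s + 4 * (η / 5) * Real.sqrt s := by
    rw [← hdiff.tsum_eq]
    refine (tsum_of_norm_bounded hbound hterm).trans ?_
    rw [← Finset.sum_mul, ← hE]
    refine add_le_add le_rfl (mul_le_mul_of_nonneg_left (hlex.trans ?_) (by positivity))
    exact Real.sqrt_le_sqrt (by linarith)
  have hsq : s = Real.sqrt s * Real.sqrt s := (Real.mul_self_sqrt hs0.le).symm
  have hEs : E * s ≤ η / 5 * Real.sqrt s := by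
    have h1 : Real.sqrt s ≤ η / 5 / (E + 1) := by
      rw [Real.sqrt_le_left (by positivity)]; exact hzs
    have h2 : E * Real.sqrt s ≤ η / 5 := by
      rw [le_div_iff₀ (by positivity)] at h1
      nlinarith [Real.sqrt_nonneg s]
    calc E * s = E * Real.sqrt s * Real.sqrt s := by rw [mul_assoc, ← hsq]
      _ ≤ _ := mul_le_mul_of_nonneg_right h2 (Real.sqrt_nonneg s)
  have hmain : ‖(C : ℂ) * (1 - genFun firstReturn z)‖ = |C| * Real.sqrt s := by
    rw [norm_mul, Complex.norm_real, Real.norm_eq_abs, norm_one_sub_genFun_firstReturn hz]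
  have htri := norm_sub_norm_le ((C : ℂ) * (1 - genFun firstReturn z)) (1 - genFun K z)
  rw [norm_sub_rev (_ * _), hmain] at htri
  linarith

/-- Away from `1`, the generating function of an aperiodic kernel stays away from `1`. -/
lemma exists_pos_le_norm_one_sub_genFun (hK1 : HasSum K 1) (hK : ∀ n, 0 ≤ K n)
    (hpos : ∀ᶠ n in atTop, 0 < K n) {s₀ : ℝ} (hs₀ : 0 < s₀) :
    ∃ κ > 0, ∀ z : ℂ, ‖z‖ < 1 → s₀ ≤ ‖1 - z‖ → κ ≤ ‖1 - genFun K z‖ := by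
  set T : Set ℂ := Metric.closedBall 0 1 ∩ {z | s₀ ≤ ‖1 - z‖} with hT
  have hTc : IsCompact T := (isCompact_closedBall 0 1).inter_right
    (isClosed_le continuous_const (by fun_prop))
  have hcont : ContinuousOn (fun z => ‖1 - genFun K z‖) T := by
    refine (continuousOn_const.sub ?_).norm
    refine continuousOn_tsum (u := K) (fun n => by fun_prop) hK1.summable fun n z hz => ?_
    rw [norm_mul, norm_pow, Complex.norm_real, Real.norm_of_nonneg (hK n)]
    have : ‖z‖ ≤ 1 := by simpa using hz.1
    exact mul_le_of_le_one_right (hK n) (pow_le_one₀ (norm_nonneg z) this)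
  have hne : ∀ z ∈ T, 0 < ‖1 - genFun K z‖ := by
    intro z hz
    have hz1 : ‖z‖ ≤ 1 := by simpa using hz.1
    refine norm_pos_iff.2 fun h0 => ?_
    have hsum : Summable fun n => (K n : ℂ) * z ^ n := by
      refine Summable.of_norm_bounded hK1.summable fun n => ?_
      rw [norm_mul, norm_pow, Complex.norm_real, Real.norm_of_nonneg (hK n)]
      exact mul_le_of_le_one_right (hK n) (pow_le_one₀ (norm_nonneg z) hz1)
    have h1 : HasSum (fun n => (K n : ℂ) * z ^ n) 1 := by
      have := hsum.hasSum
      rwa [← genFun, ← sub_eq_zero.1 h0] at this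
    -- Equality case of the triangle inequality: all these nonnegative terms vanish, so `z ^ n = 1`
    -- wherever `K n > 0`.
    have h2 : HasSum (fun n => K n * (1 - (z ^ n).re)) 0 := by
      have h3 := hK1.sub (Complex.hasSum_re h1)
      rw [Complex.one_re, sub_self] at h3
      refine h3.congr_fun fun n => ?_
      rw [Complex.re_ofReal_mul]; ring
    have hre : ∀ n, (z ^ n).re ≤ 1 := fun n => (Complex.re_le_norm _).trans (by
      rw [norm_pow]; exact pow_le_one₀ (norm_nonneg z) hz1)
    have h4 := (hasSum_zero_iff_of_nonneg fun n =>
      mul_nonneg (hK n) (sub_nonneg.2 (hre n))).1 h2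
    have h5 : ∀ n, 0 < K n → z ^ n = 1 := by
      intro n hn
      have h6 : (z ^ n).re = 1 := by
        have := congrFun h4 n
        simp only [Pi.zero_apply, mul_eq_zero, hn.ne', false_or] at this
        linarith
      have h7 : ‖z ^ n‖ ≤ 1 := by rw [norm_pow]; exact pow_le_one₀ (norm_nonneg z) hz1
      have h8 : (z ^ n).im = 0 := by
        have h9 := Complex.sq_norm (z ^ n)
        rw [Complex.normSq_apply, h6] at h9
        have : ‖z ^ n‖ ^ 2 ≤ 1 := pow_le_one₀ (norm_nonneg _) h7
        have h10 : (z ^ n).im * (z ^ n).im ≤ 0 := by linarith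
        exact mul_self_eq_zero.1 (le_antisymm h10 (mul_self_nonneg _))
      exact Complex.ext (by simpa using h6) (by simpa using h8)
    -- Two consecutive exponents force `z = 1`, which `T` excludes.
    obtain ⟨n, hn, hn1⟩ := (hpos.and ((tendsto_add_atTop_nat 1).eventually hpos)).exists
    have h6 := h5 _ hn1
    rw [pow_succ, h5 n hn, one_mul] at h6
    have h7 : s₀ ≤ ‖1 - z‖ := hz.2
    rw [h6, sub_self, norm_zero] at h7
    linarith
  rcases T.eq_empty_or_nonempty with hem | hnem
  · refine ⟨1, one_pos, fun z hz hzs => ?_⟩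
    have : z ∈ T := ⟨by simpa using hz.le, hzs⟩
    rw [hem] at this
    exact absurd this (Set.notMem_empty z)
  · obtain ⟨z₁, hz₁, hmin⟩ := hTc.exists_isMinOn hnem hcont
    exact ⟨_, hne z₁ hz₁, fun z hz hzs => hmin ⟨by simpa using hz.le, hzs⟩⟩

lemma sum_range_mul_eq_antidiagonal (f g : ℕ → ℝ) (n : ℕ) :
    ∑ p ∈ Finset.HasAntidiagonal.antidiagonal n, f p.1 * g p.2 =
      ∑ m ∈ Finset.range n, g m * f (n - m) + g n * f 0 := by
  rw [← Finset.Nat.sum_antidiagonal_swap, Finset.Nat.sum_antidiagonal_eq_sum_range_succ_mk,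
    Finset.sum_range_succ]
  simp [mul_comm]

lemma mass_le_one (hK : ∀ n, 0 ≤ K n) (hs : HasSum (fun n => K (n + 1)) 1) (n : ℕ) :
    mass K n ≤ 1 := by
  induction n using Nat.strong_induction_on with
  | _ n ih =>
    rcases eq_or_ne n 0 with rfl | hn
    · exact mass_zero.le
    · rw [mass_eq_preWeight hn]
      refine le_trans (Finset.sum_le_sum fun m hm => ?_) (sum_Ico_kernel_le hK hs n)
      exact mul_le_of_le_one_left (hK _) (ih m (Finset.mem_range.1 hm))

lemma abs_mass_le (hK : ∀ n, 0 ≤ K n) (hs : HasSum (fun n => K (n + 1)) 1) (n : ℕ) :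
    |mass K n| ≤ 1 := by
  rw [abs_of_nonneg (mass_nonneg hK n)]
  exact mass_le_one hK hs n

/-- The renewal equation for generating functions. -/
lemma one_sub_genFun_mul_genFun_mass (hK : ∀ n, 0 ≤ K n) (hK0 : K 0 = 0)
    (hs : HasSum (fun n => K (n + 1)) 1) {z : ℂ} (hz : ‖z‖ < 1) :
    (1 - genFun K z) * genFun (mass K) z = 1 := by
  have hKb : ∀ n, |K n| ≤ 1 := by
    rintro (_ | n)
    · simp [hK0]
    · rw [abs_of_nonneg (hK _)]
      exact le_hasSum hs n fun m _ => hK _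
  rw [sub_mul, one_mul, genFun_mul hKb (abs_mass_le hK hs) hz]
  have h1 : (fun n => ∑ p ∈ Finset.HasAntidiagonal.antidiagonal n, K p.1 * mass K p.2) =
      fun n => if n = 0 then 0 else mass K n := by
    funext n
    rw [sum_range_mul_eq_antidiagonal, hK0, mul_zero, add_zero]
    split_ifs with h
    · simp [h]
    · rw [mass_eq_preWeight h]; rfl
  have h2 : ∀ n, |(fun n => if n = 0 then 0 else mass K n) n| ≤ 1 := by
    intro n
    simp only
    split_ifs
    · simp
    · exact abs_mass_le hK hs n
  rw [h1, genFun_eq_add h2 hz, genFun_eq_add (abs_mass_le hK hs) hz, mass_zero]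
  simp

/-- The generating function of the renewal masses is controlled by that of `centralProb`. -/
lemma exists_norm_genFun_mass_sq_le (hK : ∀ n, 0 ≤ K n) (hK0 : K 0 = 0)
    (hs : HasSum (fun n => K (n + 1)) 1) (hpos : ∀ᶠ n in atTop, 0 < K n)
    (hratio : Tendsto (fun n => K n / firstReturn n) atTop (𝓝 C)) (hC : 0 < C) {δ : ℝ}
    (hδ : 0 < δ) :
    ∃ κ > 0, ∀ z : ℂ, ‖z‖ < 1 →
      ‖genFun (mass K) z‖ ^ 2 ≤ κ + (1 + δ) / C ^ 2 * ‖genFun centralProb z‖ ^ 2 := by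
  have hK1 : HasSum K 1 := by
    have := (hasSum_nat_add_iff (f := K) 1).1 hs
    simpa [hK0] using this
  have hr1 : 1 < Real.sqrt (1 + δ) := by
    rw [Real.lt_sqrt (by norm_num)]; linarith
  -- Chosen so that `(C - η)² = C² / (1 + δ)`.
  set η := C - C / Real.sqrt (1 + δ) with hη
  have hη0 : 0 < η := sub_pos.2 (div_lt_self hC hr1)
  obtain ⟨s₀, hs₀, hnear⟩ := exists_le_norm_one_sub_genFun hK1 hK hratio hη0
  obtain ⟨κ, hκ, hfar⟩ := exists_pos_le_norm_one_sub_genFun hK1 hK hpos hs₀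
  refine ⟨(κ ^ 2)⁻¹, by positivity, fun z hz => ?_⟩
  have h1 := one_sub_genFun_mul_genFun_mass hK hK0 hs hz
  have h2 : ‖1 - genFun K z‖ ^ 2 * ‖genFun (mass K) z‖ ^ 2 = 1 := by
    rw [← mul_pow, ← norm_mul, h1, norm_one, one_pow]
  have h3 := norm_genFun_centralProb_sq hz
  set U := ‖genFun (mass K) z‖ ^ 2 with hU
  set B := ‖genFun centralProb z‖ ^ 2 with hB
  have hU0 : 0 ≤ U := by positivity
  have hB0 : 0 ≤ B := by positivity
  rcases le_total ‖1 - z‖ s₀ with h | h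
  · have h4 := hnear z hz h
    rw [abs_of_pos hC, show C - η = C / Real.sqrt (1 + δ) by rw [hη]; ring] at h4
    have h5 : C ^ 2 / (1 + δ) * ‖1 - z‖ ≤ ‖1 - genFun K z‖ ^ 2 := by
      have h6 := pow_le_pow_left₀ (by positivity) h4 2
      rwa [mul_pow, div_pow, Real.sq_sqrt (by linarith), Real.sq_sqrt (norm_nonneg _)] at h6
    have h7 : U ≤ (1 + δ) / C ^ 2 * B := by
      have h8 : C ^ 2 / (1 + δ) * ‖1 - z‖ * U ≤ 1 :=
        (mul_le_mul_of_nonneg_right h5 hU0).trans h2.le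
      have h9 : U = (1 + δ) / C ^ 2 * (B * (C ^ 2 / (1 + δ) * ‖1 - z‖ * U)) := by
        have : (1 + δ) / C ^ 2 * (B * (C ^ 2 / (1 + δ) * ‖1 - z‖ * U)) =
            ((1 + δ) / C ^ 2 * (C ^ 2 / (1 + δ))) * (‖1 - z‖ * B) * U := by ring
        rw [this, h3]
        have : 1 + δ ≠ 0 := by positivity
        field_simp
      rw [h9]
      refine mul_le_mul_of_nonneg_left ?_ (by positivity)
      exact mul_le_of_le_one_right hB0 h8
    have : 0 ≤ (κ ^ 2)⁻¹ := by positivity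
    linarith
  · have h4 := pow_le_pow_left₀ hκ.le (hfar z hz h) 2
    have h5 : κ ^ 2 * U ≤ 1 := (mul_le_mul_of_nonneg_right h4 hU0).trans h2.le
    have h6 : U ≤ (κ ^ 2)⁻¹ := by
      rw [← one_div, le_div_iff₀ (by positivity)]; linarith
    have : 0 ≤ (1 + δ) / C ^ 2 * B := by positivity
    linarith

end Comparison

/-! ### Parseval's identity and comparison of sums of squares -/

section Parseval

/-- Parseval's identity for an absolutely convergent one-sided Fourier series. -/
lemma integral_norm_genFun_sq {f : ℕ → ℝ} (hf : Summable fun n => |f n|) :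
    Integrable (fun t : AddCircle (1 : ℝ) => ‖genFun f (fourier 1 t)‖ ^ 2)
        AddCircle.haarAddCircle ∧
      ∫ t : AddCircle (1 : ℝ), ‖genFun f (fourier 1 t)‖ ^ 2 ∂AddCircle.haarAddCircle =
        ∑' n, f n ^ 2 := by
  set F : ℕ → C(AddCircle (1 : ℝ), ℂ) := fun n => (f n : ℂ) • fourier n with hF
  have hFn : ∀ n, ‖F n‖ = |f n| := by
    intro n
    rw [hF, norm_smul, fourier_norm, mul_one, Complex.norm_real, Real.norm_eq_abs]
  have hsum : Summable F := Summable.of_norm (by simpa only [hFn] using hf)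
  have hpt : ∀ t, (∑' n, F n) t = genFun f (fourier 1 t) := by
    intro t
    rw [← ContinuousMap.tsum_apply hsum, genFun]
    congr 1
    funext n
    simp only [hF, ContinuousMap.smul_apply, smul_eq_mul, fourier_apply]
    congr 1
    rw [one_smul, natCast_zsmul, AddCircle.toCircle_nsmul]
    rfl
  set G := ContinuousMap.toLp (E := ℂ) 2 (AddCircle.haarAddCircle (T := (1 : ℝ))) ℂ with hG
  have hL := hsum.hasSum.mapL G
  have hnorm : Tendsto (fun s : Finset ℕ => ‖∑ n ∈ s, G (F n)‖ ^ 2) atTop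
      (𝓝 (‖G (∑' n, F n)‖ ^ 2)) := (hL.norm.pow 2)
  -- Orthonormality of the characters settles finite sums; convergence in `L²` then transfers the
  -- identity to the whole series.
  have hfin : ∀ s : Finset ℕ, ‖∑ n ∈ s, G (F n)‖ ^ 2 = ∑ n ∈ s, f n ^ 2 := by
    intro s
    have horth : Orthonormal ℂ fun n : ℕ => fourierLp (T := (1 : ℝ)) 2 (n : ℤ) :=
      orthonormal_fourier.comp _ Nat.cast_injective
    have h1 := horth.inner_sum (fun n => (f n : ℂ)) (fun n => (f n : ℂ)) s
    have h2 : ∑ n ∈ s, G (F n) = ∑ n ∈ s, (f n : ℂ) • fourierLp (T := (1 : ℝ)) 2 (n : ℤ) :=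
      Finset.sum_congr rfl fun n _ => by rw [hF, map_smul]
    rw [h2, ← Complex.ofReal_inj]
    have h3 := inner_self_eq_norm_sq_to_K (𝕜 := ℂ)
      (∑ n ∈ s, (f n : ℂ) • fourierLp (T := (1 : ℝ)) 2 (n : ℤ))
    rw [h1] at h3
    push_cast
    refine h3.symm.trans (Finset.sum_congr rfl fun n _ => ?_)
    rw [Complex.conj_ofReal, sq]
  simp only [hfin] at hnorm
  have hS : HasSum (fun n => f n ^ 2) (‖G (∑' n, F n)‖ ^ 2) := hnorm
  have hcont : Continuous fun t : AddCircle (1 : ℝ) => ‖genFun f (fourier 1 t)‖ ^ 2 := by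
    simp only [← hpt]
    fun_prop
  refine ⟨hcont.integrable_of_hasCompactSupport (HasCompactSupport.of_compactSpace _), ?_⟩
  rw [hS.tsum_eq, ← Complex.ofReal_inj]
  have h4 := inner_self_eq_norm_sq_to_K (𝕜 := ℂ) (G (∑' n, F n))
  rw [hG, ContinuousMap.inner_toLp] at h4
  push_cast
  refine Eq.trans ?_ h4
  rw [← integral_complex_ofReal]
  congr 1
  funext t
  rw [hpt, Complex.mul_conj, Complex.normSq_eq_norm_sq]

lemma genFun_mul_pow (f : ℕ → ℝ) (r : ℝ) (z : ℂ) :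
    genFun (fun n => f n * r ^ n) z = genFun f (r * z) := by
  unfold genFun
  congr 1
  funext n
  push_cast
  rw [mul_pow]; ring

/-- Comparison of generating functions in the disc gives comparison of `ℓ²` norms. -/
lemma tsum_sq_mul_pow_le {f g : ℕ → ℝ} (hf : ∀ n, |f n| ≤ 1) (hg : ∀ n, |g n| ≤ 1) {κ c : ℝ}
    (h : ∀ z : ℂ, ‖z‖ < 1 → ‖genFun f z‖ ^ 2 ≤ κ + c * ‖genFun g z‖ ^ 2) {r : ℝ} (hr0 : 0 ≤ r)
    (hr1 : r < 1) : ∑' n, (f n * r ^ n) ^ 2 ≤ κ + c * ∑' n, (g n * r ^ n) ^ 2 := by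
  have hsum : ∀ {f : ℕ → ℝ}, (∀ n, |f n| ≤ 1) → Summable fun n => |f n * r ^ n| := by
    intro f hf
    refine Summable.of_nonneg_of_le (fun n => abs_nonneg _) (fun n => ?_)
      (summable_geometric_of_lt_one hr0 hr1)
    rw [abs_mul, abs_of_nonneg (pow_nonneg hr0 n)]
    exact mul_le_of_le_one_left (pow_nonneg hr0 n) (hf n)
  obtain ⟨hfi, hfe⟩ := integral_norm_genFun_sq (hsum hf)
  obtain ⟨hgi, hge⟩ := integral_norm_genFun_sq (hsum hg)
  rw [← hfe, ← hge, ← integral_const_mul]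
  have h1 : ∫ _ : AddCircle (1 : ℝ), κ ∂AddCircle.haarAddCircle = κ := by simp
  nth_rewrite 1 [← h1]
  rw [← integral_add (integrable_const κ) (hgi.const_mul c)]
  refine integral_mono hfi ((integrable_const κ).add (hgi.const_mul c)) fun t => ?_
  simp only [genFun_mul_pow]
  refine h _ ?_
  have h2 : ‖(fourier 1 t : ℂ)‖ = 1 := by rw [fourier_apply]; exact Circle.norm_coe _
  rwa [norm_mul, h2, mul_one, Complex.norm_real, Real.norm_of_nonneg hr0]

end Parseval

/-! ### Logarithmic bound on the overlap -/

section Overlap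

variable {S : Type*} [MeasurableSpace S] {Ω : Type*} [MeasurableSpace Ω]
  {P : Measure S} [IsProbabilityMeasure P] {ξ : ℕ → S → ℕ} {φ : ℝ → ℝ}
  {Q : Measure Ω} [IsProbabilityMeasure Q] {ω : ℕ → Ω → ℝ}

/-- By `firstReturn_succ` the ratio at `n + 1` equals `φ(n + 1) / (π · centralProb n · √(n + 1))`,
and the denominator tends to `√π`. -/
lemma tendsto_interArrival_div_firstReturn {c : ℝ}
    (hc : Tendsto (fun n : ℕ => φ n) atTop (𝓝 c)) :
    Tendsto (fun n => interArrival φ n / firstReturn n) atTop (𝓝 (c / Real.sqrt Real.pi)) := by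
  have hpi : 0 < Real.sqrt Real.pi := Real.sqrt_pos.2 Real.pi_pos
  refine (tendsto_add_atTop_iff_nat 1).1 ?_
  have h1 : Tendsto (fun n : ℕ => Real.pi⁻¹ * φ ((n + 1 : ℕ) : ℝ) /
      (centralProb n * Real.sqrt (n + 1))) atTop
      (𝓝 (Real.pi⁻¹ * c / (1 / Real.sqrt Real.pi))) :=
    (((tendsto_add_atTop_iff_nat 1).2 hc).const_mul _).div tendsto_centralProb_mul_sqrt
      (by positivity)
  have h2 : Real.pi⁻¹ * c / (1 / Real.sqrt Real.pi) = c / Real.sqrt Real.pi := by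
    have h3 : Real.pi = Real.sqrt Real.pi * Real.sqrt Real.pi :=
      (Real.mul_self_sqrt Real.pi_pos.le).symm
    nth_rewrite 1 [h3]
    field_simp
  rw [h2] at h1
  refine h1.congr fun n => ?_
  have hn : (0 : ℝ) < (n : ℝ) + 1 := by positivity
  have h3 : ((n : ℝ) + 1) ^ (-(3 / 2) : ℝ) = 1 / ((n + 1) * Real.sqrt (n + 1)) := by
    rw [Real.rpow_neg hn.le, show (3 / 2 : ℝ) = 1 + 1 / 2 by norm_num, Real.rpow_add hn,
      Real.rpow_one, ← Real.sqrt_eq_rpow, one_div]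
  have h4 := centralProb_pos n
  have h5 := Real.sqrt_pos.2 hn
  rw [firstReturn_succ, interArrival]
  push_cast
  rw [h3]
  field_simp

/-- The sum of the squared masses against a geometric weight grows logarithmically. -/
lemma tsum_centralProb_sq_le {ρ : ℝ} (h0 : 0 ≤ ρ) (h1 : ρ < 1) :
    ∑' n, (centralProb n * Real.sqrt ρ ^ n) ^ 2 ≤ 1 + 1 / Real.pi * -Real.log (1 - ρ) := by
  have hlog := (Real.hasSum_pow_div_log_of_abs_lt_one (by rwa [abs_of_nonneg h0])).mul_left
    (1 / Real.pi)
  have hterm : ∀ n, (centralProb n * Real.sqrt ρ ^ n) ^ 2 = centralProb n ^ 2 * ρ ^ n := by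
    intro n
    rw [mul_pow, ← pow_mul, mul_comm n 2, pow_mul, Real.sq_sqrt h0]
  simp only [hterm]
  have hle : ∀ n : ℕ, centralProb (n + 1) ^ 2 * ρ ^ (n + 1) ≤
      1 / Real.pi * (ρ ^ (n + 1) / ((n : ℝ) + 1)) := by
    intro n
    refine (mul_le_mul_of_nonneg_right (centralProb_sq_le n) (by positivity)).trans (le_of_eq ?_)
    ring
  have hs : Summable fun n : ℕ => centralProb (n + 1) ^ 2 * ρ ^ (n + 1) :=
    Summable.of_nonneg_of_le (fun n => by positivity) hle hlog.summable
  rw [((summable_nat_add_iff (f := fun n => centralProb n ^ 2 * ρ ^ n) 1).1 hs).tsum_eq_zero_add,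
    centralProb_zero]
  simp only [pow_zero, one_pow, mul_one]
  exact add_le_add le_rfl (hasSum_le hle hs.hasSum hlog)

/-- The expected overlap grows at most like `log N / c ^ 2` when `φ` tends to `c`. -/
theorem eventually_D_le (hφ : SlowlyVarying φ) (hξ : IsRenewalIncrements P ξ φ) {c : ℝ}
    (hc : Tendsto (fun n : ℕ => φ n) atTop (𝓝 c)) (hc0 : 0 < c) {δ : ℝ} (hδ : 0 < δ)
    (hδ1 : δ < 1) : ∀ᶠ N : ℕ in atTop, D P ξ N ≤ (1 + δ) / c ^ 2 * Real.log N := by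
  have hK := interArrival_nonneg hξ
  have hs := hasSum_interArrival hξ
  have hpos : ∀ᶠ n in atTop, 0 < interArrival φ n := by
    filter_upwards [hφ.le_interArrival, eventually_gt_atTop 0] with n hn hn0
    have : (0 : ℝ) < n := by exact_mod_cast hn0
    exact lt_of_lt_of_le (by positivity) hn
  have hpi : 0 < Real.sqrt Real.pi := Real.sqrt_pos.2 Real.pi_pos
  set γ := δ / 8 with hγ
  have hγ0 : 0 < γ := by positivity
  have hγ1 : γ < 1 := by linarith
  obtain ⟨κ, hκ, hbound⟩ := exists_norm_genFun_mass_sq_le hK interArrival_zero hs hpos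
    (tendsto_interArrival_div_firstReturn hc) (by positivity) hγ0
  have hC2 : (c / Real.sqrt Real.pi) ^ 2 = c ^ 2 / Real.pi := by
    rw [div_pow, Real.sq_sqrt Real.pi_pos.le]
  rw [hC2] at hbound
  set A := κ + (1 + γ) / (c ^ 2 / Real.pi) * (1 - 1 / Real.pi * Real.log γ) with hA
  have hlog : Tendsto (fun N : ℕ => Real.log N) atTop atTop :=
    Real.tendsto_log_atTop.comp tendsto_natCast_atTop_atTop
  filter_upwards [hlog.eventually (eventually_ge_atTop (A / (1 - γ) / (δ / (2 * c ^ 2)))),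
    hlog.eventually (eventually_ge_atTop 0), eventually_gt_atTop 0] with N hN hlogN hN0
  have hNr : (0 : ℝ) < N := by exact_mod_cast hN0
  have hN1 : (1 : ℝ) ≤ N := by exact_mod_cast hN0
  -- Abel-type cutoff: `ρ ^ n ≥ 1 - γ` for `n ≤ N` by Bernoulli, while `-log (1 - ρ) = log N - log
  -- γ` has leading coefficient one.
  set ρ := 1 - γ / N with hρ
  have hγN : γ / N ≤ γ := div_le_self hγ0.le hN1
  have hγN0 : 0 < γ / N := by positivity
  have hρ0 : 0 ≤ ρ := by linarith
  have hρ1 : ρ < 1 := by linarith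
  set r := Real.sqrt ρ with hr
  have hr0 : 0 ≤ r := Real.sqrt_nonneg _
  have hr1 : r < 1 := by rw [hr, Real.sqrt_lt' one_pos]; linarith
  have hcmp := tsum_sq_mul_pow_le (abs_mass_le hK hs) abs_centralProb_le hbound hr0 hr1
  have hB := tsum_centralProb_sq_le hρ0 hρ1
  rw [show 1 - ρ = γ / N by rw [hρ]; ring, Real.log_div hγ0.ne' hNr.ne'] at hB
  have hsumm : Summable fun n => (mass (interArrival φ) n * r ^ n) ^ 2 := by
    refine Summable.of_nonneg_of_le (fun n => sq_nonneg _) (fun n => ?_)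
      (summable_geometric_of_lt_one hr0 hr1)
    have h1 : mass (interArrival φ) n * r ^ n ≤ 1 := mul_le_one₀ (mass_le_one hK hs n)
      (by positivity) (pow_le_one₀ hr0 hr1.le)
    have h2 : 0 ≤ mass (interArrival φ) n * r ^ n :=
      mul_nonneg (mass_nonneg hK n) (by positivity)
    calc (mass (interArrival φ) n * r ^ n) ^ 2
        ≤ mass (interArrival φ) n * r ^ n := by rw [sq]; exact mul_le_of_le_one_left h2 h1
      _ ≤ r ^ n := mul_le_of_le_one_left (by positivity) (mass_le_one hK hs n)
  have hD : (1 - γ) * D P ξ N ≤ ∑' n, (mass (interArrival φ) n * r ^ n) ^ 2 := by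
    rw [D_eq hξ, Finset.mul_sum, hsumm.tsum_eq_zero_add]
    refine le_add_of_nonneg_of_le (sq_nonneg _) ?_
    refine le_trans (Finset.sum_le_sum fun n hn => ?_)
      (((summable_nat_add_iff 1).2 hsumm).sum_le_tsum (Finset.range N) fun n _ => sq_nonneg _)
    rw [mul_pow, ← pow_mul, mul_comm (n + 1) 2, pow_mul, hr, Real.sq_sqrt hρ0, mul_comm]
    refine mul_le_mul_of_nonneg_left ?_ (sq_nonneg _)
    have h1 := one_add_mul_le_pow (show (-2 : ℝ) ≤ -(γ / N) by linarith) (n + 1)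
    rw [← sub_eq_add_neg, ← hρ] at h1
    refine le_trans ?_ h1
    have h2 : ((n + 1 : ℕ) : ℝ) ≤ N := by exact_mod_cast Finset.mem_range.1 hn
    have h3 : ((n + 1 : ℕ) : ℝ) * (γ / N) ≤ γ := by
      calc _ ≤ (N : ℝ) * (γ / N) := mul_le_mul_of_nonneg_right h2 hγN0.le
        _ = γ := by field_simp
    linarith
  have hcoef : 0 ≤ (1 + γ) / (c ^ 2 / Real.pi) := by positivity
  have hfin : (1 - γ) * D P ξ N ≤ A + (1 + γ) / c ^ 2 * Real.log N := by
    refine hD.trans (hcmp.trans ((add_le_add le_rfl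
      (mul_le_mul_of_nonneg_left hB hcoef)).trans (le_of_eq ?_)))
    rw [hA]
    have := Real.pi_pos
    field_simp
    ring
  have h1γ : 0 < 1 - γ := by linarith
  have hD2 : D P ξ N ≤ A / (1 - γ) + (1 + γ) / (1 - γ) / c ^ 2 * Real.log N := by
    have : D P ξ N ≤ (A + (1 + γ) / c ^ 2 * Real.log N) / (1 - γ) := by
      rw [le_div_iff₀ h1γ]; linarith
    refine this.trans (le_of_eq ?_)
    field_simp
  have hγ2 : (1 + γ) / (1 - γ) ≤ 1 + δ / 2 := by
    rw [div_le_iff₀ h1γ, hγ]; nlinarith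
  rw [div_le_iff₀ (by positivity)] at hN
  have h5 : (1 + γ) / (1 - γ) / c ^ 2 * Real.log N ≤ (1 + δ / 2) / c ^ 2 * Real.log N := by
    gcongr
  refine hD2.trans ((add_le_add hN h5).trans (le_of_eq ?_))
  field_simp
  ring

end Overlap

/-! ### Logarithmic asymptotics of the critical point -/

section CriticalPoint

variable {S : Type*} [MeasurableSpace S] {Ω : Type*} [MeasurableSpace Ω]
  {P : Measure S} [IsProbabilityMeasure P] {ξ : ℕ → S → ℕ} {φ : ℝ → ℝ}
  {Q : Measure Ω} [IsProbabilityMeasure Q] {ω : ℕ → Ω → ℝ}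

-- A nonpositive critical point is sent to `0`, with logarithm `-∞`, so monotonicity alone suffices.
omit [IsProbabilityMeasure P] [IsProbabilityMeasure Q] in
lemma mul_log_criticalPoint_le {β H : ℝ} (hH : 0 < H)
    (h : criticalPoint P ξ Q ω β ≤ H) :
    ((β ^ 2 : ℝ) : EReal) * ENNReal.log (criticalPoint P ξ Q ω β).toENNReal ≤
      ((β ^ 2 * Real.log H : ℝ) : EReal) := by
  have h1 : (criticalPoint P ξ Q ω β).toENNReal ≤ ENNReal.ofReal H := by
    have := EReal.toENNReal_le_toENNReal h
    rwa [EReal.toENNReal_of_ne_top (EReal.coe_ne_top H), EReal.toReal_coe] at this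
  have h2 := ENNReal.log_monotone h1
  rw [ENNReal.log_ofReal_of_pos hH] at h2
  rw [EReal.coe_mul]
  exact mul_le_mul_of_nonneg_left h2 (EReal.coe_nonneg.2 (sq_nonneg β))

lemma eventually_criticalPoint_le_one (hφ : SlowlyVarying φ) (hξ : IsRenewalIncrements P ξ φ)
    (hω : IsDisorder Q ω) : ∀ᶠ β in 𝓝[>] (0 : ℝ), criticalPoint P ξ Q ω β ≤ ((1 : ℝ) : EReal) := by
  obtain ⟨β₀, hβ₀, N₀, hmain⟩ := exists_freeEnergy_pos hφ hξ hω (ε := 1 / 2) (by norm_num)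
    (by norm_num)
  have hev := (tendsto_div_sq_atTop (show (0 : ℝ) < 1 - 1 / 2 by norm_num)).eventually
    (eventually_ge_atTop (D P ξ (N₀ + 1)))
  filter_upwards [hev, Ioc_mem_nhdsGT hβ₀] with β hβ hβ'
  refine (criticalPoint_le (hmain β hβ'.1 hβ'.2 (N₀ + 1) (by omega) hβ)).trans ?_
  refine EReal.coe_le_coe_iff.2 (Real.rpow_le_one_of_one_le_of_nonpos ?_ (by norm_num))
  push_cast
  linarith [Nat.cast_nonneg (α := ℝ) N₀]

/-- The integer is chosen so that `(1 + ε) c⁻² log N ≤ (1 - ε) / β²`; by `eventually_D_le` this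
length is admissible. -/
lemma eventually_criticalPoint_le_rpow (hφ : SlowlyVarying φ) (hξ : IsRenewalIncrements P ξ φ)
    (hω : IsDisorder Q ω) {c : ℝ} (hc : Tendsto (fun n : ℕ => φ n) atTop (𝓝 c)) (hc0 : 0 < c)
    {ε : ℝ} (hε : 0 < ε) (hε1 : ε < 1) :
    ∀ᶠ β in 𝓝[>] (0 : ℝ), criticalPoint P ξ Q ω β ≤
      ((((⌊Real.exp (c ^ 2 * (1 - ε) / (1 + ε) / β ^ 2)⌋₊ : ℕ) : ℝ) ^ (-(1 / 2) * (1 - ε)) : ℝ) :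
        EReal) := by
  obtain ⟨β₀, hβ₀, N₀, hmain⟩ := exists_freeEnergy_pos hφ hξ hω hε hε1
  obtain ⟨N₁, hN₁⟩ := eventually_atTop.1 (eventually_D_le hφ hξ hc hc0 hε hε1)
  have ha : 0 < c ^ 2 * (1 - ε) / (1 + ε) := by
    have : 0 < 1 - ε := by linarith
    positivity
  have hev := (tendsto_nat_floor_atTop.comp (Real.tendsto_exp_atTop.comp
    (tendsto_div_sq_atTop ha))).eventually (eventually_ge_atTop (max N₀ (N₁ + 1)))
  filter_upwards [hev, Ioc_mem_nhdsGT hβ₀] with β hβ hβ'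
  simp only [Function.comp] at hβ
  set N := ⌊Real.exp (c ^ 2 * (1 - ε) / (1 + ε) / β ^ 2)⌋₊ with hN
  refine criticalPoint_le (hmain β hβ'.1 hβ'.2 N ((le_max_left _ _).trans hβ) ?_)
  have hN1 : N₁ + 1 ≤ N := (le_max_right _ _).trans hβ
  have hNpos : (0 : ℝ) < N := by
    have : 0 < N := by omega
    exact_mod_cast this
  have hlog : Real.log N ≤ c ^ 2 * (1 - ε) / (1 + ε) / β ^ 2 := by
    rw [Real.log_le_iff_le_exp hNpos]
    exact Nat.floor_le (Real.exp_pos _).le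
  refine (hN₁ N (by omega)).trans ((mul_le_mul_of_nonneg_left hlog (by positivity)).trans
    (le_of_eq ?_))
  have := hβ'.1
  field_simp

theorem limsup_mul_log_criticalPoint_le (hφ : SlowlyVarying φ) (hξ : IsRenewalIncrements P ξ φ)
    (hω : IsDisorder Q ω) {c : ℝ} (hc : Tendsto (fun n : ℕ => φ n) atTop (𝓝 c)) :
    limsup (fun β : ℝ =>
        ((β ^ 2 : ℝ) : EReal) * ENNReal.log (criticalPoint P ξ Q ω β).toENNReal)
      (𝓝[>] 0) ≤ ((-(1 / 2) * c ^ 2 : ℝ) : EReal) := by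
  have hc0 : 0 ≤ c := ge_of_tendsto hc
    ((tendsto_natCast_atTop_atTop.eventually hφ.eventually_pos).mono fun n hn => hn.le)
  rcases hc0.eq_or_lt with rfl | hc0
  -- For `c = 0` the target is `0`, so a critical point at most one suffices; the overlap estimate
  -- is not available here.
  · refine limsup_le_of_le (by isBoundedDefault) ?_
    filter_upwards [eventually_criticalPoint_le_one hφ hξ hω] with β hβ
    simpa using mul_log_criticalPoint_le one_pos hβ
  refine EReal.le_of_forall_lt_iff_le.1 fun y hy => ?_
  have hy' : -(1 / 2) * c ^ 2 < y := EReal.coe_lt_coe_iff.1 hy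
  obtain ⟨ε, hε, hε1, hεy⟩ : ∃ ε : ℝ, 0 < ε ∧ ε < 1 ∧
      -(1 / 2) * (1 - ε) * (c ^ 2 * (1 - ε) / (1 + ε)) < y := by
    have h1 : ContinuousAt (fun ε : ℝ => -(1 / 2) * (1 - ε) * (c ^ 2 * (1 - ε) / (1 + ε))) 0 := by
      refine ContinuousAt.mul (by fun_prop) (ContinuousAt.div (by fun_prop) (by fun_prop) ?_)
      norm_num
    have h2 : ∀ᶠ ε : ℝ in 𝓝[>] 0,
        -(1 / 2) * (1 - ε) * (c ^ 2 * (1 - ε) / (1 + ε)) < y := by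
      refine (h1.tendsto.mono_left nhdsWithin_le_nhds).eventually (gt_mem_nhds ?_)
      simpa using hy'
    obtain ⟨ε, h3, h4⟩ := (h2.and (Ioo_mem_nhdsGT (one_pos (α := ℝ)))).exists
    exact ⟨ε, h4.1, h4.2, h3⟩
  set a := c ^ 2 * (1 - ε) / (1 + ε) with ha
  have ha0 : 0 < a := by
    have : 0 < 1 - ε := by linarith
    positivity
  -- The integer part costs at most a factor `2`, hence the term `β² log 2`, which vanishes in the
  -- limit.
  have hlim : Tendsto (fun β : ℝ => -(1 / 2) * (1 - ε) * (a - β ^ 2 * Real.log 2)) (𝓝[>] 0)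
      (𝓝 (-(1 / 2) * (1 - ε) * (a - 0 ^ 2 * Real.log 2))) := by
    refine Tendsto.mono_left (Continuous.tendsto ?_ 0) nhdsWithin_le_nhds
    fun_prop
  have hev := hlim.eventually (gt_mem_nhds (show _ < y by simpa using hεy))
  have hlarge := (tendsto_div_sq_atTop ha0).eventually (eventually_ge_atTop 1)
  refine limsup_le_of_le (by isBoundedDefault) ?_
  filter_upwards [eventually_criticalPoint_le_rpow hφ hξ hω hc hc0 hε hε1, hev, hlarge,
    self_mem_nhdsWithin] with β hβ1 hβ2 hβ3 hβ4
  have hβ0 : 0 < β := hβ4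
  set x := a / β ^ 2 with hx
  have hexp : 2 ≤ Real.exp x := by
    have := Real.add_one_le_exp x
    linarith
  set N := ⌊Real.exp x⌋₊ with hN
  have hNle : Real.exp x / 2 ≤ N := by
    have := Nat.lt_floor_add_one (Real.exp x)
    linarith
  have hN0 : (0 : ℝ) < N := by linarith
  refine (mul_log_criticalPoint_le (Real.rpow_pos_of_pos hN0 _) hβ1).trans
    (EReal.coe_le_coe_iff.2 (le_trans ?_ hβ2.le))
  have hlogN : x - Real.log 2 ≤ Real.log N := by
    have := Real.log_le_log (by positivity) hNle
    rwa [Real.log_div (Real.exp_pos x).ne' (by norm_num), Real.log_exp] at this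
  rw [Real.log_rpow hN0]
  have h1 : a - β ^ 2 * Real.log 2 = β ^ 2 * (x - Real.log 2) := by
    rw [hx]; field_simp
  rw [h1]
  have h2 : β ^ 2 * (x - Real.log 2) ≤ β ^ 2 * Real.log N :=
    mul_le_mul_of_nonneg_left hlogN (sq_nonneg β)
  nlinarith

end CriticalPoint

end

end Pinning

theorem mainTheorem4 {S : Type*} [MeasurableSpace S] {Ω : Type*} [MeasurableSpace Ω]
    (P : Measure S) [IsProbabilityMeasure P] (ξ : ℕ → S → ℕ) (φ : ℝ → ℝ)
    (hφ : Pinning.SlowlyVarying φ) (hξ : Pinning.IsRenewalIncrements P ξ φ)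
    (Q : Measure Ω) [IsProbabilityMeasure Q] (ω : ℕ → Ω → ℝ) (hω : Pinning.IsDisorder Q ω) :
    (∀ ε : ℝ, 0 < ε → ε < 1 → ∃ β₀ : ℝ, 0 < β₀ ∧ ∀ β : ℝ, 0 < β → β ≤ β₀ →
      Pinning.criticalPoint P ξ Q ω β ≤
        (((Pinning.DInv P ξ ((1 - ε) / β ^ 2) : ℝ≥0∞) ^ (-(1 / 2) * (1 - ε) : ℝ) : ℝ≥0∞) :
          EReal)) ∧
    (∀ c : ℝ, Tendsto (fun n : ℕ => φ n) atTop (𝓝 c) →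
      limsup (fun β : ℝ =>
          ((β ^ 2 : ℝ) : EReal) * ENNReal.log (Pinning.criticalPoint P ξ Q ω β).toENNReal)
        (𝓝[>] 0) ≤ ((-(1 / 2) * c ^ 2 : ℝ) : EReal)) :=
  ⟨fun _ hε hε1 => Pinning.criticalPoint_le_DInv hφ hξ hω hε hε1,
    fun _ hc => Pinning.limsup_mul_log_criticalPoint_le hφ hξ hω hc⟩
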